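/- **Setting.** Let $P\subset\mathbb R^2$ be a finite set with no three points collinear, let $\gamma>0$, $i\in\mathbb Z$ and $s=\gamma 3^{i-1}$, and consider an axis-parallel grid of half-open square cells of side $s$. For a point $p$ let $N(p)$ be the $3\times3$ block of cells centred at the cell containing $p$. Let $A$ be a planar straight-line graph on $P$ all of whose edges $pq$ satisfy $q\in N(p)$, and which is inclusion-maximal among such graphs. Let $f$ be a face of $A$ (a component of the complement of the drawing) which is not an open triangle with vertices in $P$. Let $\sigma(f)=\langle v_0,\dots,v_{m-1}\rangle$ be a boundary vertex sequence of $f$: the vertex sequence of a closed facial walk along edges of $A$, having $f$ on its right. Indices are extended $m$-periodically to $\mathbb Z$; a vertex may occur several times, and a vertex of $\sigma(f)$ means an occurrence with its interior angle. A vertex $v_k$ is *convex* (*reflex*) if its interior angle is $<\pi$ ($>\pi$). Two vertices $v_k,v_l$ are *visible* to each other if the open segment between them is contained in $f$ and leaves both ends inside the interior angles at these occurrences. For $k\le l$, $\mathbb C(v_k,v_l)$ is the chain $v_k,v_{k+1},\dots,v_l$ of $\sigma(f)$. An edge $xy$ of $A$ is *$\delta$-visible* from $v_k$ if there is a point $z$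 on $xy$ with $\|v_kz\|\le\delta$ such that the open segment $v_kz$ is contained in $f$ and leaves $v_k$ inside its interior angle. The *forward convex vertex* of $v_p$ is the first convex vertex after $v_p$ and its *forward support vertex* is the vertex following that one. The *backward convex vertex* is the last convex vertex before $v_p$ and the *backward support vertex* is the vertex preceding that one. **Phase 1.** Choose as start vertex $v_j$ a backward support vertex of a reflex vertex, i.e. one for which $v_{j+1}$ is convex and $v_{j+2}$ reflex; if there is none, choose any vertex. Process vertices in order, beginning with $v_j$. To process $v_p$, let $v_{l-1}$ and $v_l$ be its forward convex and forward support vertices. * *Step 1.* If these exist, $v_{l-1}\in N(v_p)$ and $v_l$ is visible to $v_p$, generate a chain $\mathbb C(v_p,v_e)$, with $e$ as follows. (a) Suppose $v_{l+1}$ is reflex and its backward convex vertex $v_{q+1}$ and backward support vertex $v_q$ satisfy $v_{q+1}\in N(v_{l+1})$ and $v_q$ is visible to $v_{l+1}$. Then $v_e$ is the last vertex of the run of consecutive reflex vertices beginning with $v_{l+1}$ such that $v_{q+1}\in N(v_e)$ and $v_q$ is visible to $v_e$. (b) Otherwise $e=l$. (c) If instead $v_{l-1}$ was already visited (its index is at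 least $j+m$), this last chain is merged with the first chain $\mathbb C(v_j,v_{j'})$ into $\mathbb C(v_p,v_{j'})$, and $v_j$ is dropped from the final sequence. * *Step 2.* Otherwise generate the trivial chain $\mathbb C(v_p,v_{p+1})$. The end of the chain is the next vertex processed; stop when the round is complete, i.e. when index $j+m$ is reached or passed. Let $\sigma(f')=\langle v_{j_0},v_{j_1},\dots\rangle$ be the sequence of processed vertices, without $v_j$ in case (c), where the subscript $r$ of $j_r$ is extended cyclically over $\mathbb Z$ (so that one round increases $j_r$ by $m$). The chains $\mathbb C(v_{j_r},v_{j_{r+1}})$ are the *maximal triangulated chains*. **Lemma.** Let $\delta=\gamma3^{i-1}/\sqrt2$, let $v=v_a$ be a vertex of $\sigma(f)$ and let $xy$ be an edge of $A$ that is $\delta$-visible from $v$, its endpoints being named so that $v$ lies to the right of the line directed from $x$ to $y$. Then $v$ lies on some maximal triangulated chain ($j_r\le a<j_{r+1}$ for some $r$), and: 1. whenever $v$ is in the interior of $\mathbb C(v_{j_r},v_{j_{r+1}})$, i.e. $j_r<a<j_{r+1}$, the edge $xy$ occurs in $\sigma(f)$ as consecutive vertices $x=v_b$, $y=v_{b+1}$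 such that $\{x,y,v\}\subseteq\mathbb C(v_{j_{r-1}},v_{j_{r+1}})$ or $\{x,y,v\}\subseteq\mathbb C(v_{j_r},v_{j_{r+2}})$; 2. whenever $v=v_{j_r}$, i.e. $a=j_r$, the edge $xy$ occurs in $\sigma(f)$ as consecutive vertices $x=v_b$, $y=v_{b+1}$ such that $\{x,y,v\}\subseteq\mathbb C(v_{j_r},v_{j_{r+1}})$ or $\{x,y,v\}\subseteq\mathbb C(v_{j_{r-1}},v_{j_r})$. The inclusions are meant for the occurrences $a,b,b+1$. In particular $v,x,y$ lie in one maximal triangulated chain or in two consecutive ones. -/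

import Mathlib

open Set Filter Topology

noncomputable section

/-! The plane is `ℂ`. -/

/-- The index of the cell of the axis-parallel grid with corner `o` and side length `s`
that contains `p`; cells are half-open squares. -/
def cell (o : ℂ) (s : ℝ) (p : ℂ) : ℤ × ℤ :=
  (⌊(p.re - o.re) / s⌋, ⌊(p.im - o.im) / s⌋)

/-- `q` lies in the `3 × 3` block of cells `N(p)` centred at the cell of `p`. -/
def Near (o : ℂ) (s : ℝ) (p q : ℂ) : Prop :=
  |(cell o s p).1 - (cell o s q).1| ≤ 1 ∧ |(cell o s p).2 - (cell o s q).2| ≤ 1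

/-- The graph on `P` joining any two distinct points each in the block of the other. -/
def nearGraph (P : Finset ℂ) (o : ℂ) (s : ℝ) : SimpleGraph ℂ where
  Adj p q := p ∈ P ∧ q ∈ P ∧ p ≠ q ∧ Near o s p q
  symm := ⟨fun p q h => ⟨h.2.1, h.1, h.2.2.1.symm, by
    simpa [Near, abs_sub_comm] using h.2.2.2⟩⟩
  loopless := ⟨fun _ h => h.2.2.1 rfl⟩

/-- `G` is a planar straight-line graph with vertex set `P`. -/
structure IsPSLG (P : Finset ℂ) (G : SimpleGraph ℂ) : Prop where
  mem : ∀ p q, G.Adj p q → p ∈ P ∧ q ∈ P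
  vertex_free : ∀ p q, G.Adj p q → ∀ w ∈ P, w ∉ openSegment ℝ p q
  non_crossing : ∀ p q p' q', G.Adj p q → G.Adj p' q' → s(p, q) ≠ s(p', q') →
    Disjoint (openSegment ℝ p q) (openSegment ℝ p' q')

/-- `A` is a maximal planar straight-line subgraph of the near graph. -/
def IsMaximalPSLG (P : Finset ℂ) (o : ℂ) (s : ℝ) (A : SimpleGraph ℂ) : Prop :=
  Maximal (fun G : SimpleGraph ℂ => IsPSLG P G ∧ G ≤ nearGraph P o s) A

/-- The set of points of the plane covered by the drawing of `A`. -/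
def drawing (P : Finset ℂ) (A : SimpleGraph ℂ) : Set ℂ :=
  (P : Set ℂ) ∪ {z | ∃ p q, A.Adj p q ∧ z ∈ segment ℝ p q}

/-- A face is a connected component of the complement of the drawing. -/
def IsFace (P : Finset ℂ) (A : SimpleGraph ℂ) (f : Set ℂ) : Prop :=
  ∃ z ∈ (drawing P A)ᶜ, f = connectedComponentIn (drawing P A)ᶜ z

/-- The face is an open triangle with vertices in `P`. -/
def IsTriangularFace (P : Finset ℂ) (f : Set ℂ) : Prop :=
  ∃ p ∈ P, ∃ q ∈ P, ∃ r ∈ P, f = interior (convexHull ℝ {p, q, r})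

/-- The counterclockwise angle in `(0, 2π]` from the nonzero vector `a` to the nonzero
vector `d`. -/
def ccwAngle (a d : ℂ) : ℝ :=
  if (d / a).arg ≤ 0 then (d / a).arg + 2 * Real.pi else (d / a).arg

/-- The angle in `(0, 2π]` at the `k`-th vertex of the walk `v`, measured on the right-hand
side of the walk. -/
def cornerAngle (v : ℤ → ℂ) (k : ℤ) : ℝ :=
  ccwAngle (v (k - 1) - v k) (v (k + 1) - v k)

/-- `v` is the boundary vertex sequence `⟨v 0, …, v (m - 1)⟩` of (a component of the boundary
of) the face `f`, continued periodically to all integers: a closed walk along edges of `A`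
which has `f` on its right, which leaves each vertex by the first edge that follows the
edge of arrival on the side of `f`, and which uses each edge at most once in each
direction. -/
structure IsBoundaryWalk (A : SimpleGraph ℂ) (f : Set ℂ) (v : ℤ → ℂ) (m : ℕ) : Prop where
  pos : 0 < m
  periodic : ∀ k, v (k + m) = v k
  minimal : ∀ d : ℕ, 0 < d → d < m → ¬ (v d = v 0 ∧ v (d + 1) = v 1)
  adj : ∀ k, A.Adj (v k) (v (k + 1))
  next : ∀ k w, A.Adj (v k) w → cornerAngle v k ≤ ccwAngle (v (k - 1) - v k) (w - v k)
  right : ∀ k, ∀ᶠ ε : ℝ in 𝓝[>] 0,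
    (v k + v (k + 1)) / 2 - (ε : ℂ) * Complex.I * (v (k + 1) - v k) ∈ f

/-- The interior angle at the `k`-th vertex is less than `π`. -/
def ConvexAt (v : ℤ → ℂ) (k : ℤ) : Prop := cornerAngle v k < Real.pi

/-- The interior angle at the `k`-th vertex is greater than `π`. -/
def ReflexAt (v : ℤ → ℂ) (k : ℤ) : Prop := Real.pi < cornerAngle v k

/-- From the `k`-th vertex, the point `z` is seen within `f` and inside the corner that the
walk forms there (a vertex may occur several times on the walk). -/
def SeesPoint (f : Set ℂ) (v : ℤ → ℂ) (k : ℤ) (z : ℂ) : Prop :=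
  openSegment ℝ (v k) z ⊆ f ∧ ccwAngle (v (k - 1) - v k) (z - v k) < cornerAngle v k

/-- The `k`-th and the `l`-th vertex of the walk are visible to each other. -/
def Sees (f : Set ℂ) (v : ℤ → ℂ) (k l : ℤ) : Prop :=
  SeesPoint f v k (v l) ∧ SeesPoint f v l (v k)

/-- Some point of the edge from `x` to `y`, at distance at most `δ`, is seen from the `k`-th
vertex of the walk, which lies to the right of the line directed from `x` to `y`. -/
def DeltaVisible (f : Set ℂ) (v : ℤ → ℂ) (δ : ℝ) (k : ℤ) (x y : ℂ) : Prop :=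
  ((starRingEnd ℂ) (y - x) * (v k - x)).im < 0 ∧
    ∃ z ∈ segment ℝ x y, SeesPoint f v k z ∧ dist (v k) z ≤ δ

/-- Position of the forward convex vertex of the `p`-th vertex. The forward support vertex
is the vertex after it. -/
def forwardConvex (v : ℤ → ℂ) (p : ℤ) : ℤ := sInf {c | p < c ∧ ConvexAt v c}

/-- Position of the backward convex vertex of the `p`-th vertex. The backward support vertex
is the vertex before it. -/
def backwardConvex (v : ℤ → ℂ) (p : ℤ) : ℤ := sSup {c | c < p ∧ ConvexAt v c}

/-- The precondition of Step 1 at the `p`-th vertex: its forward convex vertex exists and is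
near, and its forward support vertex is visible. -/
def StepOne (o : ℂ) (s : ℝ) (f : Set ℂ) (v : ℤ → ℂ) (p : ℤ) : Prop :=
  ConvexAt v (forwardConvex v p) ∧ Near o s (v p) (v (forwardConvex v p)) ∧
    Sees f v p (forwardConvex v p + 1)

/-- For a reflex vertex at position `k` whose backward convex vertex is at position `d`: that
vertex is near, and the backward support vertex is visible. -/
def BackwardOK (o : ℂ) (s : ℝ) (f : Set ℂ) (v : ℤ → ℂ) (d k : ℤ) : Prop :=
  Near o s (v k) (v d) ∧ Sees f v k (d - 1)

/-- Step 1(a) applies when the forward support vertex is at position `l`. -/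
def StepOneA (o : ℂ) (s : ℝ) (f : Set ℂ) (v : ℤ → ℂ) (l : ℤ) : Prop :=
  ReflexAt v (l + 1) ∧ BackwardOK o s f v (backwardConvex v (l + 1)) (l + 1)

/-- In Step 1(a), the position of the last vertex, in the run of reflex vertices starting at
`l + 1`, that is near the backward convex vertex and sees the backward support vertex of
the vertex at `l + 1`. -/
def extendedEnd (o : ℂ) (s : ℝ) (f : Set ℂ) (v : ℤ → ℂ) (l : ℤ) : ℤ :=
  sSup {e | l < e ∧ (∀ k, l < k → k ≤ e → ReflexAt v k) ∧
    BackwardOK o s f v (backwardConvex v (l + 1)) e}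

open Classical in
/-- The last position of the chain generated when the `p`-th vertex is processed: Step 1
with (a), Step 1 without (a), and Step 2 (a single boundary edge). -/
def chainEnd (o : ℂ) (s : ℝ) (f : Set ℂ) (v : ℤ → ℂ) (p : ℤ) : ℤ :=
  if StepOne o s f v p then
    if StepOneA o s f v (forwardConvex v p + 1) then
      extendedEnd o s f v (forwardConvex v p + 1)
    else forwardConvex v p + 1
  else p + 1

/-- A start vertex: a backward support vertex of some reflex vertex, that is, a vertex
followed by a convex and then a reflex one; any vertex if there is none of this kind. -/
def IsStart (v : ℤ → ℂ) (j : ℤ) : Prop :=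
  (ConvexAt v (j + 1) ∧ ReflexAt v (j + 2)) ∨ ¬ ∃ k, ConvexAt v (k + 1) ∧ ReflexAt v (k + 2)

/-- The positions of the vertices processed from position `p` on, before position `bound`, in
at most `fuel` steps. -/
def processedFrom (o : ℂ) (s : ℝ) (f : Set ℂ) (v : ℤ → ℂ) (bound : ℤ) : ℕ → ℤ → List ℤ
  | 0, _ => []
  | fuel + 1, p =>
    if p < bound then p :: processedFrom o s f v bound fuel (chainEnd o s f v p) else []

/-- The positions of the vertices processed in Phase 1 in one round along the walk. Each step
advances by at least one position, so that `m` steps suffice. -/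
def processed (o : ℂ) (s : ℝ) (f : Set ℂ) (v : ℤ → ℂ) (m : ℕ) (j : ℤ) : List ℤ :=
  processedFrom o s f v (j + m) m j

/-- Step 1(c) is executed: for some processed vertex Step 1 is executed with a forward convex
vertex that was already visited, that is, beyond the end of the round. -/
def StepOneC (o : ℂ) (s : ℝ) (f : Set ℂ) (v : ℤ → ℂ) (m : ℕ) (j : ℤ) : Prop :=
  ∃ p ∈ processed o s f v m j, StepOne o s f v p ∧ j + m ≤ forwardConvex v p

open Classical in
/-- The positions, in one round, of the vertices that remain after Phase 1. In Step 1(c) the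
last chain is merged with the first one, and the start vertex disappears. -/
def remaining (o : ℂ) (s : ℝ) (f : Set ℂ) (v : ℤ → ℂ) (m : ℕ) (j : ℤ) : List ℤ :=
  if StepOneC o s f v m j then (processed o s f v m j).tail else processed o s f v m j

/-- The `r`-th vertex after Phase 1 is `v (remainingIndex … r)`; `r` runs over all integers,
continuing the list periodically. -/
def remainingIndex (o : ℂ) (s : ℝ) (f : Set ℂ) (v : ℤ → ℂ) (m : ℕ) (j r : ℤ) : ℤ :=
  let L := remaining o s f v m j
  L.getD (r % (L.length : ℤ)).toNat 0 + r / (L.length : ℤ) * (m : ℤ)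

end

/-!
The vertices between a viewer `v a` and an edge `x y` that it sees within distance `s / √2` form a
short and very regular piece of the boundary walk, and Phase 1 cannot cut such a piece badly.

*Geometry.* As `v a` is within `s / √2` of a point `z` of the edge, it is near one of the ends of
the edge (`near_or_near`), say `y`. Then the triangle `v z x` contains no further vertices
(`View.eq_of_mem`): the support lines of the vertices in the triangles `v z x` and `v z y` give
pairs of vertices that see each other across the line of sight, none of these pairs can be near by
maximality of `A`, and the positions of their cells contradict this. If `v a` were also near `x`,
it would be joined to both ends and the face would be a triangle (`View.not_near`); so `v a` sees
`x` through the face. The vertices in the triangle `x v y` other than `x` are pairwise near, so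
consecutive vertices of their convex hull on the side of `x` are joined by edges
(`SeesEnd.exists_chainEdge`), and these edges are consecutive edges of the walk. Hence the walk
runs through `x`, `y`, a chain of reflex vertices, and `v a`; here `y` is a convex vertex, and all
vertices of the chain are near `y` and see `x`. If `v a` is near `x` instead, the walk runs through
`v a`, a chain, `x`, and `y`, and the roles of `x` and `y` are exchanged
(`IsBoundaryWalk.exists_of_deltaVisible`).

*Phase 1.* Seeing a support vertex past a near convex vertex is just the condition of Step 1. The
two neighbours of a convex vertex always see each other (`IsBoundaryWalk.sees_of_convexAt`), so Step
1 also applies just before every convex vertex. If the chain follows the viewer, every processed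
vertex between the viewer and the edge makes Phase 1 jump over the edge. If the chain precedes the
viewer, part (a) of Step 1 extends the generated chain that contains the edge to the viewer, or to
the vertex before it when the viewer is convex (`le_chainEnd_of_backward`); in the latter case Step
1 makes the next chain pass over the viewer. All of this is periodic along the walk; the merging in
part (c) of Step 1 is possible only at a start vertex, which a convex vertex follows
(`exists_round`).
-/

/-! ### Plane coordinates -/

/-- The determinant of two plane vectors; positive when `b` lies counterclockwise of `a` by less
than a half turn. -/
def cross (a b : ℂ) : ℝ := a.re * b.im - a.im * b.re

/-- Real functions on the plane that are affine along every segment. -/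
def IsAff (g : ℂ → ℝ) : Prop :=
  ∀ (a b : ℂ) (t : ℝ), g ((1 - t) • a + t • b) = (1 - t) * g a + t * g b

theorem IsAff.comb {g h : ℂ → ℝ} (hg : IsAff g) (hh : IsAff h) (l m c : ℝ) :
    IsAff fun q => l * g q + m * h q + c := by
  intro a b t
  simp only [hg a b t, hh a b t]
  ring

/-- Coordinates of a point with respect to a triangle `O a b`: the vertex `O` is the origin and
the two other vertices are the unit points. -/
structure Coords (O a b : ℂ) (p h : ℂ → ℝ) : Prop where
  aff_fst : IsAff p
  aff_snd : IsAff h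
  eq : ∀ q, q = O + p q • (a - O) + h q • (b - O)
  fst : ∀ α β : ℝ, p (O + α • (a - O) + β • (b - O)) = α
  snd : ∀ α β : ℝ, h (O + α • (a - O) + β • (b - O)) = β
  cont_fst : Continuous p
  cont_snd : Continuous h

theorem exists_coords {O a b : ℂ} (H : cross (a - O) (b - O) ≠ 0) :
    ∃ p h, Coords O a b p h := by
  refine ⟨fun q => cross (q - O) (b - O) / cross (a - O) (b - O),
    fun q => cross (a - O) (q - O) / cross (a - O) (b - O), ?_, ?_, ?_, ?_, ?_, ?_, ?_⟩
  · intro u w t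
    simp [cross]
    field_simp
    ring
  · intro u w t
    simp [cross]
    field_simp
    ring
  · intro q
    apply Complex.ext
    · simp only [cross, Complex.add_re, Complex.real_smul, Complex.mul_re, Complex.sub_re,
        Complex.sub_im, Complex.ofReal_re, Complex.ofReal_im] at H ⊢
      generalize hD : (a.re - O.re) * (b.im - O.im) - (a.im - O.im) * (b.re - O.re) = D at H ⊢
      field_simp
      rw [← hD]
      ring
    · simp only [cross, Complex.add_im, Complex.real_smul, Complex.mul_im, Complex.sub_re,
        Complex.sub_im, Complex.ofReal_re, Complex.ofReal_im] at H ⊢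
      generalize hD : (a.re - O.re) * (b.im - O.im) - (a.im - O.im) * (b.re - O.re) = D at H ⊢
      field_simp
      rw [← hD]
      ring
  · intro α β
    rw [div_eq_iff H]
    simp [cross]
    ring
  · intro α β
    rw [div_eq_iff H]
    simp [cross]
    ring
  · unfold cross
    fun_prop
  · unfold cross
    fun_prop

namespace Coords

variable {O a b : ℂ} {p h : ℂ → ℝ}

theorem fst_O (c : Coords O a b p h) : p O = 0 := by simpa using c.fst 0 0
theorem snd_O (c : Coords O a b p h) : h O = 0 := by simpa using c.snd 0 0
theorem fst_a (c : Coords O a b p h) : p a = 1 := by simpa using c.fst 1 0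
theorem snd_a (c : Coords O a b p h) : h a = 0 := by simpa using c.snd 1 0
theorem fst_b (c : Coords O a b p h) : p b = 0 := by simpa using c.fst 0 1
theorem snd_b (c : Coords O a b p h) : h b = 1 := by simpa using c.snd 0 1

theorem ext (c : Coords O a b p h) {q r : ℂ} (h1 : p q = p r) (h2 : h q = h r) : q = r := by
  rw [c.eq q, c.eq r, h1, h2]

theorem swap (c : Coords O a b p h) : Coords O b a h p :=
  ⟨c.aff_snd, c.aff_fst, fun q => by rw [add_right_comm]; exact c.eq q,
    fun α β => by rw [add_right_comm]; exact c.snd β α,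
    fun α β => by rw [add_right_comm]; exact c.fst β α, c.cont_snd, c.cont_fst⟩

/-- Collinearity of three points in terms of their coordinates. -/
theorem collinear (c : Coords O a b p h) {q r s : ℂ}
    (H : (p r - p q) * (h s - h q) = (h r - h q) * (p s - p q)) : Collinear ℝ {q, r, s} := by
  by_cases hrq : r = q
  · subst hrq
    simpa using collinear_pair ℝ r s
  rw [collinear_iff_of_mem (p₀ := q) (by simp)]
  refine ⟨r - q, ?_⟩
  have key : ∀ t : ℝ, p s = p q + t * (p r - p q) → h s = h q + t * (h r - h q) →
      s = t • (r - q) + q := by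
    intro t h1 h2
    have : t • (r - q) + q = (1 - t) • q + t • r := by module
    rw [this]
    apply c.ext
    · rw [c.aff_fst, h1]; ring
    · rw [c.aff_snd, h2]; ring
  have hs : ∃ t : ℝ, s = t • (r - q) + q := by
    by_cases h1 : p r - p q = 0
    · have h2 : h r - h q ≠ 0 := by
        intro h2
        exact hrq (c.ext (by linarith) (by linarith))
      refine ⟨(h s - h q) / (h r - h q), key _ ?_ ?_⟩
      · rw [h1] at H ⊢
        have : p s - p q = 0 := by
          rcases mul_eq_zero.1 (H.symm.trans (by ring)) with h3 | h3
          · exact absurd h3 h2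
          · exact h3
        linarith
      · field_simp; ring
    · refine ⟨(p s - p q) / (p r - p q), key _ ?_ ?_⟩
      · field_simp; ring
      · field_simp; linarith
  intro w hw
  simp only [mem_insert_iff, mem_singleton_iff] at hw
  rcases hw with rfl | rfl | rfl
  · exact ⟨0, by simp⟩
  · exact ⟨1, by simp⟩
  · simpa using hs

end Coords

theorem mem_segment_iff_lin {a b d : ℂ} :
    d ∈ segment ℝ a b ↔ ∃ t : ℝ, 0 ≤ t ∧ t ≤ 1 ∧ d = (1 - t) • a + t • b := by
  constructor
  · rintro ⟨u, w, hu, hw, huw, rfl⟩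
    exact ⟨w, hw, by linarith, by rw [← huw]; simp⟩
  · rintro ⟨t, h0, h1, rfl⟩
    exact ⟨1 - t, t, by linarith, h0, by ring, rfl⟩

theorem mem_openSegment_iff_lin {a b d : ℂ} :
    d ∈ openSegment ℝ a b ↔ ∃ t : ℝ, 0 < t ∧ t < 1 ∧ d = (1 - t) • a + t • b := by
  constructor
  · rintro ⟨u, w, hu, hw, huw, rfl⟩
    exact ⟨w, hw, by linarith, by rw [← huw]; simp⟩
  · rintro ⟨t, h0, h1, rfl⟩
    exact ⟨1 - t, t, by linarith, h0, by ring, rfl⟩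

theorem IsAff.convex_pos {g : ℂ → ℝ} (hg : IsAff g) : Convex ℝ {q | 0 < g q} := by
  intro a ha b hb u w hu hw huw
  have : u = 1 - w := by linarith
  subst this
  simp only [mem_ofPred_eq, hg a b w] at *
  rcases hu.eq_or_lt with h | h
  · have : w = 1 := by linarith
    subst this; simpa using hb
  · have := mul_pos h ha
    have := mul_nonneg hw hb.le
    linarith

theorem IsAff.convex_nonneg {g : ℂ → ℝ} (hg : IsAff g) : Convex ℝ {q | 0 ≤ g q} := by
  intro a ha b hb u w hu hw huw
  have : u = 1 - w := by linarith
  subst this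
  simp only [mem_ofPred_eq, hg a b w] at *
  have := mul_nonneg hu ha
  have := mul_nonneg hw hb
  linarith

/-! ### Planar straight-line graphs and their faces -/

section Graph

variable {P : Finset ℂ} {A : SimpleGraph ℂ} {f : Set ℂ}

/-- No three points of `P` are collinear. -/
def GenPos (P : Finset ℂ) : Prop :=
  ∀ a ∈ P, ∀ b ∈ P, ∀ c ∈ P, a ≠ b → a ≠ c → b ≠ c → ¬ Collinear ℝ {a, b, c}

theorem segment_subset_drawing {p q : ℂ} (h : A.Adj p q) : segment ℝ p q ⊆ drawing P A :=
  fun _ hz => Or.inr ⟨p, q, h, hz⟩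

theorem IsFace.subset (hf : IsFace P A f) : f ⊆ (drawing P A)ᶜ := by
  obtain ⟨z, -, rfl⟩ := hf
  exact connectedComponentIn_subset _ _

theorem IsFace.preconnected (hf : IsFace P A f) : IsPreconnected f := by
  obtain ⟨z, -, rfl⟩ := hf
  exact isPreconnected_connectedComponentIn

/-- A connected set off the drawing that meets a face lies in the face. -/
theorem IsFace.absorb (hf : IsFace P A f) {S : Set ℂ} (hS : IsPreconnected S)
    (hd : ∀ d ∈ S, d ∉ drawing P A) {w : ℂ} (hw : w ∈ S) (hwf : w ∈ f) : S ⊆ f := by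
  obtain ⟨z, -, rfl⟩ := hf
  rw [connectedComponentIn_eq hwf]
  exact hS.subset_connectedComponentIn hw hd

/-- If a point of an edge lies in the interior of another edge, the edges coincide. -/
theorem IsPSLG.same_edge (hG : IsPSLG P A) {r s x y d : ℂ} (hrs : A.Adj r s) (hxy : A.Adj x y)
    (hd : d ∈ segment ℝ r s) (hd' : d ∈ openSegment ℝ x y) : s(r, s) = s(x, y) := by
  by_contra hne
  by_cases h1 : d = r
  · subst h1
    exact hG.vertex_free x y hxy d (hG.mem _ _ hrs).1 hd'
  by_cases h2 : d = s
  · subst h2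
    exact hG.vertex_free x y hxy d (hG.mem _ _ hrs).2 hd'
  have := mem_openSegment_of_ne_left_right (Ne.symm h1) (Ne.symm h2) hd
  exact Set.disjoint_left.1 (hG.non_crossing r s x y hrs hxy hne) this hd'

/-- A vertex on an edge is one of its ends. -/
theorem IsPSLG.vertex_on_edge (hG : IsPSLG P A) {r s d : ℂ} (hrs : A.Adj r s)
    (hd : d ∈ segment ℝ r s) (hdP : d ∈ P) : d = r ∨ d = s := by
  by_contra! h
  exact hG.vertex_free r s hrs d hdP
    (mem_openSegment_of_ne_left_right (Ne.symm h.1) (Ne.symm h.2) hd)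

/-- In a maximal graph, two vertices with no part of the drawing between them are not near: the
segment between them could be added. -/
theorem IsMaximalPSLG.not_near {o : ℂ} {s : ℝ} (hA : IsMaximalPSLG P o s A) {p q : ℂ}
    (hp : p ∈ P) (hq : q ∈ P) (hpq : p ≠ q)
    (hfree : ∀ d ∈ openSegment ℝ p q, d ∉ drawing P A) : ¬ Near o s p q := by
  intro hN
  obtain ⟨⟨hG, hle⟩, hmax⟩ := hA
  have hnon : ∀ r t, A.Adj r t → Disjoint (openSegment ℝ p q) (openSegment ℝ r t) :=
    fun r t h => Set.disjoint_left.2 fun d hd hd' =>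
      hfree d hd (segment_subset_drawing h (openSegment_subset_segment _ _ _ hd'))
  have hfe : ∀ w ∈ P, w ∉ openSegment ℝ p q := fun w hw hd => hfree w hd (Or.inl hw)
  have hadj : ∀ r t, (A ⊔ SimpleGraph.edge p q).Adj r t →
      A.Adj r t ∨ (r = p ∧ t = q) ∨ (r = q ∧ t = p) := by
    intro r t h
    rw [SimpleGraph.sup_adj, SimpleGraph.edge_adj] at h
    tauto
  have hnew : IsPSLG P (A ⊔ SimpleGraph.edge p q) := by
    refine ⟨?_, ?_, ?_⟩
    · intro r t h
      rcases hadj r t h with h | ⟨rfl, rfl⟩ | ⟨rfl, rfl⟩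
      · exact hG.mem _ _ h
      · exact ⟨hp, hq⟩
      · exact ⟨hq, hp⟩
    · intro r t h
      rcases hadj r t h with h | ⟨rfl, rfl⟩ | ⟨rfl, rfl⟩
      · exact hG.vertex_free _ _ h
      · exact hfe
      · rw [openSegment_symm]; exact hfe
    · intro r t r' t' h h' hne
      rcases hadj r t h with k | ⟨rfl, rfl⟩ | ⟨rfl, rfl⟩ <;>
      rcases hadj r' t' h' with k' | ⟨rfl, rfl⟩ | ⟨rfl, rfl⟩
      · exact hG.non_crossing _ _ _ _ k k' hne
      · exact (hnon _ _ k).symm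
      · rw [openSegment_symm ℝ r']; exact (hnon _ _ k).symm
      · exact hnon _ _ k'
      · exact absurd rfl hne
      · exact absurd Sym2.eq_swap hne
      · rw [openSegment_symm ℝ r]; exact hnon _ _ k'
      · exact absurd Sym2.eq_swap hne
      · exact absurd rfl hne
  have hle' : A ⊔ SimpleGraph.edge p q ≤ nearGraph P o s := by
    intro r t h
    rcases hadj r t h with h | ⟨rfl, rfl⟩ | ⟨rfl, rfl⟩
    · exact hle h
    · exact ⟨hp, hq, hpq, hN⟩
    · exact SimpleGraph.Adj.symm (G := nearGraph P o s) ⟨hp, hq, hpq, hN⟩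
  have hA' : A.Adj p q := by
    refine hmax ⟨hnew, hle'⟩ le_sup_left ?_
    rw [SimpleGraph.sup_adj, SimpleGraph.edge_adj]
    exact Or.inr ⟨Or.inl ⟨rfl, rfl⟩, hpq⟩
  have hmid : (1 - (1 / 2 : ℝ)) • p + (1 / 2 : ℝ) • q ∈ openSegment ℝ p q :=
    mem_openSegment_iff_lin.2 ⟨1 / 2, by norm_num, by norm_num, rfl⟩
  exact hfree _ hmid (segment_subset_drawing hA' (openSegment_subset_segment _ _ _ hmid))

/-- Three functions affine along a segment, nonnegative at its start but not at its end: at some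
point all are still nonnegative and one vanishes. -/
theorem exists_exit {g₁ g₂ g₃ : ℂ → ℝ} (h₁ : IsAff g₁) (h₂ : IsAff g₂) (h₃ : IsAff g₃) {d r : ℂ}
    (d₁ : 0 ≤ g₁ d) (d₂ : 0 ≤ g₂ d) (d₃ : 0 ≤ g₃ d) (hr : ¬ (0 ≤ g₁ r ∧ 0 ≤ g₂ r ∧ 0 ≤ g₃ r)) :
    ∃ t : ℝ, 0 ≤ t ∧ t ≤ 1 ∧ 0 ≤ g₁ ((1 - t) • d + t • r) ∧ 0 ≤ g₂ ((1 - t) • d + t • r) ∧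
      0 ≤ g₃ ((1 - t) • d + t • r) ∧ (g₁ ((1 - t) • d + t • r) = 0 ∨
        g₂ ((1 - t) • d + t • r) = 0 ∨ g₃ ((1 - t) • d + t • r) = 0) := by
  set m : ℝ → ℝ := fun t => min (min ((1 - t) * g₁ d + t * g₁ r) ((1 - t) * g₂ d + t * g₂ r))
    ((1 - t) * g₃ d + t * g₃ r) with hm
  have hc : Continuous m := by
    rw [hm]; fun_prop
  have h0 : 0 ≤ m 0 := by simp [hm, d₁, d₂, d₃]
  have h1 : m 1 ≤ 0 := by
    by_contra! h
    apply hr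
    simp only [hm, sub_self, zero_mul, one_mul, zero_add, lt_min_iff] at h
    exact ⟨h.1.1.le, h.1.2.le, h.2.le⟩
  obtain ⟨t, ⟨ht0, ht1⟩, ht⟩ := intermediate_value_Icc' (zero_le_one' ℝ) hc.continuousOn ⟨h1, h0⟩
  refine ⟨t, ht0, ht1, ?_⟩
  rw [h₁, h₂, h₃]
  have ht' : min (min ((1 - t) * g₁ d + t * g₁ r) ((1 - t) * g₂ d + t * g₂ r))
    ((1 - t) * g₃ d + t * g₃ r) = 0 := ht
  have e1 := le_min_iff.1 ht'.ge
  have e2 := le_min_iff.1 e1.1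
  refine ⟨e2.1, e2.2, e1.2, ?_⟩
  rcases min_choice (min ((1 - t) * g₁ d + t * g₁ r) ((1 - t) * g₂ d + t * g₂ r))
    ((1 - t) * g₃ d + t * g₃ r) with h | h
  · rcases min_choice ((1 - t) * g₁ d + t * g₁ r) ((1 - t) * g₂ d + t * g₂ r) with h' | h'
    · left; rw [← h', ← h, ht']
    · right; left; rw [← h', ← h, ht']
  · right; right; rw [← h, ht']

/-- Let a triangle be cut out by `g₁, g₂, g₃ ≥ 0`, and suppose that edges that run through it meet
the sides `g₁ = 0` and `g₂ = 0` only in the half-plane `0 ≤ φ`. If this half-plane contains the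
third side and the vertices in the triangle, then it contains the part of the drawing in the
triangle: otherwise follow an edge in the direction in which `φ` decreases. -/
theorem IsPSLG.drawing_subset_halfPlane (hG : IsPSLG P A) {g₁ g₂ g₃ φ : ℂ → ℝ} (h₁ : IsAff g₁)
    (h₂ : IsAff g₂) (h₃ : IsAff g₃) (hφ : IsAff φ)
    (hside : ∀ r s, A.Adj r s → ∀ d ∈ segment ℝ r s, 0 < g₁ d → 0 < g₂ d → 0 ≤ g₃ d →
      ∀ d' ∈ segment ℝ r s, 0 ≤ g₁ d' → 0 ≤ g₂ d' → 0 ≤ g₃ d' → (g₁ d' = 0 ∨ g₂ d' = 0) →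
        0 ≤ φ d')
    (hP : ∀ q ∈ P, 0 < g₁ q → 0 < g₂ q → 0 ≤ g₃ q → 0 ≤ φ q)
    (hthird : ∀ q, 0 ≤ g₁ q → 0 ≤ g₂ q → g₃ q = 0 → 0 ≤ φ q)
    {d : ℂ} (hd : d ∈ drawing P A) (d₁ : 0 < g₁ d) (d₂ : 0 < g₂ d) (d₃ : 0 ≤ g₃ d) :
    0 ≤ φ d := by
  rcases hd with hd | ⟨r, s, hrs, hd⟩
  · exact hP d hd d₁ d₂ d₃
  by_contra! hneg
  have main : ∀ r s, A.Adj r s → d ∈ segment ℝ r s → φ r ≤ φ d → False := by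
    intro r s hrs hd hr
    by_cases hin : 0 ≤ g₁ r ∧ 0 ≤ g₂ r ∧ 0 ≤ g₃ r
    · have : 0 ≤ φ r := by
        by_cases hz : g₁ r = 0 ∨ g₂ r = 0
        · exact hside r s hrs d hd d₁ d₂ d₃ r (left_mem_segment ℝ r s) hin.1 hin.2.1 hin.2.2 hz
        · push Not at hz
          exact hP r (hG.mem _ _ hrs).1 (lt_of_le_of_ne hin.1 (Ne.symm hz.1))
            (lt_of_le_of_ne hin.2.1 (Ne.symm hz.2)) hin.2.2
      linarith
    · obtain ⟨t, t0, t1, e1, e2, e3, e4⟩ := exists_exit h₁ h₂ h₃ d₁.le d₂.le d₃ hin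
      have hlt : φ ((1 - t) • d + t • r) < 0 := by
        rw [hφ]
        nlinarith
      have hmem : (1 - t) • d + t • r ∈ segment ℝ r s :=
        (convex_segment r s) hd (left_mem_segment ℝ r s) (by linarith) t0 (by ring)
      rcases or_assoc.2 e4 with h | h
      · linarith [hside r s hrs d hd d₁ d₂ d₃ _ hmem e1 e2 e3 h]
      · linarith [hthird _ e1 e2 h]
  obtain ⟨t, t0, t1, rfl⟩ := mem_segment_iff_lin.1 hd
  have := hφ r s t
  rcases le_total (φ r) (φ s) with h | h
  · exact main r s hrs hd (by rw [this]; nlinarith)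
  · exact main s r hrs.symm (by rw [segment_symm]; exact hd) (by rw [this]; nlinarith)

end Graph

/-! ### Corners of a boundary walk -/

theorem ccwAngle_pos (a d : ℂ) : 0 < ccwAngle a d := by
  unfold ccwAngle
  have := Complex.neg_pi_lt_arg (d / a)
  split_ifs with h
  · linarith [Real.pi_pos]
  · linarith

theorem ccwAngle_le (a d : ℂ) : ccwAngle a d ≤ 2 * Real.pi := by
  unfold ccwAngle
  have := Complex.arg_le_pi (d / a)
  split_ifs with h
  · linarith [Real.pi_pos]
  · linarith [Real.pi_pos]

theorem polar_ccwAngle {a d : ℂ} (ha : a ≠ 0) (hd : d ≠ 0) :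
    ∃ ρ : ℝ, 0 < ρ ∧ d = ρ * (Real.cos (ccwAngle a d) + Real.sin (ccwAngle a d) * Complex.I) * a := by
  have hda : d / a ≠ 0 := div_ne_zero hd ha
  refine ⟨‖d / a‖, norm_pos_iff.2 hda, ?_⟩
  have h1 : Real.cos (ccwAngle a d) = Real.cos (d / a).arg := by
    unfold ccwAngle; split_ifs <;> simp
  have h2 : Real.sin (ccwAngle a d) = Real.sin (d / a).arg := by
    unfold ccwAngle; split_ifs <;> simp
  rw [h1, h2, Complex.ofReal_cos, Complex.ofReal_sin, Complex.norm_mul_cos_add_sin_mul_I]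
  field_simp

theorem cross_polar (p : ℂ) (r₁ r₂ α β : ℝ) :
    cross (r₁ * (Real.cos α + Real.sin α * Complex.I) * p)
      (r₂ * (Real.cos β + Real.sin β * Complex.I) * p) =
      r₁ * r₂ * Complex.normSq p * Real.sin (β - α) := by
  rw [Real.sin_sub, Complex.normSq_apply]
  simp only [cross, Complex.mul_re, Complex.mul_im, Complex.add_re, Complex.add_im,
    Complex.ofReal_re, Complex.ofReal_im, Complex.I_re, Complex.I_im]
  ring

/-- The determinant of two vectors in terms of their angles from a common direction `p`. -/
theorem cross_eq_sin {p a d : ℂ} (hp : p ≠ 0) (ha : a ≠ 0) (hd : d ≠ 0) :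
    ∃ c : ℝ, 0 < c ∧ cross a d = c * Real.sin (ccwAngle p d - ccwAngle p a) := by
  obtain ⟨r, hr, h1⟩ := polar_ccwAngle hp ha
  obtain ⟨r', hr', h2⟩ := polar_ccwAngle hp hd
  refine ⟨r * r' * Complex.normSq p, by have := Complex.normSq_pos.2 hp; positivity, ?_⟩
  rw [← cross_polar, ← h1, ← h2]

theorem cross_self_eq_sin {p d : ℂ} (hp : p ≠ 0) (hd : d ≠ 0) :
    ∃ c : ℝ, 0 < c ∧ cross p d = c * Real.sin (ccwAngle p d) := by
  obtain ⟨r', hr', h2⟩ := polar_ccwAngle hp hd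
  refine ⟨1 * r' * Complex.normSq p, by have := Complex.normSq_pos.2 hp; positivity, ?_⟩
  have := cross_polar p 1 r' 0 (ccwAngle p d)
  rw [← h2] at this
  simpa using this

theorem cross_comm (a b : ℂ) : cross a b = - cross b a := by unfold cross; ring

theorem cross_ne_zero_left {a b : ℂ} (h : cross a b ≠ 0) : a ≠ 0 := by
  rintro rfl; simp [cross] at h

theorem cross_ne_zero_right {a b : ℂ} (h : cross a b ≠ 0) : b ≠ 0 := by
  rintro rfl; simp [cross] at h

theorem eq_comb_of_cross {a b : ℂ} (h : cross a b ≠ 0) (w : ℂ) :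
    w = (cross w b / cross a b) • a + (cross a w / cross a b) • b := by
  obtain ⟨p, h', c⟩ := exists_coords (O := 0) (a := a) (b := b) (by simpa using h)
  have e := c.eq w
  simp only [sub_zero, zero_add] at e
  have e1 : cross w b = p w * cross a b := by
    conv_lhs => rw [e]
    simp [cross]; ring
  have e2 : cross a w = h' w * cross a b := by
    conv_lhs => rw [e]
    simp [cross]; ring
  rw [e1, e2, mul_div_cancel_right₀ _ h, mul_div_cancel_right₀ _ h]
  exact e

theorem sin_pos_imp_lt_neg_pi {t : ℝ} (h0 : t ≤ 0) (h : 0 < Real.sin t) : t < -Real.pi := by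
  by_contra! h1
  linarith [Real.sin_nonpos_of_nonpos_of_neg_pi_le h0 h1]

theorem sin_pos_imp_lt_pi {t : ℝ} (h0 : t ≤ 2 * Real.pi) (h : 0 < Real.sin t) :
    t < Real.pi := by
  by_contra! h1
  have : Real.sin (t - 2 * Real.pi) ≤ 0 :=
    Real.sin_nonpos_of_nonpos_of_neg_pi_le (by linarith) (by linarith)
  rw [Real.sin_sub_two_pi] at this
  linarith

/-- Let `p, d, n` be directions such that `n` lies counterclockwise of `d` by less than a half
turn. If, turning from `p`, one meets `n` no later than `d`, then `p` lies in the sector from `d`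
to `n`. -/
theorem mem_sector_of_ccwAngle_le {p d n : ℂ} (hp : p ≠ 0) (hdn : 0 < cross d n)
    (h : ccwAngle p n ≤ ccwAngle p d) : ∃ α β : ℝ, 0 < α ∧ 0 ≤ β ∧ p = α • d + β • n := by
  have hd := cross_ne_zero_left hdn.ne'
  have hn := cross_ne_zero_right hdn.ne'
  obtain ⟨c, hc, e⟩ := cross_eq_sin hp hd hn
  have hs : 0 < Real.sin (ccwAngle p n - ccwAngle p d) := by
    rw [e] at hdn; exact pos_of_mul_pos_right hdn hc.le
  have h1 := sin_pos_imp_lt_neg_pi (by linarith) hs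
  have := ccwAngle_le p d
  have := ccwAngle_pos p n
  have hpn : 0 < cross p n := by
    obtain ⟨c', hc', e'⟩ := cross_self_eq_sin hp hn
    rw [e']
    exact mul_pos hc' (Real.sin_pos_of_pos_of_lt_pi (by linarith) (by linarith))
  have hdp : 0 ≤ cross d p := by
    obtain ⟨c', hc', e'⟩ := cross_self_eq_sin hp hd
    rw [cross_comm, e', ← mul_neg]
    have : Real.sin (ccwAngle p d - 2 * Real.pi) ≤ 0 :=
      Real.sin_nonpos_of_nonpos_of_neg_pi_le (by linarith) (by linarith)
    rw [Real.sin_sub_two_pi] at this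
    exact mul_nonneg hc'.le (by linarith)
  exact ⟨_, _, div_pos hpn hdn, div_nonneg hdp hdn.le, eq_comb_of_cross hdn.ne' p⟩

/-- Let `p, d, n` be directions such that `d` lies counterclockwise of `p` by less than a half
turn. If, turning from `p`, one meets `n` no later than `d`, then `n` lies in the sector from `p`
to `d`. -/
theorem next_mem_sector {p d n : ℂ} (hn : n ≠ 0) (hpd : 0 < cross p d)
    (h : ccwAngle p n ≤ ccwAngle p d) : ∃ α β : ℝ, 0 ≤ α ∧ 0 < β ∧ n = α • p + β • d := by
  have hp := cross_ne_zero_left hpd.ne'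
  have hd := cross_ne_zero_right hpd.ne'
  obtain ⟨c, hc, e⟩ := cross_self_eq_sin hp hd
  have hs : 0 < Real.sin (ccwAngle p d) := by
    rw [e] at hpd; exact pos_of_mul_pos_right hpd hc.le
  have h1 := sin_pos_imp_lt_pi (ccwAngle_le p d) hs
  have := ccwAngle_pos p n
  have hpn : 0 < cross p n := by
    obtain ⟨c', hc', e'⟩ := cross_self_eq_sin hp hn
    rw [e']
    exact mul_pos hc' (Real.sin_pos_of_pos_of_lt_pi (by linarith) (by linarith))
  have hnd : 0 ≤ cross n d := by
    obtain ⟨c', hc', e'⟩ := cross_eq_sin hp hn hd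
    rw [e']
    exact mul_nonneg hc'.le (Real.sin_nonneg_of_nonneg_of_le_pi (by linarith) (by linarith))
  exact ⟨_, _, div_nonneg hnd hpd.le, div_pos hpn hpd, eq_comb_of_cross hpd.ne' n⟩

/-- Let `w` lie counterclockwise of `d` by less than a half turn. If, turning from `p`, one meets
`d`, `n`, `w` in this order, then `n` lies in the sector from `d` to `w`. -/
theorem next_mem_sector' {p d n w : ℂ} (hp : p ≠ 0) (hn : n ≠ 0) (hdw : 0 < cross d w)
    (h1 : ccwAngle p d ≤ ccwAngle p n) (h2 : ccwAngle p n ≤ ccwAngle p w) :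
    ∃ α β : ℝ, 0 ≤ α ∧ 0 ≤ β ∧ n = α • d + β • w := by
  have hd := cross_ne_zero_left hdw.ne'
  have hw := cross_ne_zero_right hdw.ne'
  obtain ⟨c, hc, e⟩ := cross_eq_sin hp hd hw
  have hs : 0 < Real.sin (ccwAngle p w - ccwAngle p d) := by
    rw [e] at hdw; exact pos_of_mul_pos_right hdw hc.le
  have := ccwAngle_pos p d
  have := ccwAngle_le p w
  have hlt := sin_pos_imp_lt_pi (by linarith) hs
  have hdn : 0 ≤ cross d n := by
    obtain ⟨c', hc', e'⟩ := cross_eq_sin hp hd hn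
    rw [e']
    exact mul_nonneg hc'.le (Real.sin_nonneg_of_nonneg_of_le_pi (by linarith) (by linarith))
  have hnw : 0 ≤ cross n w := by
    obtain ⟨c', hc', e'⟩ := cross_eq_sin hp hn hw
    rw [e']
    exact mul_nonneg hc'.le (Real.sin_nonneg_of_nonneg_of_le_pi (by linarith) (by linarith))
  exact ⟨_, _, div_nonneg hnw hdw.le, div_nonneg hdn hdw.le, eq_comb_of_cross hdw.ne' n⟩

section Walk

variable {A : SimpleGraph ℂ} {f : Set ℂ} {v : ℤ → ℂ} {m : ℕ} {k : ℤ} {P : Finset ℂ}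

/-- Two edges from a common vertex do not overlap. -/
theorem IsPSLG.eq_of_ray (hG : IsPSLG P A) (hP : GenPos P) {u q w : ℂ} (hq : A.Adj u q)
    (hw : A.Adj u w) {α : ℝ} (e : q - u = α • (w - u)) : q = w := by
  by_contra hne
  refine hP u (hG.mem _ _ hq).1 q (hG.mem _ _ hq).2 w (hG.mem _ _ hw).2 hq.ne hw.ne hne ?_
  rw [collinear_iff_of_mem (p₀ := u) (by simp)]
  refine ⟨w - u, ?_⟩
  intro z hz
  simp only [mem_insert_iff, mem_singleton_iff] at hz
  rcases hz with rfl | rfl | rfl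
  · exact ⟨0, by simp⟩
  · exact ⟨α, by simp [← e]⟩
  · exact ⟨1, by simp⟩

theorem IsBoundaryWalk.adj_prev (hv : IsBoundaryWalk A f v m) (k : ℤ) :
    A.Adj (v k) (v (k - 1)) := by
  have := hv.adj (k - 1)
  rw [sub_add_cancel] at this
  exact this.symm

theorem IsBoundaryWalk.prev_ne (hv : IsBoundaryWalk A f v m) (k : ℤ) : v (k - 1) - v k ≠ 0 :=
  sub_ne_zero.2 (hv.adj_prev k).ne'

theorem IsBoundaryWalk.next_ne (hv : IsBoundaryWalk A f v m) (k : ℤ) : v (k + 1) - v k ≠ 0 :=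
  sub_ne_zero.2 (hv.adj k).ne'

/-- The vector `d` points into the corner that the walk forms at its `k`-th vertex. -/
def InCorner (v : ℤ → ℂ) (k : ℤ) (d : ℂ) : Prop :=
  ccwAngle (v (k - 1) - v k) d < cornerAngle v k

/-- A direction clockwise of the next edge, with no edges in between, points into the corner. -/
theorem IsBoundaryWalk.inCorner_of_next (hv : IsBoundaryWalk A f v m) {d : ℂ}
    (hd : 0 < cross d (v (k + 1) - v k))
    (hempty : ∀ q, A.Adj (v k) q → ∀ α β : ℝ, 0 < α → 0 ≤ β →
      q - v k ≠ α • d + β • (v (k + 1) - v k)) : InCorner v k d := by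
  by_contra! h
  unfold InCorner at h
  obtain ⟨α, β, hα, hβ, e⟩ := mem_sector_of_ccwAngle_le (hv.prev_ne k) hd (not_lt.1 h)
  exact hempty _ (hv.adj_prev k) α β hα hβ e

/-- A direction counterclockwise of the previous edge, with no edges in between, points into the
corner. -/
theorem IsBoundaryWalk.inCorner_of_prev (hv : IsBoundaryWalk A f v m) {d : ℂ}
    (hd : 0 < cross (v (k - 1) - v k) d)
    (hempty : ∀ q, A.Adj (v k) q → ∀ α β : ℝ, 0 < α → 0 ≤ β →
      q - v k ≠ α • d + β • (v (k - 1) - v k)) : InCorner v k d := by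
  by_contra! h
  unfold InCorner at h
  obtain ⟨α, β, hα, hβ, e⟩ := next_mem_sector (hv.next_ne k) hd (not_lt.1 h)
  exact hempty _ (hv.adj k) β α hβ hα (by rw [e, add_comm])

/-- An edge clockwise of a direction in the corner, with no edges in between, is the previous
edge of the walk. -/
theorem IsBoundaryWalk.eq_prev (hv : IsBoundaryWalk A f v m) (hG : IsPSLG P A)
    (hP : GenPos P) {d w : ℂ}
    (hd : InCorner v k d ∨ d = v (k + 1) - v k) (hw : A.Adj (v k) w)
    (hwd : 0 < cross (w - v k) d)
    (hempty : ∀ q, A.Adj (v k) q → ∀ α β : ℝ, 0 < α → 0 < β →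
      q - v k ≠ α • d + β • (w - v k)) :
    v (k - 1) = w := by
  have h1 := hv.next k w hw
  have h2 : ccwAngle (v (k - 1) - v k) d ≤ ccwAngle (v (k - 1) - v k) (w - v k) := by
    rcases hd with hd | rfl
    · exact hd.le.trans h1
    · exact h1
  obtain ⟨α, β, hα, hβ, e⟩ := mem_sector_of_ccwAngle_le (hv.prev_ne k) hwd h2
  rcases hβ.eq_or_lt with rfl | hβ
  · exact hG.eq_of_ray hP (hv.adj_prev k) hw (α := α) (by simpa using e)
  · exact absurd (by rw [e, add_comm]) (hempty _ (hv.adj_prev k) β α hβ hα)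

/-- An edge counterclockwise of a direction in the corner, with no edges in between, is the next
edge of the walk. -/
theorem IsBoundaryWalk.eq_next (hv : IsBoundaryWalk A f v m) (hG : IsPSLG P A)
    (hP : GenPos P) {d w : ℂ}
    (hd : InCorner v k d) (hw : A.Adj (v k) w)
    (hdw : 0 < cross d (w - v k))
    (hempty : ∀ q, A.Adj (v k) q → ∀ α β : ℝ, 0 < α → 0 ≤ β →
      q - v k ≠ α • d + β • (w - v k)) :
    v (k + 1) = w := by
  have h1 := hv.next k w hw
  obtain ⟨α, β, hα, hβ, e⟩ := next_mem_sector' (hv.prev_ne k) (hv.next_ne k) hdw hd.le h1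
  rcases hα.eq_or_lt with rfl | hα
  · exact hG.eq_of_ray hP (hv.adj k) hw (α := β) (by simpa using e)
  · exact absurd e (hempty _ (hv.adj k) α β hα hβ)

/-- An edge counterclockwise of the previous edge, with no edges in between, is the next edge of
the walk. -/
theorem IsBoundaryWalk.eq_next_of_prev (hv : IsBoundaryWalk A f v m) (hG : IsPSLG P A)
    (hP : GenPos P) {w : ℂ}
    (hw : A.Adj (v k) w) (hdw : 0 < cross (v (k - 1) - v k) (w - v k))
    (hempty : ∀ q, A.Adj (v k) q → ∀ α β : ℝ, 0 < α → 0 < β →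
      q - v k ≠ α • (v (k - 1) - v k) + β • (w - v k)) :
    v (k + 1) = w := by
  obtain ⟨α, β, hα, hβ, e⟩ := next_mem_sector (hv.next_ne k) hdw (hv.next k w hw)
  rcases hα.eq_or_lt with rfl | hα
  · exact hG.eq_of_ray hP (hv.adj k) hw (α := β) (by simpa using e)
  · exact absurd e (hempty _ (hv.adj k) α β hα hβ)

theorem IsBoundaryWalk.convexAt_of_cross (hv : IsBoundaryWalk A f v m)
    (h : 0 < cross (v (k - 1) - v k) (v (k + 1) - v k)) : ConvexAt v k := by
  obtain ⟨c, hc, e⟩ := cross_self_eq_sin (hv.prev_ne k) (hv.next_ne k)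
  rw [e] at h
  exact sin_pos_imp_lt_pi (ccwAngle_le _ _) (pos_of_mul_pos_right h hc.le)

theorem IsBoundaryWalk.cross_pos_of_convexAt (hv : IsBoundaryWalk A f v m) (h : ConvexAt v k) :
    0 < cross (v (k - 1) - v k) (v (k + 1) - v k) := by
  obtain ⟨c, hc, e⟩ := cross_self_eq_sin (hv.prev_ne k) (hv.next_ne k)
  rw [e]
  exact mul_pos hc (Real.sin_pos_of_pos_of_lt_pi (ccwAngle_pos _ _) h)

/-- No interior angle is straight. -/
theorem IsBoundaryWalk.reflexAt_of_not_convexAt (hv : IsBoundaryWalk A f v m)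
    (hG : IsPSLG P A) (hP : GenPos P) (h : ¬ ConvexAt v k) : ReflexAt v k := by
  refine lt_of_le_of_ne (not_lt.1 h) ?_
  intro hpi
  obtain ⟨c, hc, e⟩ := cross_self_eq_sin (hv.prev_ne k) (hv.next_ne k)
  have hpi' : ccwAngle (v (k - 1) - v k) (v (k + 1) - v k) = Real.pi := hpi.symm
  by_cases heq : v (k - 1) = v (k + 1)
  · unfold ccwAngle at hpi'
    rw [heq, div_self (hv.next_ne k)] at hpi'
    simp at hpi'
  · rw [hpi', Real.sin_pi, mul_zero] at e
    have hk := (hG.mem _ _ (hv.adj k))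
    refine hP _ hk.1 _ (hG.mem _ _ (hv.adj_prev k)).2 _ hk.2 (hv.adj_prev k).ne (hv.adj k).ne heq ?_
    obtain ⟨p, h', cc⟩ := exists_coords (O := 0) (a := 1) (b := Complex.I) (by simp [cross])
    apply cc.collinear
    have hre : ∀ w : ℂ, p w = w.re := fun w => by
      have := congrArg Complex.re (cc.eq w); simpa using this.symm
    have him : ∀ w : ℂ, h' w = w.im := fun w => by
      have := congrArg Complex.im (cc.eq w); simpa using this.symm
    simp only [hre, him]
    simp only [cross, Complex.sub_re, Complex.sub_im] at e
    linarith

end Walk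

/-! ### Empty triangles -/

theorem IsAff.eventually_pos {g : ℂ → ℝ} (hg : IsAff g) {d : ℂ} (hd : 0 < g d) (r : ℂ) :
    ∀ᶠ t : ℝ in 𝓝[>] 0, 0 < g ((1 - t) • d + t • r) := by
  have hc : ContinuousAt (fun t : ℝ => (1 - t) * g d + t * g r) 0 := by fun_prop
  have h0 : (0 : ℝ) < (fun t : ℝ => (1 - t) * g d + t * g r) 0 := by simpa using hd
  filter_upwards [nhdsWithin_le_nhds (hc.eventually (lt_mem_nhds h0))] with t ht
  rw [hg]; exact ht

theorem IsAff.eventually_neg {g : ℂ → ℝ} (hg : IsAff g) {d r : ℂ} (hd : g d = 0) (hr : g r < 0) :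
    ∀ᶠ t : ℝ in 𝓝[>] 0, g ((1 - t) • d + t • r) < 0 := by
  filter_upwards [self_mem_nhdsWithin] with t ht
  rw [hg, hd, mul_zero, zero_add]
  exact mul_neg_of_pos_of_neg ht hr

theorem IsAff.pos_of_mem_interior {g : ℂ → ℝ} (hg : IsAff g) {T : Set ℂ} (hT : ∀ q ∈ T, 0 ≤ g q)
    {r : ℂ} (hr : g r < 0) {q : ℂ} (hq : q ∈ interior T) : 0 < g q := by
  refine lt_of_le_of_ne (hT q (interior_subset hq)) fun h0 => ?_
  have hc : ContinuousAt (fun t : ℝ => (1 - t) • q + t • r) 0 := by fun_prop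
  have : ∀ᶠ t : ℝ in 𝓝[>] 0, (1 - t) • q + t • r ∈ T := by
    apply nhdsWithin_le_nhds
    apply hc.eventually
    simpa using mem_interior_iff_mem_nhds.1 hq
  obtain ⟨t, h1, h2⟩ := (this.and (hg.eventually_neg h0.symm hr)).exists
  exact absurd (hT _ h1) (not_le.2 h2)

theorem Coords.convexHull_eq {O a b : ℂ} {p h : ℂ → ℝ} (c : Coords O a b p h) :
    convexHull ℝ {O, a, b} = {q | 0 ≤ p q ∧ 0 ≤ h q ∧ p q + h q ≤ 1} := by
  apply Subset.antisymm
  · apply convexHull_min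
    · rintro q (rfl | rfl | rfl)
      · simp [c.fst_O, c.snd_O]
      · simp [c.fst_a, c.snd_a]
      · simp [c.fst_b, c.snd_b]
    · have h3 : Convex ℝ {q | 0 ≤ (-1) * p q + (-1) * h q + 1} :=
        (c.aff_fst.comb c.aff_snd (-1) (-1) 1).convex_nonneg
      have e : {q | 0 ≤ p q ∧ 0 ≤ h q ∧ p q + h q ≤ 1} =
          ({q | 0 ≤ p q} ∩ {q | 0 ≤ h q}) ∩ {q | 0 ≤ (-1) * p q + (-1) * h q + 1} := by
        refine Set.ext fun q => ⟨fun H => ⟨⟨H.1, H.2.1⟩, ?_⟩, fun H => ⟨H.1.1, H.1.2, ?_⟩⟩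
        · have := H.2.2
          show 0 ≤ (-1) * p q + (-1) * h q + 1
          linarith
        · have : 0 ≤ (-1) * p q + (-1) * h q + 1 := H.2
          linarith
      rw [e]
      exact (c.aff_fst.convex_nonneg.inter c.aff_snd.convex_nonneg).inter h3
  · rintro q ⟨h1, h2, h3⟩
    rw [c.eq q]
    have e : O + p q • (a - O) + h q • (b - O) = (1 - p q - h q) • O + p q • a + h q • b := by
      module
    rw [e]
    have hO : O ∈ convexHull ℝ {O, a, b} := subset_convexHull ℝ _ (by simp)
    have ha : a ∈ convexHull ℝ {O, a, b} := subset_convexHull ℝ _ (by simp)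
    have hb : b ∈ convexHull ℝ {O, a, b} := subset_convexHull ℝ _ (by simp)
    have := (convex_convexHull ℝ {O, a, b}).sum_mem (t := Finset.univ)
      (w := ![1 - p q - h q, p q, h q]) (z := ![O, a, b])
      (by intro i _; fin_cases i <;> simp <;> linarith)
      (by simp only [Fin.sum_univ_three, Matrix.cons_val]; ring) (by intro i _; fin_cases i <;> simpa)
    simpa [Fin.sum_univ_three] using this

theorem Coords.interior_convexHull_eq {O a b : ℂ} {p h : ℂ → ℝ} (c : Coords O a b p h) :
    interior (convexHull ℝ {O, a, b}) = {q | 0 < p q ∧ 0 < h q ∧ p q + h q < 1} := by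
  rw [c.convexHull_eq]
  apply Subset.antisymm
  · intro q hq
    refine ⟨c.aff_fst.pos_of_mem_interior (fun q hq => hq.1)
        (r := O + (-1 : ℝ) • (a - O) + (0 : ℝ) • (b - O)) (by rw [c.fst]; norm_num) hq,
      c.aff_snd.pos_of_mem_interior (fun q hq => hq.2.1)
        (r := O + (0 : ℝ) • (a - O) + (-1 : ℝ) • (b - O)) (by rw [c.snd]; norm_num) hq, ?_⟩
    have := (c.aff_fst.comb c.aff_snd (-1) (-1) 1).pos_of_mem_interior
        (T := {q | 0 ≤ p q ∧ 0 ≤ h q ∧ p q + h q ≤ 1})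
        (fun q hq => by linarith [hq.2.2])
        (r := O + (2 : ℝ) • (a - O) + (0 : ℝ) • (b - O)) (by rw [c.fst, c.snd]; norm_num) hq
    linarith
  · apply interior_maximal
    · rintro q ⟨h1, h2, h3⟩; exact ⟨h1.le, h2.le, h3.le⟩
    · exact (isOpen_lt continuous_const c.cont_fst).inter
        ((isOpen_lt continuous_const c.cont_snd).inter
          (isOpen_lt (c.cont_fst.add c.cont_snd) continuous_const))

theorem Coords.convex_openTriangle {O a b : ℂ} {p h : ℂ → ℝ} (c : Coords O a b p h) :
    Convex ℝ {q | 0 < p q ∧ 0 < h q ∧ p q + h q < 1} := by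
  rw [← c.interior_convexHull_eq]
  exact (convex_convexHull ℝ _).interior

section

variable {P : Finset ℂ} {A : SimpleGraph ℂ} {f : Set ℂ} {O a b : ℂ} {p h : ℂ → ℝ}

/-- A face that contains the interior of a triangle of edges is this interior. -/
theorem IsFace.isTriangularFace (hf : IsFace P A f) (hO : O ∈ P) (ha : a ∈ P) (hb : b ∈ P)
    (c : Coords O a b p h) (hOa : A.Adj O a) (hOb : A.Adj O b) (hab : A.Adj a b)
    (hempty : ∀ d ∈ drawing P A, 0 < p d → 0 < h d → p d + h d < 1 → False)
    {w : ℂ} (hw : w ∈ f) (w₁ : 0 < p w) (w₂ : 0 < h w) (w₃ : p w + h w < 1) :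
    IsTriangularFace P f := by
  refine ⟨O, hO, a, ha, b, hb, ?_⟩
  rw [c.interior_convexHull_eq]
  apply Subset.antisymm
  · have hopen : IsOpen {q | 0 < p q ∧ 0 < h q ∧ p q + h q < 1} := by
      rw [← c.interior_convexHull_eq]; exact isOpen_interior
    have hclosed : IsClosed {q | 0 ≤ p q ∧ 0 ≤ h q ∧ p q + h q ≤ 1} :=
      (isClosed_le continuous_const c.cont_fst).inter
        ((isClosed_le continuous_const c.cont_snd).inter
          (isClosed_le (c.cont_fst.add c.cont_snd) continuous_const))
    refine hf.preconnected.subset_left_of_subset_union hopen hclosed.isOpen_compl ?_ ?_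
      ⟨w, hw, w₁, w₂, w₃⟩
    · exact Set.disjoint_left.2 fun q hq hq' => hq' ⟨hq.1.le, hq.2.1.le, hq.2.2.le⟩
    · intro q hq
      by_contra hn
      simp only [mem_union, mem_compl_iff, mem_ofPred_eq, not_or, not_not] at hn
      obtain ⟨h1, h2, h3, h4⟩ := hn
      apply hf.subset hq
      rcases h2.eq_or_lt with e | e
      · apply segment_subset_drawing hOb
        refine mem_segment_iff_lin.2 ⟨h q, h3, by linarith, ?_⟩
        conv_lhs => rw [c.eq q, ← e]
        module
      · rcases h3.eq_or_lt with e' | e'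
        · apply segment_subset_drawing hOa
          refine mem_segment_iff_lin.2 ⟨p q, h2, by linarith, ?_⟩
          conv_lhs => rw [c.eq q, ← e']
          module
        · have e3 : p q + h q = 1 := by
            by_contra hne
            exact h1 ⟨e, e', lt_of_le_of_ne h4 hne⟩
          apply segment_subset_drawing hab
          refine mem_segment_iff_lin.2 ⟨h q, h3, by linarith, ?_⟩
          conv_lhs => rw [c.eq q, show p q = 1 - h q by linarith]
          module
  · exact hf.absorb c.convex_openTriangle.isPreconnected
      (fun d hd hdD => hempty d hdD hd.1 hd.2.1 hd.2.2) ⟨w₁, w₂, w₃⟩ hw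

/-- An edge that meets another edge in an interior point of the latter lies on the same line. -/
theorem IsPSLG.eq_zero_of_meet (hG : IsPSLG P A) {g : ℂ → ℝ} (hg : IsAff g) {r s x y d d' : ℂ}
    (hrs : A.Adj r s) (hxy : A.Adj x y) (hx : g x = 0) (hy : g y = 0) (hd : d ∈ segment ℝ r s)
    (hd' : d' ∈ segment ℝ r s) (hd'' : d' ∈ openSegment ℝ x y) : g d = 0 := by
  have h1 := hG.same_edge hrs hxy hd' hd''
  have h2 : g r = 0 ∧ g s = 0 := by
    rcases Sym2.eq_iff.1 h1 with ⟨rfl, rfl⟩ | ⟨rfl, rfl⟩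
    · exact ⟨hx, hy⟩
    · exact ⟨hy, hx⟩
  obtain ⟨t, -, -, rfl⟩ := mem_segment_iff_lin.1 hd
  rw [hg, h2.1, h2.2]; ring

/-- If the drawing meets the interior of a segment between two vertices but stays, near the
meeting point, on one side of the line, then the segment is an edge. -/
theorem IsPSLG.adj_of_touch (hG : IsPSLG P A) {φ : ℂ → ℝ} (hφ : IsAff φ)
    (ha : φ a = 0) (hb : φ b = 0) {d : ℂ} (hd : d ∈ openSegment ℝ a b) (hdD : d ∈ drawing P A)
    (honly : ∀ q ∈ P, φ q = 0 → q = a ∨ q = b) (hab : a ≠ b)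
    (hloc : ∀ r, φ r < 0 → ∀ᶠ t : ℝ in 𝓝[>] 0, (1 - t) • d + t • r ∉ drawing P A) :
    A.Adj a b := by
  have hd0 : φ d = 0 := by
    obtain ⟨t, -, -, rfl⟩ := mem_openSegment_iff_lin.1 hd
    rw [hφ, ha, hb]; ring
  have hdP : d ∉ P := by
    intro hdP
    rcases honly d hdP hd0 with rfl | rfl
    · exact hab (left_mem_openSegment_iff.1 hd)
    · exact hab (right_mem_openSegment_iff.1 hd)
  rcases hdD with hdD | ⟨r, s, hrs, hds⟩
  · exact absurd hdD hdP
  have side : ∀ r s, A.Adj r s → d ∈ segment ℝ r s → 0 ≤ φ r := by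
    intro r s hrs hds
    by_contra! hneg
    have hlt : ∀ᶠ t : ℝ in 𝓝[>] 0, t < 1 := nhdsWithin_le_nhds (Iio_mem_nhds one_pos)
    obtain ⟨t, ht, ht1, ht0⟩ := ((hloc r hneg).and (hlt.and self_mem_nhdsWithin)).exists
    have ht0' : (0 : ℝ) < t := ht0
    have ht1' : t < (1 : ℝ) := ht1
    apply ht
    refine segment_subset_drawing hrs ?_
    exact (convex_segment r s) hds (left_mem_segment ℝ r s) (by linarith) ht0'.le (by ring)
  have h1 := side r s hrs hds
  have h2 := side s r hrs.symm (by rwa [segment_symm])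
  obtain ⟨t, t0, t1, e⟩ := mem_segment_iff_lin.1 hds
  have hr := (hG.mem _ _ hrs).1
  have hs := (hG.mem _ _ hrs).2
  have t0' : 0 < t := lt_of_le_of_ne t0 (by rintro rfl; exact hdP (by simp [e, hr]))
  have t1' : t < 1 := lt_of_le_of_ne t1 (by rintro rfl; exact hdP (by simp [e, hs]))
  rw [e, hφ] at hd0
  have e1 : φ r = 0 := by nlinarith
  have e2 : φ s = 0 := by nlinarith
  rcases honly r hr e1 with rfl | rfl <;> rcases honly s hs e2 with rfl | rfl
  · exact absurd rfl hrs.ne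
  · exact hrs
  · exact hrs.symm
  · exact absurd rfl hrs.ne

end

/-! ### Convex corners -/

section

variable {P : Finset ℂ} {A : SimpleGraph ℂ} {f : Set ℂ} {o : ℂ} {s : ℝ}

theorem convex_floor_mem (o : ℝ) {s : ℝ} (hs : 0 < s) (l u : ℤ) :
    Convex ℝ {t : ℝ | l ≤ ⌊(t - o) / s⌋ ∧ ⌊(t - o) / s⌋ ≤ u} := by
  apply OrdConnected.convex
  refine ⟨fun x hx y hy z hz => ⟨hx.1.trans ?_, le_trans ?_ hy.2⟩⟩
  · have := hz.1; gcongr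
  · have := hz.2; gcongr

/-- The points in a rectangular block of cells form a convex set. -/
theorem convex_block (o : ℂ) {s : ℝ} (hs : 0 < s) (l u l' u' : ℤ) :
    Convex ℝ {q : ℂ | (l ≤ (cell o s q).1 ∧ (cell o s q).1 ≤ u) ∧
      (l' ≤ (cell o s q).2 ∧ (cell o s q).2 ≤ u')} :=
  ((convex_floor_mem o.re hs l u).linear_preimage Complex.reLm).inter
    ((convex_floor_mem o.im hs l' u').linear_preimage Complex.imLm)

theorem convex_near (o : ℂ) {s : ℝ} (hs : 0 < s) (p : ℂ) : Convex ℝ {q | Near o s p q} := by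
  convert convex_block o hs ((cell o s p).1 - 1) ((cell o s p).1 + 1) ((cell o s p).2 - 1)
    ((cell o s p).2 + 1) using 1
  refine Set.ext fun q => ?_
  show Near o s p q ↔ _ ∧ _
  simp only [Near, abs_le]
  constructor
  · rintro ⟨⟨h1, h2⟩, h3, h4⟩
    exact ⟨⟨by linarith, by linarith⟩, by linarith, by linarith⟩
  · rintro ⟨⟨h1, h2⟩, h3, h4⟩
    exact ⟨⟨by linarith, by linarith⟩, by linarith, by linarith⟩

theorem near_self (o : ℂ) (s : ℝ) (p : ℂ) : Near o s p p := by simp [Near]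

theorem Near.symm {p q : ℂ} (h : Near o s p q) : Near o s q p := by
  simpa [Near, abs_sub_comm] using h

theorem IsMaximalPSLG.pslg (hA : IsMaximalPSLG P o s A) : IsPSLG P A := hA.1.1

theorem IsMaximalPSLG.near (hA : IsMaximalPSLG P o s A) {p q : ℂ} (h : A.Adj p q) :
    Near o s p q := (hA.1.2 h).2.2.2

/-- A convex subset of the plane containing the vertices of a triangle contains the triangle. -/
theorem Coords.mem_of_convex {O a b : ℂ} {p h : ℂ → ℝ} (c : Coords O a b p h) {K : Set ℂ}
    (hK : Convex ℝ K) (hO : O ∈ K) (ha : a ∈ K) (hb : b ∈ K) {q : ℂ} (h1 : 0 ≤ p q)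
    (h2 : 0 ≤ h q) (h3 : p q + h q ≤ 1) : q ∈ K := by
  have : q ∈ convexHull ℝ {O, a, b} := by
    rw [c.convexHull_eq]; exact ⟨h1, h2, h3⟩
  refine convexHull_min ?_ hK this
  rintro q (rfl | rfl | rfl) <;> assumption

/-- A vertex on the line through two vertices is one of them. -/
theorem Coords.eq_or_eq {O a b : ℂ} {p h : ℂ → ℝ} (c : Coords O a b p h) (hP : GenPos P)
    {u w q : ℂ} (hu : u ∈ P) (hw : w ∈ P) (hq : q ∈ P) (huw : u ≠ w)
    (H : (p w - p u) * (h q - h u) = (h w - h u) * (p q - p u)) : q = u ∨ q = w := by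
  by_contra! hne
  exact hP u hu w hw q hq huw hne.1.symm hne.2.symm (c.collinear H)

/-- The two neighbours of a convex vertex see each other. Of the vertices in the triangle that
they span with the convex vertex, the nearest one, measured parallel to the third side, would be
visible from the convex vertex and near it, and so joined to it by an edge inside the corner. -/
theorem IsBoundaryWalk.sees_of_convexAt (hs : 0 < s) (hA : IsMaximalPSLG P o s A)
    (hP : GenPos P) (hf : IsFace P A f) (hnt : ¬ IsTriangularFace P f) {v : ℤ → ℂ} {m : ℕ}
    (hv : IsBoundaryWalk A f v m) {k : ℤ} (hk : ConvexAt v k) : Sees f v (k - 1) (k + 1) := by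
  have hG := hA.pslg
  have hcr := hv.cross_pos_of_convexAt hk
  have hOa := hv.adj_prev k
  have hOb := hv.adj k
  have hcr' : 0 < cross (v (k - 1) - v k) (v (k + 1) - v k) := hcr
  set O := v k with hOdef
  set a := v (k - 1) with hadef
  set b := v (k + 1) with hbdef
  have hO := (hG.mem _ _ hOa).1
  have ha := (hG.mem _ _ hOa).2
  have hb := (hG.mem _ _ hOb).2
  obtain ⟨p, h, c⟩ := exists_coords hcr.ne'
  have habne : a ≠ b := by
    intro e
    have := c.fst_a
    rw [e, c.fst_b] at this
    norm_num at this
  have hcone : ∀ q, A.Adj O q → 0 < p q → 0 < h q → False := by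
    intro q hq h1 h2
    have e := c.eq q
    have hq' : cross (q - O) (b - O) = p q * cross (a - O) (b - O) := by
      conv_lhs => rw [e]
      simp [cross]; ring
    have hq'' : cross (a - O) (q - O) = h q * cross (a - O) (b - O) := by
      conv_lhs => rw [e]
      simp [cross]; ring
    obtain ⟨α, β, hα, hβ, e'⟩ := mem_sector_of_ccwAngle_le (hv.prev_ne k)
      (d := q - O) (n := b - O) (by rw [hq']; positivity) (hv.next k q hq)
    have e1 : cross (a - O) (a - O) = α * cross (a - O) (q - O) + β * cross (a - O) (b - O) := by
      conv_lhs => rw [show a - O = α • (q - O) + β • (b - O) from e']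
      conv_rhs => rw [show a - O = α • (q - O) + β • (b - O) from e']
      simp [cross]; ring
    rw [hq''] at e1
    have e2 : cross (a - O) (a - O) = 0 := by simp [cross]; ring
    rw [e2] at e1
    have : 0 < α * (h q * cross (a - O) (b - O)) := by positivity
    have : 0 ≤ β * cross (a - O) (b - O) := by positivity
    linarith
  have hside : ∀ r t, A.Adj r t → ∀ d ∈ segment ℝ r t, 0 < p d → 0 < h d →
      ∀ d' ∈ segment ℝ r t, 0 ≤ p d' → 0 ≤ h d' → p d' + h d' ≤ 1 → (p d' = 0 ∨ h d' = 0) →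
        d' = a ∨ d' = b := by
    intro r t hrt d hd d₁ d₂ d' hd' h1 h2 h3 h4
    by_cases hd'O : d' = O
    · exfalso
      have key : ∀ e, A.Adj O e → d ∈ segment ℝ O e → False := by
        intro e he hde
        obtain ⟨τ, t0, t1, rfl⟩ := mem_segment_iff_lin.1 hde
        rw [c.aff_fst, c.fst_O] at d₁
        rw [c.aff_snd, c.snd_O] at d₂
        exact hcone e he (by nlinarith) (by nlinarith)
      rcases hG.vertex_on_edge hrt hd' (hd'O ▸ hO) with e | e
      · rw [hd'O] at e; subst e; exact key t hrt hd
      · rw [hd'O] at e; subst e; exact key r hrt.symm (by rwa [segment_symm])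
    rcases h4 with h4 | h4
    · by_cases hd'b : d' = b
      · exact Or.inr hd'b
      exfalso
      have hlt : h d' < 1 := lt_of_le_of_ne (by linarith) fun e =>
        hd'b (c.ext (by rw [h4, c.fst_b]) (by rw [e, c.snd_b]))
      have hgt : 0 < h d' := lt_of_le_of_ne h2 fun e =>
        hd'O (c.ext (by rw [h4, c.fst_O]) (by rw [← e, c.snd_O]))
      have hmem : d' ∈ openSegment ℝ O b := by
        refine mem_openSegment_iff_lin.2 ⟨h d', hgt, hlt, ?_⟩
        conv_lhs => rw [c.eq d', h4]
        module
      exact d₁.ne' (hG.eq_zero_of_meet c.aff_fst hrt hOb c.fst_O c.fst_b hd hd' hmem)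
    · by_cases hd'a : d' = a
      · exact Or.inl hd'a
      exfalso
      have hlt : p d' < 1 := lt_of_le_of_ne (by linarith) fun e =>
        hd'a (c.ext (by rw [e, c.fst_a]) (by rw [h4, c.snd_a]))
      have hgt : 0 < p d' := lt_of_le_of_ne h1 fun e =>
        hd'O (c.ext (by rw [← e, c.fst_O]) (by rw [h4, c.snd_O]))
      have hmem : d' ∈ openSegment ℝ O a := by
        refine mem_openSegment_iff_lin.2 ⟨p d', hgt, hlt, ?_⟩
        conv_lhs => rw [c.eq d', h4]
        module
      exact d₂.ne' (hG.eq_zero_of_meet c.aff_snd hrt hOa c.snd_O c.snd_a hd hd' hmem)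
  have haff3 := c.aff_fst.comb c.aff_snd (-1) (-1) 1
  have hhull : ∀ l : ℝ, l ≤ 1 → (∀ q ∈ P, 0 < p q → 0 < h q → p q + h q ≤ 1 → l ≤ p q + h q) →
      ∀ d ∈ drawing P A, 0 < p d → 0 < h d → p d + h d ≤ 1 → l ≤ p d + h d := by
    intro l hl hq d hd d₁ d₂ d₃
    have := hG.drawing_subset_halfPlane c.aff_fst c.aff_snd haff3
      (c.aff_fst.comb c.aff_snd 1 1 (-l))
      (fun r t hrt d hd d₁ d₂ _ d' hd' e1 e2 e3 e4 => by
        rcases hside r t hrt d hd d₁ d₂ d' hd' e1 e2 (by linarith) e4 with rfl | rfl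
        · rw [c.fst_a, c.snd_a]; linarith
        · rw [c.fst_b, c.snd_b]; linarith)
      (fun q hqP e1 e2 e3 => by linarith [hq q hqP e1 e2 (by linarith)])
      (fun q e1 e2 e3 => by linarith) hd d₁ d₂ (by linarith)
    linarith
  have hno : ∀ q ∈ P, 0 < p q → 0 < h q → p q + h q ≤ 1 → False := by
    intro q₀ hq₀ e1 e2 e3
    obtain ⟨u, hu, hmin⟩ := (P.filter fun q => 0 < p q ∧ 0 < h q ∧ p q + h q ≤ 1).exists_min_image
      (fun q => p q + h q) ⟨q₀, by simp [hq₀, e1, e2, e3]⟩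
    simp only [Finset.mem_filter] at hu hmin
    obtain ⟨huP, u1, u2, u3⟩ := hu
    have hcl := hhull (p u + h u) u3 (fun q h0 h1 h2 h3 => hmin q ⟨h0, h1, h2, h3⟩)
    have hlt : p u + h u < 1 ∨ p u + h u = 1 := lt_or_eq_of_le u3
    rcases hlt with hlt | heq
    · refine hA.not_near hO huP (fun e => ?_) ?_ ?_
      · rw [← e, c.fst_O] at u1; exact lt_irrefl _ u1
      · intro d hd hdD
        obtain ⟨t, t0, t1, rfl⟩ := mem_openSegment_iff_lin.1 hd
        have := hcl _ hdD
        rw [c.aff_fst, c.aff_snd, c.fst_O, c.snd_O] at this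
        have := this (by nlinarith) (by nlinarith) (by nlinarith)
        nlinarith
      · exact c.mem_of_convex (convex_near o hs O) (near_self o s O) (hA.near hOa) (hA.near hOb)
          u1.le u2.le u3
    · rcases c.eq_or_eq hP ha hb huP habne (by
        rw [c.fst_a, c.snd_a, c.fst_b, c.snd_b]; linarith) with rfl | rfl
      · rw [c.snd_a] at u2; exact lt_irrefl _ u2
      · rw [c.fst_b] at u1; exact lt_irrefl _ u1
  have hD : ∀ d ∈ drawing P A, 0 < p d → 0 < h d → p d + h d ≤ 1 → 1 ≤ p d + h d :=
    hhull 1 le_rfl fun q hq e1 e2 e3 => (hno q hq e1 e2 e3).elim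
  -- the points next to the middle of the edge `O b`, on its right, lie in the triangle
  obtain ⟨w, hwf, w1, w2, w3⟩ : ∃ w ∈ f, 0 < p w ∧ 0 < h w ∧ p w + h w < 1 := by
    set n : ℂ := -(Complex.I * (b - O)) with hn
    have hncr : 0 < cross n (b - O) := by
      have : cross n (b - O) = Complex.normSq (b - O) := by
        rw [Complex.normSq_apply]; simp [hn, cross]; ring
      rw [this]; exact Complex.normSq_pos.2 (hv.next_ne k)
    have e := eq_comb_of_cross hcr.ne' n
    set α := cross n (b - O) / cross (a - O) (b - O)
    set β := cross (a - O) n / cross (a - O) (b - O)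
    have hα : 0 < α := div_pos hncr hcr
    have hpt : ∀ ε : ℝ, (O + b) / 2 - (ε : ℂ) * Complex.I * (b - O) =
        O + (ε * α) • (a - O) + (1 / 2 + ε * β) • (b - O) := by
      intro ε
      have e' : (O + b) / 2 - (ε : ℂ) * Complex.I * (b - O) = (O + b) / 2 + ε • n := by
        rw [hn, Complex.real_smul]; ring
      rw [e', e]
      simp only [Complex.real_smul]
      push_cast
      ring
    have l1 : ∀ᶠ ε : ℝ in 𝓝[>] 0, 0 < 1 / 2 + ε * β := by
      apply nhdsWithin_le_nhds
      have : ContinuousAt (fun ε : ℝ => 1 / 2 + ε * β) 0 := by fun_prop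
      exact this.eventually (lt_mem_nhds (by norm_num))
    have l2 : ∀ᶠ ε : ℝ in 𝓝[>] 0, ε * α + (1 / 2 + ε * β) < 1 := by
      apply nhdsWithin_le_nhds
      have : ContinuousAt (fun ε : ℝ => ε * α + (1 / 2 + ε * β)) 0 := by fun_prop
      exact this.eventually (gt_mem_nhds (by norm_num))
    obtain ⟨ε, hε, e1, e2, e3⟩ := ((hv.right k).and (l1.and (l2.and self_mem_nhdsWithin))).exists
    have e3' : (0 : ℝ) < ε := e3
    refine ⟨_, hε, ?_⟩
    change 0 < p ((O + b) / 2 - (ε : ℂ) * Complex.I * (b - O)) ∧ _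
    rw [hpt ε, c.fst, c.snd]
    exact ⟨mul_pos e3' hα, e1, e2⟩
  by_cases hab : A.Adj a b
  · exact absurd (hf.isTriangularFace hO ha hb c hOa hOb hab
      (fun d hd d₁ d₂ d₃ => by linarith [hD d hd d₁ d₂ d₃.le]) hwf w1 w2 w3) hnt
  have hS : ∀ d, 0 < p d → 0 < h d → p d + h d ≤ 1 → d ∉ drawing P A := by
    intro d d₁ d₂ d₃ hdD
    have d₄ := hD d hdD d₁ d₂ d₃
    apply hab
    refine hG.adj_of_touch (d := d) (c.aff_fst.comb c.aff_snd 1 1 (-1)) ?_ ?_ ?_ hdD ?_ habne ?_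
    · rw [c.fst_a, c.snd_a]; norm_num
    · rw [c.fst_b, c.snd_b]; norm_num
    · refine mem_openSegment_iff_lin.2 ⟨h d, d₂, by linarith, ?_⟩
      conv_lhs => rw [c.eq d, show p d = 1 - h d by linarith]
      module
    · intro q hq e
      exact c.eq_or_eq hP ha hb hq habne (by
        rw [c.fst_a, c.snd_a, c.fst_b, c.snd_b]; linarith)
    · intro r hr
      filter_upwards [c.aff_fst.eventually_pos d₁ r, c.aff_snd.eventually_pos d₂ r,
        (c.aff_fst.comb c.aff_snd 1 1 (-1)).eventually_neg (d := d) (by linarith) hr] with t t1 t2 t3 htD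
      have := hD _ htD t1 t2 (by linarith)
      linarith
  have hSconv : Convex ℝ {q | 0 < p q ∧ 0 < h q ∧ 0 ≤ (-1) * p q + (-1) * h q + 1} :=
    c.aff_fst.convex_pos.inter (c.aff_snd.convex_pos.inter haff3.convex_nonneg)
  have hSf := hf.absorb hSconv.isPreconnected
    (fun d hd => hS d hd.1 hd.2.1 (by linarith [hd.2.2])) ⟨w1, w2, by linarith⟩ hwf
  have hseg : openSegment ℝ a b ⊆ f := by
    intro d hd
    obtain ⟨t, t0, t1, rfl⟩ := mem_openSegment_iff_lin.1 hd
    apply hSf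
    refine ⟨?_, ?_, ?_⟩
    · show 0 < p _
      rw [c.aff_fst, c.fst_a, c.fst_b]; linarith
    · show 0 < h _
      rw [c.aff_snd, c.snd_a, c.snd_b]; linarith
    · show 0 ≤ (-1) * p _ + (-1) * h _ + 1
      rw [c.aff_fst, c.fst_a, c.fst_b, c.aff_snd, c.snd_a, c.snd_b]; linarith
  have hlt : ∀ᶠ t : ℝ in 𝓝[>] 0, t < 1 := nhdsWithin_le_nhds (Iio_mem_nhds one_pos)
  -- an edge inside one of the angles at `a` and `b` of the triangle would run through `f`
  have hwb : ∀ q, A.Adj b q → ∀ α β : ℝ, 0 < α → 0 ≤ β → q - b ≠ α • (a - b) + β • (O - b) := by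
    intro q hq α β hα hβ e
    have e' : q = O + α • (a - O) + (1 - α - β) • (b - O) := by
      rw [sub_eq_iff_eq_add] at e
      rw [e]; module
    have hpq : p q = α := by rw [e', c.fst]
    have hhq : h q = 1 - α - β := by rw [e', c.snd]
    obtain ⟨t, t1, t2, t3⟩ := ((c.aff_snd.eventually_pos (d := b) (by rw [c.snd_b]; norm_num) q).and
      (hlt.and self_mem_nhdsWithin)).exists
    have t3' : (0 : ℝ) < t := t3
    refine hS _ ?_ t1 ?_ (segment_subset_drawing hq
      (mem_segment_iff_lin.2 ⟨t, t3'.le, t2.le, rfl⟩))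
    · rw [c.aff_fst, c.fst_b, hpq]; nlinarith
    · rw [c.aff_fst, c.fst_b, hpq, c.aff_snd, c.snd_b, hhq]; nlinarith
  have hwa : ∀ q, A.Adj a q → ∀ α β : ℝ, 0 < α → 0 ≤ β → q - a ≠ α • (b - a) + β • (O - a) := by
    intro q hq α β hα hβ e
    have e' : q = O + (1 - α - β) • (a - O) + α • (b - O) := by
      rw [sub_eq_iff_eq_add] at e
      rw [e]; module
    have hpq : p q = 1 - α - β := by rw [e', c.fst]
    have hhq : h q = α := by rw [e', c.snd]
    obtain ⟨t, t1, t2, t3⟩ := ((c.aff_fst.eventually_pos (d := a) (by rw [c.fst_a]; norm_num) q).and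
      (hlt.and self_mem_nhdsWithin)).exists
    have t3' : (0 : ℝ) < t := t3
    refine hS _ t1 ?_ ?_ (segment_subset_drawing hq
      (mem_segment_iff_lin.2 ⟨t, t3'.le, t2.le, rfl⟩))
    · rw [c.aff_snd, c.snd_a, hhq]; nlinarith
    · rw [c.aff_fst, c.fst_a, hpq, c.aff_snd, c.snd_a, hhq]; nlinarith
  have ek : k + 1 - 1 = k := by ring
  have ek' : k - 1 + 1 = k := by ring
  refine ⟨⟨hseg, ?_⟩, ⟨by rw [openSegment_symm]; exact hseg, ?_⟩⟩
  · refine hv.inCorner_of_next (k := k - 1) ?_ ?_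
    · rw [ek']
      show 0 < cross (b - a) (O - a)
      convert hcr using 1
      simp [cross]; ring
    · rw [ek']; exact hwa
  · refine hv.inCorner_of_prev (k := k + 1) ?_ ?_
    · rw [ek]
      show 0 < cross (O - b) (a - b)
      convert hcr using 1
      simp [cross]; ring
    · rw [ek]; exact hwb

end

/-! ### Chains of edges facing an edge -/

theorem IsAff.wedge {g : ℂ → ℝ} (hg : IsAff g) (e a b : ℂ) (α β : ℝ) :
    g (e + α • (a - e) + β • (b - e)) = g e + α * (g a - g e) + β * (g b - g e) := by
  have h1 : e + α • (a - e) + β • (b - e) =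
      (1 - (1 / 2 : ℝ)) • ((1 - 2 * α) • e + (2 * α) • a) +
        (1 / 2 : ℝ) • ((1 - 2 * β) • e + (2 * β) • b) := by module
  rw [h1, hg, hg, hg]
  ring

section

variable {P : Finset ℂ} {A : SimpleGraph ℂ} {f : Set ℂ} {o : ℂ} {s : ℝ} {x y w : ℂ}

/-- The vertex `w` sees the end `x` of the edge `x y` through the face `f`, and `x` has no edges
in the angle from the line of sight to the edge. -/
structure SeesEnd (P : Finset ℂ) (A : SimpleGraph ℂ) (f : Set ℂ) (x y w : ℂ) : Prop where
  mem : w ∈ P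
  indep : cross (w - x) (y - x) ≠ 0
  seg : openSegment ℝ x w ⊆ f
  wedge : ∀ q, A.Adj x q → ∀ α β : ℝ, 0 < α → 0 ≤ β → q - x ≠ α • (w - x) + β • (y - x)

/-- The edge `w w'` is the first one at `w` in the angle from `x` to `y`, and no other vertex of
the triangle `x w y` lies on the side of `x` of it. -/
structure ChainEdge (P : Finset ℂ) (A : SimpleGraph ℂ) (x y w w' : ℂ) : Prop where
  mem : w' ∈ convexHull ℝ {x, w, y}
  adj : A.Adj w w'
  turn : ∃ η : ℝ, 0 < η ∧ cross (x - w) (w' - w) = -η * cross (w - x) (y - x)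
  side : ∀ q ∈ P, q ∈ convexHull ℝ {x, w, y} → q ≠ x →
    cross (w' - w) (q - w) * cross (w - x) (y - x) ≤ 0
  wedge : ∀ q, A.Adj w q → ∀ α β : ℝ, 0 < α → 0 ≤ β → q - w ≠ α • (x - w) + β • (w' - w)
  wedge' : ∀ q, A.Adj w' q → ∀ α β : ℝ, 0 < α → 0 ≤ β → (w' = y → 0 < β) →
    q - w' ≠ α • (x - w') + β • (w - w')
  orient : w' ≠ y → ∃ κ : ℝ, 0 < κ ∧ cross (w' - x) (y - x) = κ * cross (w - x) (y - x)

/-- If `w` sees the end `x` of the edge `x y` and is near all vertices in the triangle `x w y`,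
then the boundary of the hull of these vertices starts at `w` with an edge, and the other end of
this edge also sees `x`, or equals `y`. -/
theorem SeesEnd.exists_chainEdge (hA : IsMaximalPSLG P o s A)
    (hP : GenPos P) (hf : IsFace P A f) (hxy : A.Adj x y) (hw : SeesEnd P A f x y w)
    (hnear : ∀ q ∈ P, q ∈ convexHull ℝ {x, w, y} → q ≠ x → Near o s w q) :
    ∃ w', ChainEdge P A x y w w' ∧ w ∉ convexHull ℝ {x, w', y} ∧
      (w' ≠ y → SeesEnd P A f x y w') := by
  have hG := hA.pslg
  have hx := (hG.mem _ _ hxy).1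
  have hy := (hG.mem _ _ hxy).2
  obtain ⟨p, h, c⟩ := exists_coords hw.indep
  have hDseg : ∀ d ∈ drawing P A, h d = 0 → 0 < p d → p d < 1 → False := by
    intro d hd e1 e2 e3
    refine hf.subset (hw.seg (mem_openSegment_iff_lin.2 ⟨p d, e2, e3, ?_⟩)) hd
    conv_lhs => rw [c.eq d, e1]
    module
  -- the first vertex of the triangle that a ray from `w` meets when it turns from `x` to `y`
  obtain ⟨w', hw', hmin⟩ := (P.filter fun q => 0 ≤ p q ∧ 0 < h q ∧ p q + h q ≤ 1).exists_min_image
    (fun q => h q / (1 - p q)) ⟨y, by simp [hy, c.fst_b, c.snd_b]⟩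
  simp only [Finset.mem_filter] at hw' hmin
  obtain ⟨hw'P, p0, h0, ph1⟩ := hw'
  set τ := h w' / (1 - p w') with hτ
  have hp1 : 0 < 1 - p w' := by linarith
  have hτ0 : 0 < τ := div_pos h0 hp1
  have hτ1 : τ ≤ 1 := by rw [hτ, div_le_one hp1]; linarith
  have hhw' : h w' = τ * (1 - p w') := by rw [hτ, div_mul_cancel₀ _ hp1.ne']
  set φ : ℂ → ℝ := fun q => τ * p q + 1 * h q + -τ with hφdef
  have hφ : IsAff φ := c.aff_fst.comb c.aff_snd τ 1 (-τ)
  have φx : φ x = -τ := by simp [hφdef, c.fst_O, c.snd_O]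
  have φw : φ w = 0 := by simp [hφdef, c.fst_a, c.snd_a]
  have φw' : φ w' = 0 := by simp only [hφdef]; rw [hhw']; ring
  have hφP : ∀ q ∈ P, 0 ≤ p q → 0 < h q → p q + h q ≤ 1 → 0 ≤ φ q := by
    intro q hq e1 e2 e3
    have h1 : 0 < 1 - p q := by linarith
    have := hmin q ⟨hq, e1, e2, e3⟩
    rw [le_div_iff₀ h1] at this
    simp only [hφdef]; linarith
  have hside : ∀ r t, A.Adj r t → ∀ d ∈ segment ℝ r t, 0 < p d → 0 < h d →
      ∀ d' ∈ segment ℝ r t, 0 ≤ p d' → 0 ≤ h d' → p d' + h d' ≤ 1 → (p d' = 0 ∨ h d' = 0) →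
        0 ≤ φ d' := by
    intro r t hrt d hd d₁ d₂ d' hd' h1 h2 h3 h4
    by_cases hd'O : d' = x
    · exfalso
      have key : ∀ e, A.Adj x e → d ∈ segment ℝ x e → False := by
        intro e he hde
        obtain ⟨t, t0, t1, rfl⟩ := mem_segment_iff_lin.1 hde
        rw [c.aff_fst, c.fst_O] at d₁
        rw [c.aff_snd, c.snd_O] at d₂
        exact hw.wedge e he (p e) (h e) (by nlinarith) (by nlinarith)
          (by conv_lhs => rw [c.eq e]
              module)
      rcases hG.vertex_on_edge hrt hd' (hd'O ▸ hx) with e | e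
      · rw [hd'O] at e; subst e; exact key t hrt hd
      · rw [hd'O] at e; subst e; exact key r hrt.symm (by rwa [segment_symm])
    rcases h4 with h4 | h4
    · by_cases hd'b : d' = y
      · simp only [hd'b, hφdef, c.fst_b, c.snd_b]; linarith
      exfalso
      have hlt : h d' < 1 := lt_of_le_of_ne (by linarith) fun e =>
        hd'b (c.ext (by rw [h4, c.fst_b]) (by rw [e, c.snd_b]))
      have hgt : 0 < h d' := lt_of_le_of_ne h2 fun e =>
        hd'O (c.ext (by rw [h4, c.fst_O]) (by rw [← e, c.snd_O]))
      have hmem : d' ∈ openSegment ℝ x y := by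
        refine mem_openSegment_iff_lin.2 ⟨h d', hgt, hlt, ?_⟩
        conv_lhs => rw [c.eq d', h4]
        module
      exact d₁.ne' (hG.eq_zero_of_meet c.aff_fst hrt hxy c.fst_O c.fst_b hd hd' hmem)
    · by_cases hd'a : d' = w
      · rw [hd'a, φw]
      exfalso
      have hlt : p d' < 1 := lt_of_le_of_ne (by linarith) fun e =>
        hd'a (c.ext (by rw [e, c.fst_a]) (by rw [h4, c.snd_a]))
      have hgt : 0 < p d' := lt_of_le_of_ne h1 fun e =>
        hd'O (c.ext (by rw [← e, c.fst_O]) (by rw [h4, c.snd_O]))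
      exact hDseg d' (segment_subset_drawing hrt hd') h4 hgt hlt
  have hhull : ∀ d ∈ drawing P A, 0 < p d → 0 < h d → p d + h d ≤ 1 → 0 ≤ φ d := by
    intro d hd d₁ d₂ d₃
    refine hG.drawing_subset_halfPlane c.aff_fst c.aff_snd
      (c.aff_fst.comb c.aff_snd (-1) (-1) 1) hφ
      (fun r t hrt d hd d₁ d₂ _ d' hd' e1 e2 e3 e4 =>
        hside r t hrt d hd d₁ d₂ d' hd' e1 e2 (by linarith) e4)
      (fun q hqP e1 e2 e3 => hφP q hqP e1.le e2 (by linarith))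
      (fun q e1 e2 e3 => ?_) hd d₁ d₂ (by linarith)
    have : p q = 1 - h q := by linarith
    simp only [hφdef, this]
    nlinarith
  -- the part of the triangle cut off by the line `w w'` on the side of `x`
  have hZ : ∀ d, 0 < p d → 0 ≤ h d → φ d < 0 → d ∉ drawing P A := by
    intro d d₁ d₂ d₃ hdD
    have d₃' : τ * p d + 1 * h d + -τ < 0 := d₃
    have hlt : p d < 1 := by nlinarith
    rcases d₂.eq_or_lt with e | e
    · exact hDseg d hdD e.symm d₁ hlt
    · linarith [hhull d hdD d₁ e (by nlinarith)]
  have hZconv : Convex ℝ {q | 0 < p q ∧ 0 ≤ h q ∧ 0 < (-τ) * p q + (-1) * h q + τ} :=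
    c.aff_fst.convex_pos.inter (c.aff_snd.convex_nonneg.inter
      (c.aff_fst.comb c.aff_snd (-τ) (-1) τ).convex_pos)
  have hmid : (1 - (1 / 2 : ℝ)) • x + (1 / 2 : ℝ) • w ∈ openSegment ℝ x w :=
    mem_openSegment_iff_lin.2 ⟨1 / 2, by norm_num, by norm_num, rfl⟩
  have hZf := hf.absorb hZconv.isPreconnected
    (fun d hd => hZ d hd.1 hd.2.1 (by have := hd.2.2; simp only [hφdef]; linarith))
    (w := (1 - (1 / 2 : ℝ)) • x + (1 / 2 : ℝ) • w)
    (by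
      have e1 : p ((1 - (1 / 2 : ℝ)) • x + (1 / 2 : ℝ) • w) = 1 / 2 := by
        rw [c.aff_fst, c.fst_O, c.fst_a]; norm_num
      have e2 : h ((1 - (1 / 2 : ℝ)) • x + (1 / 2 : ℝ) • w) = 0 := by
        rw [c.aff_snd, c.snd_O, c.snd_a]; norm_num
      refine ⟨?_, ?_, ?_⟩
      · show 0 < p _
        rw [e1]; norm_num
      · show 0 ≤ h _
        rw [e2]
      · show 0 < (-τ) * p _ + (-1) * h _ + τ
        rw [e1, e2]; linarith) (hw.seg hmid)
  have hww' : w ≠ w' := by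
    intro e; rw [← e, c.snd_a] at h0; exact lt_irrefl _ h0
  have hmem : w' ∈ convexHull ℝ {x, w, y} := by
    rw [c.convexHull_eq]; exact ⟨p0, h0.le, ph1⟩
  have hw'x : w' ≠ x := by
    intro e; rw [e, c.snd_O] at h0; exact lt_irrefl _ h0
  have honly : ∀ q ∈ P, φ q = 0 → q = w ∨ q = w' := by
    intro q hq e
    refine c.eq_or_eq hP hw.mem hw'P hq hww' ?_
    have e' : τ * p q + 1 * h q + -τ = 0 := e
    have : h q = τ * (1 - p q) := by linarith
    rw [this, hhw', c.fst_a, c.snd_a]; ring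
  have hadj : A.Adj w w' := by
    by_contra hn
    refine hA.not_near hw.mem hw'P hww' (fun d hd hdD => hn ?_) (hnear w' hw'P hmem hw'x)
    refine hG.adj_of_touch hφ φw φw' hd hdD honly hww' fun r hr => ?_
    obtain ⟨t, t0, t1, rfl⟩ := mem_openSegment_iff_lin.1 hd
    set d := (1 - t) • w + t • w'
    have d1 : 0 < p d := by rw [c.aff_fst, c.fst_a]; nlinarith
    have d2 : 0 < h d := by rw [c.aff_snd, c.snd_a]; nlinarith
    have d3 : φ d = 0 := by rw [hφ, φw, φw']; ring
    filter_upwards [c.aff_fst.eventually_pos d1 r, c.aff_snd.eventually_pos d2 r,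
      hφ.eventually_neg d3 hr] with t t1 t2 t3
    exact hZ _ t1 t2.le t3
  have hlt : ∀ᶠ t : ℝ in 𝓝[>] 0, t < 1 := nhdsWithin_le_nhds (Iio_mem_nhds one_pos)
  have hew : w' - w = (p w' - 1) • (w - x) + h w' • (y - x) := by
    conv_lhs => rw [c.eq w']
    module
  have hpos : w' ≠ y → 0 < p w' := by
    intro hne
    refine lt_of_le_of_ne p0 fun e0 => ?_
    have h1 : h w' < 1 := lt_of_le_of_ne (by linarith) fun e1 =>
      hne (c.ext (by rw [← e0, c.fst_b]) (by rw [e1, c.snd_b]))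
    refine hG.vertex_free x y hxy w' hw'P (mem_openSegment_iff_lin.2 ⟨h w', h0, h1, ?_⟩)
    conv_lhs => rw [c.eq w', ← e0]
    module
  have hew' : w' - x = p w' • (w - x) + h w' • (y - x) := by
    conv_lhs => rw [c.eq w']
    module
  have hcr : cross (w' - x) (y - x) = p w' * cross (w - x) (y - x) := by
    rw [hew']
    simp [cross]; ring
  refine ⟨w', ⟨hmem, hadj, ⟨h w', h0, ?_⟩, ?_, ?_, ?_, fun hne => ⟨p w', hpos hne, hcr⟩⟩, ?_,
    fun hne => ?_⟩
  · rw [hew]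
    simp [cross]; ring
  · intro q hq hqT hqx
    rw [c.convexHull_eq] at hqT
    obtain ⟨e1, e2, e3⟩ := hqT
    have hφq : 0 ≤ φ q := by
      rcases e2.eq_or_lt with e | e
      · by_cases hqw : q = w
        · rw [hqw, φw]
        exfalso
        refine hDseg q (Or.inl hq) e.symm (lt_of_le_of_ne e1 fun e' => ?_)
          (lt_of_le_of_ne (by linarith) fun e' => ?_)
        · exact hqx (c.ext (by rw [← e', c.fst_O]) (by rw [← e, c.snd_O]))
        · exact hqw (c.ext (by rw [e', c.fst_a]) (by rw [← e, c.snd_a]))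
      · exact hφP q hq e1 e e3
    have hφq' : 0 ≤ τ * p q + 1 * h q + -τ := hφq
    have heq : q - w = (p q - 1) • (w - x) + h q • (y - x) := by
      conv_lhs => rw [c.eq q]
      module
    have e : cross (w' - w) (q - w) =
        -((1 - p w') * (τ * p q + 1 * h q + -τ)) * cross (w - x) (y - x) := by
      rw [hew, heq, hhw']
      simp [cross]; ring
    rw [e, mul_assoc]
    have := mul_nonneg hp1.le hφq'
    have := mul_self_nonneg (cross (w - x) (y - x))
    nlinarith
  · intro q hq α β hα hβ e
    have e' : q = w + α • (x - w) + β • (w' - w) := by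
      rw [sub_eq_iff_eq_add] at e; rw [e]; module
    have hφq : φ q = -(α * τ) := by rw [e', hφ.wedge, φx, φw, φw']; ring
    have hhq : h q = β * h w' := by rw [e', c.aff_snd.wedge, c.snd_O, c.snd_a]; ring
    obtain ⟨t, t1, t2, t3, t4⟩ := ((c.aff_fst.eventually_pos (d := w) (by rw [c.fst_a]; norm_num)
      q).and ((hφ.eventually_neg φw (by rw [hφq]; have := mul_pos hα hτ0; linarith)).and
        (hlt.and self_mem_nhdsWithin))).exists
    have t4' : (0 : ℝ) < t := t4
    refine hZ _ t1 ?_ t2 (segment_subset_drawing hq (mem_segment_iff_lin.2 ⟨t, t4'.le, t3.le, rfl⟩))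
    rw [c.aff_snd, c.snd_a, hhq]; positivity
  · intro q hq α β hα hβ hβ' e
    have e' : q = w' + α • (x - w') + β • (w - w') := by
      rw [sub_eq_iff_eq_add] at e; rw [e]; module
    have hφq : φ q = -(α * τ) := by rw [e', hφ.wedge, φx, φw, φw']; ring
    have hpq : p q = p w' - α * p w' + β * (1 - p w') := by
      rw [e', c.aff_fst.wedge, c.fst_O, c.fst_a]; ring
    have hev : ∀ᶠ t : ℝ in 𝓝[>] 0, 0 < p ((1 - t) • w' + t • q) := by
      rcases p0.eq_or_lt with e0 | e0
      · have hw'y : w' = y := by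
          by_contra hne
          exact (hpos hne).ne e0
        filter_upwards [self_mem_nhdsWithin] with t ht
        have ht' : (0 : ℝ) < t := ht
        rw [c.aff_fst, hpq, ← e0]
        have := mul_pos ht' (hβ' hw'y)
        linarith
      · exact c.aff_fst.eventually_pos e0 q
    obtain ⟨t, t1, t2, t3, t4, t5⟩ := (hev.and ((c.aff_snd.eventually_pos h0 q).and
      ((hφ.eventually_neg φw' (by rw [hφq]; have := mul_pos hα hτ0; linarith)).and
        (hlt.and self_mem_nhdsWithin)))).exists
    have t5' : (0 : ℝ) < t := t5
    exact hZ _ t1 t2.le t3 (segment_subset_drawing hq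
      (mem_segment_iff_lin.2 ⟨t, t5'.le, t4.le, rfl⟩))
  · intro hmemw
    have : w ∈ {q | 0 ≤ (-1) * p q + 0 * h q + p w'} := by
      refine convexHull_min ?_ (c.aff_fst.comb c.aff_snd (-1) 0 (p w')).convex_nonneg hmemw
      rintro q (rfl | rfl | rfl)
      · show 0 ≤ (-1) * p _ + 0 * h _ + p w'
        rw [c.fst_O]; linarith
      · show 0 ≤ (-1) * p _ + 0 * h _ + p q
        linarith
      · show 0 ≤ (-1) * p _ + 0 * h _ + p w'
        rw [c.fst_b]; linarith
    have : 0 ≤ (-1) * p w + 0 * h w + p w' := this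
    rw [c.fst_a] at this
    linarith
  · have hpos := hpos hne
    refine ⟨hw'P, ?_, ?_, ?_⟩
    · rw [hcr]
      exact mul_ne_zero hpos.ne' hw.indep
    · intro d hd
      obtain ⟨t, t0, t1, rfl⟩ := mem_openSegment_iff_lin.1 hd
      apply hZf
      have e3 : φ ((1 - t) • x + t • w') < 0 := by
        rw [hφ, φx, φw']; nlinarith
      refine ⟨?_, ?_, ?_⟩
      · show 0 < p _
        rw [c.aff_fst, c.fst_O]; nlinarith
      · show 0 ≤ h _
        rw [c.aff_snd, c.snd_O]; nlinarith
      · show 0 < (-τ) * p _ + (-1) * h _ + τ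
        simp only [hφdef] at e3
        linarith
    · intro q hq α β hα hβ e
      refine hw.wedge q hq (α * p w') (α * h w' + β) (mul_pos hα hpos) (by positivity) ?_
      rw [e, hew']
      module

end

section

variable {P : Finset ℂ} {A : SimpleGraph ℂ} {f : Set ℂ} {o : ℂ} {s : ℝ} {x y : ℂ}
  {v : ℤ → ℂ} {m : ℕ}

theorem SeesEnd.ne {w : ℂ} (hw : SeesEnd P A f x y w) : w ≠ x := by
  rintro rfl
  exact hw.indep (by simp [cross])

theorem hull_mono {x y w w' : ℂ} (h : w' ∈ convexHull ℝ {x, w, y}) :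
    convexHull ℝ {x, w', y} ⊆ convexHull ℝ {x, w, y} := by
  refine convexHull_min ?_ (convex_convexHull ℝ _)
  rintro q (rfl | rfl | rfl)
  · exact subset_convexHull ℝ _ (by simp)
  · exact h
  · exact subset_convexHull ℝ _ (by simp)

open Classical in
theorem card_hull_lt {x y w w' : ℂ} (hwP : w ∈ P) (h : w' ∈ convexHull ℝ {x, w, y})
    (hw : w ∉ convexHull ℝ {x, w', y}) :
    (P.filter fun q => q ∈ convexHull ℝ {x, w', y}).card <
      (P.filter fun q => q ∈ convexHull ℝ {x, w, y}).card := by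
  apply Finset.card_lt_card
  rw [Finset.ssubset_iff_of_subset]
  · refine ⟨w, ?_, ?_⟩
    · simp only [Finset.mem_filter]
      exact ⟨hwP, subset_convexHull ℝ _ (by simp)⟩
    · simp only [Finset.mem_filter, not_and]
      exact fun _ => hw
  · intro q hq
    simp only [Finset.mem_filter] at hq ⊢
    exact ⟨hq.1, hull_mono h hq.2⟩

open Classical in
/-- Let `v k`, on the right of the line from `x` to `y`, see the end `x` of the edge `x y`, and let
the vertices in the triangle `x (v k) y` other than `x` be pairwise near. The hull chain of these
vertices, followed from `v k`, is the walk followed backwards until it traverses `x y`. The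
induction is on the number of vertices in the triangle. -/
theorem IsBoundaryWalk.backward_chain (hA : IsMaximalPSLG P o s A) (hP : GenPos P)
    (hf : IsFace P A f) (hv : IsBoundaryWalk A f v m) (hxy : A.Adj x y) (n : ℕ) :
    ∀ k : ℤ, (P.filter fun q => q ∈ convexHull ℝ {x, v k, y}).card = n →
      SeesEnd P A f x y (v k) → 0 < cross (v k - x) (y - x) → InCorner v k (x - v k) →
      (∀ q ∈ P, ∀ q' ∈ P, q ∈ convexHull ℝ {x, v k, y} → q' ∈ convexHull ℝ {x, v k, y} →
        q ≠ x → q' ≠ x → Near o s q q') →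
      ∃ c : ℤ, c < k ∧ v c = y ∧ v (c - 1) = x ∧ ConvexAt v c ∧
        (∀ i, c < i → i < k → ReflexAt v i) ∧
        ∀ i, c < i → i ≤ k → v i ∈ convexHull ℝ {x, v k, y} ∧ SeesEnd P A f x y (v i) ∧
          0 < cross (v i - x) (y - x) ∧ InCorner v i (x - v i) := by
  have hG := hA.pslg
  induction n using Nat.strong_induction_on with
  | _ n ih =>
  intro k hn hsee hC hcor hnear
  obtain ⟨w', hch, hout, hnext⟩ := hsee.exists_chainEdge hA hP hf hxy
    (fun q hq hqT hqx => hnear _ hsee.mem _ hq (subset_convexHull ℝ _ (by simp)) hqT hsee.ne hqx)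
  obtain ⟨η, hη, hturn⟩ := hch.turn
  have hprev : v (k - 1) = w' := by
    refine hv.eq_prev hG hP (Or.inl hcor) hch.adj ?_
      (fun q hq α β hα hβ => hch.wedge q hq α β hα hβ.le)
    rw [cross_comm, hturn]
    have := mul_pos hη hC
    linarith
  subst hprev
  have hk0 : v k ∈ convexHull ℝ {x, v k, y} := subset_convexHull ℝ _ (by simp)
  have hy0 : y ∈ convexHull ℝ {x, v k, y} := subset_convexHull ℝ _ (by simp)
  have hkk : k - 1 + 1 = k := by ring
  by_cases hw'y : v (k - 1) = y
  · have hcr : 0 < cross (x - v (k - 1)) (v k - v (k - 1)) := by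
      rw [hw'y]
      convert hC using 1
      simp [cross]; ring
    have hx : v (k - 1 - 1) = x := by
      refine hv.eq_prev hG hP (d := v k - v (k - 1)) (Or.inr (by rw [hkk]))
        (by rw [hw'y]; exact hxy.symm) hcr (fun q hq α β hα hβ e => ?_)
      exact hch.wedge' q hq β α hβ hα.le (fun _ => hα) (by rw [e, add_comm])
    refine ⟨k - 1, by lia, hw'y, hx, ?_, fun i h1 h2 => by lia, fun i h1 h2 => ?_⟩
    · apply hv.convexAt_of_cross
      rw [hx, hkk]; exact hcr
    · obtain rfl : i = k := by lia
      exact ⟨hk0, hsee, hC, hcor⟩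
  · obtain ⟨κ, hκ, hκe⟩ := hch.orient hw'y
    have hC' : 0 < cross (v (k - 1) - x) (y - x) := by rw [hκe]; positivity
    have hcor' : InCorner v (k - 1) (x - v (k - 1)) := by
      refine hv.inCorner_of_next ?_ (fun q hq α β hα hβ => ?_)
      · rw [hkk]
        have e : cross (x - v (k - 1)) (v k - v (k - 1)) =
            -cross (x - v k) (v (k - 1) - v k) := by simp [cross]; ring
        rw [e, hturn]
        have := mul_pos hη hC
        linarith
      · rw [hkk]
        exact hch.wedge' q hq α β hα hβ (fun h => absurd h hw'y)
    have hsub := hull_mono hch.mem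
    obtain ⟨c, hc, h1, h2, h3, h4, h5⟩ := ih _ (hn ▸ card_hull_lt hsee.mem hch.mem hout) (k - 1) rfl
      (hnext hw'y) hC' hcor'
      (fun q hq q' hq' hT hT' => hnear q hq q' hq' (hsub hT) (hsub hT'))
    refine ⟨c, by lia, h1, h2, h3, fun i hi1 hi2 => ?_, fun i hi1 hi2 => ?_⟩
    · rcases (show i < k - 1 ∨ i = k - 1 by lia) with hi | rfl
      · exact h4 i hi1 hi
      · refine hv.reflexAt_of_not_convexAt hG hP fun hcv => ?_
        have hpos := hv.cross_pos_of_convexAt hcv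
        rw [hkk] at hpos
        have hq : v (k - 1 - 1) ∈ convexHull ℝ {x, v k, y} ∧ v (k - 1 - 1) ≠ x := by
          rcases (show c < k - 1 - 1 ∨ c = k - 1 - 1 by lia) with hc' | hc'
          · have := h5 (k - 1 - 1) hc' (by lia)
            exact ⟨hsub this.1, this.2.1.ne⟩
          · rw [← hc', h1]; exact ⟨hy0, hxy.ne'⟩
        have hs := hch.side _ (hG.mem _ _ (hv.adj_prev (k - 1))).2 hq.1 hq.2
        have e : cross (v (k - 1 - 1) - v (k - 1)) (v k - v (k - 1)) =
            cross (v (k - 1) - v k) (v (k - 1 - 1) - v k) := by simp [cross]; ring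
        rw [e] at hpos
        have := mul_pos hpos hC
        linarith
    · rcases (show i ≤ k - 1 ∨ i = k by lia) with hi | rfl
      · have := h5 i hi1 hi
        exact ⟨hsub this.1, this.2⟩
      · exact ⟨hk0, hsee, hC, hcor⟩

open Classical in
/-- The mirror image of `IsBoundaryWalk.backward_chain`: if `v k` lies on the left of the line from
`x` to `y`, the hull chain is the walk followed forwards until it traverses `y x`. -/
theorem IsBoundaryWalk.forward_chain (hA : IsMaximalPSLG P o s A) (hP : GenPos P)
    (hf : IsFace P A f) (hv : IsBoundaryWalk A f v m) (hxy : A.Adj x y) (n : ℕ) :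
    ∀ k : ℤ, (P.filter fun q => q ∈ convexHull ℝ {x, v k, y}).card = n →
      SeesEnd P A f x y (v k) → cross (v k - x) (y - x) < 0 → InCorner v k (x - v k) →
      (∀ q ∈ P, ∀ q' ∈ P, q ∈ convexHull ℝ {x, v k, y} → q' ∈ convexHull ℝ {x, v k, y} →
        q ≠ x → q' ≠ x → Near o s q q') →
      ∃ c : ℤ, k < c ∧ v c = y ∧ v (c + 1) = x ∧ ConvexAt v c ∧
        (∀ i, k < i → i < c → ReflexAt v i) ∧
        ∀ i, k ≤ i → i < c → v i ∈ convexHull ℝ {x, v k, y} ∧ SeesEnd P A f x y (v i) ∧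
          cross (v i - x) (y - x) < 0 ∧ InCorner v i (x - v i) := by
  have hG := hA.pslg
  induction n using Nat.strong_induction_on with
  | _ n ih =>
  intro k hn hsee hC hcor hnear
  obtain ⟨w', hch, hout, hnext⟩ := hsee.exists_chainEdge hA hP hf hxy
    (fun q hq hqT hqx => hnear _ hsee.mem _ hq (subset_convexHull ℝ _ (by simp)) hqT hsee.ne hqx)
  obtain ⟨η, hη, hturn⟩ := hch.turn
  have hηC : 0 < -η * cross (v k - x) (y - x) := by
    have := mul_pos_of_neg_of_neg (neg_neg_of_pos hη) hC
    linarith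
  have hprev : v (k + 1) = w' :=
    hv.eq_next hG hP hcor hch.adj (by rw [hturn]; exact hηC) hch.wedge
  subst hprev
  have hk0 : v k ∈ convexHull ℝ {x, v k, y} := subset_convexHull ℝ _ (by simp)
  have hy0 : y ∈ convexHull ℝ {x, v k, y} := subset_convexHull ℝ _ (by simp)
  have hkk : k + 1 - 1 = k := by ring
  by_cases hw'y : v (k + 1) = y
  · have hcr : 0 < cross (v k - v (k + 1)) (x - v (k + 1)) := by
      rw [hw'y]
      have e : cross (v k - y) (x - y) = - cross (v k - x) (y - x) := by simp [cross]; ring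
      rw [e]; linarith
    have hx : v (k + 1 + 1) = x := by
      refine hv.eq_next_of_prev hG hP (by rw [hw'y]; exact hxy.symm) (by rw [hkk]; exact hcr)
        (fun q hq α β hα hβ e => ?_)
      rw [hkk] at e
      exact hch.wedge' q hq β α hβ hα.le (fun _ => hα) (by rw [e, add_comm])
    refine ⟨k + 1, by lia, hw'y, hx, ?_, fun i h1 h2 => by lia, fun i h1 h2 => ?_⟩
    · apply hv.convexAt_of_cross
      rw [hx, hkk]; exact hcr
    · obtain rfl : i = k := by lia
      exact ⟨hk0, hsee, hC, hcor⟩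
  · obtain ⟨κ, hκ, hκe⟩ := hch.orient hw'y
    have hC' : cross (v (k + 1) - x) (y - x) < 0 := by
      rw [hκe]; exact mul_neg_of_pos_of_neg hκ hC
    have hcor' : InCorner v (k + 1) (x - v (k + 1)) := by
      refine hv.inCorner_of_prev ?_ (fun q hq α β hα hβ => ?_)
      · rw [hkk]
        have e : cross (v k - v (k + 1)) (x - v (k + 1)) =
            cross (x - v k) (v (k + 1) - v k) := by simp [cross]; ring
        rw [e, hturn]
        exact hηC
      · rw [hkk]
        exact hch.wedge' q hq α β hα hβ (fun h => absurd h hw'y)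
    have hsub := hull_mono hch.mem
    obtain ⟨c, hc, h1, h2, h3, h4, h5⟩ := ih _ (hn ▸ card_hull_lt hsee.mem hch.mem hout) (k + 1) rfl
      (hnext hw'y) hC' hcor'
      (fun q hq q' hq' hT hT' => hnear q hq q' hq' (hsub hT) (hsub hT'))
    refine ⟨c, by lia, h1, h2, h3, fun i hi1 hi2 => ?_, fun i hi1 hi2 => ?_⟩
    · rcases (show k + 1 < i ∨ i = k + 1 by lia) with hi | rfl
      · exact h4 i hi hi2
      · refine hv.reflexAt_of_not_convexAt hG hP fun hcv => ?_
        have hpos := hv.cross_pos_of_convexAt hcv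
        rw [hkk] at hpos
        have hq : v (k + 1 + 1) ∈ convexHull ℝ {x, v k, y} ∧ v (k + 1 + 1) ≠ x := by
          rcases (show k + 1 + 1 < c ∨ k + 1 + 1 = c by lia) with hc' | hc'
          · have := h5 (k + 1 + 1) (by lia) hc'
            exact ⟨hsub this.1, this.2.1.ne⟩
          · rw [hc', h1]; exact ⟨hy0, hxy.ne'⟩
        have hs := hch.side _ (hG.mem _ _ (hv.adj (k + 1))).2 hq.1 hq.2
        have e : cross (v k - v (k + 1)) (v (k + 1 + 1) - v (k + 1)) =
            - cross (v (k + 1) - v k) (v (k + 1 + 1) - v k) := by simp [cross]; ring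
        rw [e] at hpos
        have := mul_neg_of_pos_of_neg hpos hC
        linarith
    · rcases (show k + 1 ≤ i ∨ i = k by lia) with hi | rfl
      · have := h5 i hi hi2
        exact ⟨hsub this.1, this.2⟩
      · exact ⟨hk0, hsee, hC, hcor⟩

end

/-! ### Cells -/

section OneCoordinate

variable {x y z v u w τ l m n l' m' n' : ℝ}

theorem abs_floor_sub_le (h : |v - z| < 1) : |⌊v⌋ - ⌊z⌋| ≤ 1 := by
  have h1 := Int.floor_le v
  have h2 := Int.lt_floor_add_one v
  have h3 := Int.floor_le z
  have h4 := Int.lt_floor_add_one z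
  rw [abs_lt] at h
  have e1 : (⌊v⌋ : ℝ) < ⌊z⌋ + 2 := by linarith
  have e2 : (⌊z⌋ : ℝ) < ⌊v⌋ + 2 := by linarith
  have e1' : ⌊v⌋ < ⌊z⌋ + 2 := by exact_mod_cast e1
  have e2' : ⌊z⌋ < ⌊v⌋ + 2 := by exact_mod_cast e2
  rw [abs_le]; constructor <;> lia

/-- One coordinate of a point `z` on a segment `x y` of near points and of a point `v` close to
`z` but not near `x`: the distance of `v` and `z` in this coordinate exceeds the relative distance
of `z` and `y` on the segment. -/
theorem lt_abs_of_two_le (ht0 : 0 ≤ τ) (ht1 : τ ≤ 1) (hz : z = (1 - τ) * x + τ * y)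
    (hxy : |⌊x⌋ - ⌊y⌋| ≤ 1) (hvx : 1 < |⌊v⌋ - ⌊x⌋|) : 1 - τ < |v - z| := by
  have v1 := Int.floor_le v
  have v2 := Int.lt_floor_add_one v
  have x1 := Int.floor_le x
  have x2 := Int.lt_floor_add_one x
  have y1 := Int.floor_le y
  have y2 := Int.lt_floor_add_one y
  rw [abs_le] at hxy
  rw [lt_abs] at hvx ⊢
  rcases hvx with h | h
  · left
    have e1 : ⌊x⌋ + 2 ≤ ⌊v⌋ := by lia
    have e2 : ⌊y⌋ ≤ ⌊x⌋ + 1 := by lia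
    have e1' : (⌊x⌋ : ℝ) + 2 ≤ ⌊v⌋ := by exact_mod_cast e1
    have e2' : (⌊y⌋ : ℝ) ≤ ⌊x⌋ + 1 := by exact_mod_cast e2
    rw [hz]
    rcases ht0.eq_or_lt with rfl | ht0
    · linarith
    · nlinarith [mul_pos ht0 (show 0 < (⌊x⌋ : ℝ) + 2 - y by linarith),
        mul_nonneg (sub_nonneg.2 ht1) (show 0 ≤ (⌊x⌋ : ℝ) + 1 - x by linarith)]
  · right
    have e1 : ⌊v⌋ + 1 ≤ ⌊x⌋ - 1 := by lia
    have e2 : ⌊x⌋ - 1 ≤ ⌊y⌋ := by lia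
    have e1' : (⌊v⌋ : ℝ) + 1 ≤ ⌊x⌋ - 1 := by exact_mod_cast e1
    have e2' : (⌊x⌋ : ℝ) - 1 ≤ ⌊y⌋ := by exact_mod_cast e2
    rw [hz]
    nlinarith [mul_nonneg ht0 (show 0 ≤ y - ((⌊x⌋ : ℝ) - 1) by linarith),
        mul_nonneg (sub_nonneg.2 ht1) (show 0 ≤ x - (⌊x⌋ : ℝ) by linarith)]

theorem floor_comb_bounds {a b c : ℝ} (hl : 0 ≤ l) (hm : 0 ≤ m) (hn : 0 ≤ n) (h1 : l + m + n = 1)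
    (L U : ℤ) (ha : L ≤ ⌊a⌋ ∧ ⌊a⌋ ≤ U) (hb : L ≤ ⌊b⌋ ∧ ⌊b⌋ ≤ U) (hc : L ≤ ⌊c⌋ ∧ ⌊c⌋ ≤ U) :
    L ≤ ⌊l * a + m * b + n * c⌋ ∧ ⌊l * a + m * b + n * c⌋ ≤ U := by
  have hK : Convex ℝ {t : ℝ | L ≤ ⌊t⌋ ∧ ⌊t⌋ ≤ U} := by
    simpa using convex_floor_mem 0 one_pos L U
  have := hK.sum_mem (t := Finset.univ) (w := ![l, m, n]) (z := ![a, b, c])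
    (by intro i _; fin_cases i <;> simpa)
    (by simpa [Fin.sum_univ_three] using h1)
    (by intro i _; fin_cases i <;> simpa)
  simpa [Fin.sum_univ_three] using this

theorem floor_between (ht0 : 0 ≤ τ) (ht1 : τ ≤ 1) (hz : z = (1 - τ) * x + τ * y) :
    min ⌊x⌋ ⌊y⌋ ≤ ⌊z⌋ ∧ ⌊z⌋ ≤ max ⌊x⌋ ⌊y⌋ := by
  have := floor_comb_bounds (l := 1 - τ) (m := τ) (n := 0) (a := x) (b := y) (c := x)
    (by linarith) ht0 le_rfl (by ring) (min ⌊x⌋ ⌊y⌋) (max ⌊x⌋ ⌊y⌋) (by simp) (by simp) (by simp)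
  rw [hz]
  simpa using this

theorem comb_pos {a b c : ℝ} (hl : 0 ≤ l) (hm : 0 ≤ m) (hn : 0 ≤ n) (h1 : l + m + n = 1)
    (ha : 0 < a) (hb : 0 < b) (hc : 0 < c) : 0 < l * a + m * b + n * c := by
  have ha' := mul_nonneg hl ha.le
  have hb' := mul_nonneg hm hb.le
  have hc' := mul_nonneg hn hc.le
  rcases hl.eq_or_lt with e | e
  · rcases hm.eq_or_lt with e' | e'
    · have := mul_pos (show 0 < n by linarith) hc
      linarith
    · have := mul_pos e' hb
      linarith
  · have := mul_pos e ha
    linarith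

/-- One coordinate of points `u` and `w` on the two sides of the line of sight `v z`. If `u` and
`w` are not near in this coordinate, then `u` has a larger weight at `x` than at `v`: the cells of
`v`, `z`, `x` are consecutive, and `u` lies in the cell of `x`. -/
theorem weight_lt_of_far (ht0 : 0 ≤ τ) (ht1 : τ ≤ 1) (hz : z = (1 - τ) * x + τ * y)
    (hxy : |⌊x⌋ - ⌊y⌋| ≤ 1) (hvy : |⌊v⌋ - ⌊y⌋| ≤ 1) (hvz : |v - z| < 1)
    (hl : 0 ≤ l) (hm : 0 ≤ m) (hn : 0 ≤ n) (h1 : l + m + n = 1) (hu : u = l * v + m * z + n * x)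
    (hl' : 0 ≤ l') (hm' : 0 ≤ m') (hn' : 0 ≤ n') (h1' : l' + m' + n' = 1)
    (hw : w = l' * v + m' * z + n' * y) (huw : 1 < |⌊u⌋ - ⌊w⌋|) : l < n := by
  have hb := floor_between ht0 ht1 hz
  have hvz' := abs_floor_sub_le hvz
  have bu := floor_comb_bounds (a := v) (b := z) (c := x) hl hm hn h1
    (min ⌊v⌋ (min ⌊z⌋ ⌊x⌋)) (max ⌊v⌋ (max ⌊z⌋ ⌊x⌋)) (by simp) (by simp) (by simp)
  have bw := floor_comb_bounds (a := v) (b := z) (c := y) hl' hm' hn' h1'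
    (min ⌊v⌋ (min ⌊z⌋ ⌊y⌋)) (max ⌊v⌋ (max ⌊z⌋ ⌊y⌋)) (by simp) (by simp) (by simp)
  rw [← hu] at bu
  rw [← hw] at bw
  have v1 := Int.floor_le v
  have v2 := Int.lt_floor_add_one v
  have x1 := Int.floor_le x
  have x2 := Int.lt_floor_add_one x
  have z1 := Int.floor_le z
  have z2 := Int.lt_floor_add_one z
  have u1 := Int.floor_le u
  have u2 := Int.lt_floor_add_one u
  rw [abs_le] at hxy hvy hvz'
  rw [lt_abs] at huw
  rcases huw with h | h
  · have e1 : ⌊u⌋ = ⌊x⌋ := by lia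
    have e2 : ⌊v⌋ = ⌊x⌋ - 2 := by lia
    have e3 : ⌊z⌋ = ⌊x⌋ - 1 := by lia
    rw [e1] at u1; rw [e2] at v2; rw [e3] at z2
    push_cast at v2 z2
    rw [hu] at u1
    have := comb_pos hl hm hn h1 (show 0 < (⌊x⌋ : ℝ) - 1 - v by linarith)
      (show 0 < (⌊x⌋ : ℝ) - z by linarith) (show 0 < (⌊x⌋ : ℝ) + 1 - x by linarith)
    obtain rfl : m = 1 - l - n := by linarith
    linarith
  · have e1 : ⌊u⌋ = ⌊x⌋ := by lia
    have e2 : ⌊v⌋ = ⌊x⌋ + 2 := by lia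
    have e3 : ⌊z⌋ = ⌊x⌋ + 1 := by lia
    rw [e1] at u2; rw [e2] at v1; rw [e3] at z1
    push_cast at v1 z1
    rw [hu] at u2
    have := mul_nonneg hl (show 0 ≤ v - ((⌊x⌋ : ℝ) + 2) by linarith)
    have := mul_nonneg hm (show 0 ≤ z - ((⌊x⌋ : ℝ) + 1) by linarith)
    have := mul_nonneg hn (show 0 ≤ x - (⌊x⌋ : ℝ) by linarith)
    obtain rfl : m = 1 - l - n := by linarith
    linarith

/-- If `u` is not near `x` in one coordinate, then it has a larger weight at `v` than at `x`: the
cell of `z` is the next one to that of `x`, and `u` lies beyond it. -/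
theorem lt_weight_of_far (ht0 : 0 ≤ τ) (ht1 : τ ≤ 1) (hz : z = (1 - τ) * x + τ * y)
    (hxy : |⌊x⌋ - ⌊y⌋| ≤ 1) (hvy : |⌊v⌋ - ⌊y⌋| ≤ 1) (hvz : |v - z| < 1)
    (hl : 0 ≤ l) (hm : 0 ≤ m) (hn : 0 ≤ n) (h1 : l + m + n = 1) (hu : u = l * v + m * z + n * x)
    (hux : 1 < |⌊u⌋ - ⌊x⌋|) : n < l := by
  have hb := floor_between ht0 ht1 hz
  have hvz' := abs_floor_sub_le hvz
  have bu := floor_comb_bounds (a := v) (b := z) (c := x) hl hm hn h1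
    (min ⌊v⌋ (min ⌊z⌋ ⌊x⌋)) (max ⌊v⌋ (max ⌊z⌋ ⌊x⌋)) (by simp) (by simp) (by simp)
  rw [← hu] at bu
  have x1 := Int.floor_le x
  have x2 := Int.lt_floor_add_one x
  have z1 := Int.floor_le z
  have z2 := Int.lt_floor_add_one z
  have u1 := Int.floor_le u
  have u2 := Int.lt_floor_add_one u
  rw [abs_le] at hxy hvy hvz'
  rw [abs_lt] at hvz
  rw [lt_abs] at hux
  rcases hux with h | h
  · have e1 : ⌊u⌋ = ⌊x⌋ + 2 := by lia
    have e3 : ⌊z⌋ = ⌊x⌋ + 1 := by lia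
    rw [e1] at u1; rw [e3] at z2
    push_cast at u1 z2
    rw [hu] at u1
    have h2 := mul_nonneg hl (show 0 ≤ z + 1 - v by linarith)
    have h3 := comb_pos hl hm hn h1 (show 0 < (⌊x⌋ : ℝ) + 2 - z by linarith)
      (show 0 < (⌊x⌋ : ℝ) + 2 - z by linarith) (show 0 < (⌊x⌋ : ℝ) + 1 - x by linarith)
    obtain rfl : m = 1 - l - n := by linarith
    linarith
  · have e1 : ⌊u⌋ = ⌊x⌋ - 2 := by lia
    have e3 : ⌊z⌋ = ⌊x⌋ - 1 := by lia
    rw [e1] at u2; rw [e3] at z1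
    push_cast at u2 z1
    rw [hu] at u2
    have h2 := mul_nonneg hl (show 0 ≤ v - (z - 1) by linarith)
    have h3 := mul_nonneg (show 0 ≤ l + m by linarith) (show 0 ≤ z - ((⌊x⌋ : ℝ) - 1) by linarith)
    have h4 := mul_nonneg hn (show 0 ≤ x - (⌊x⌋ : ℝ) by linarith)
    obtain rfl : m = 1 - l - n := by linarith
    linarith

end OneCoordinate

theorem mem_hull_three {a b c q : ℂ} : q ∈ convexHull ℝ {a, b, c} ↔
    ∃ l m n : ℝ, 0 ≤ l ∧ 0 ≤ m ∧ 0 ≤ n ∧ l + m + n = 1 ∧ q = l • a + m • b + n • c := by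
  constructor
  · intro hq
    have : Convex ℝ {q : ℂ | ∃ l m n : ℝ, 0 ≤ l ∧ 0 ≤ m ∧ 0 ≤ n ∧ l + m + n = 1 ∧
        q = l • a + m • b + n • c} := by
      rintro _ ⟨l, m, n, h1, h2, h3, h4, rfl⟩ _ ⟨l', m', n', h1', h2', h3', h4', rfl⟩ t t' ht ht' e
      refine ⟨t * l + t' * l', t * m + t' * m', t * n + t' * n', by positivity, by positivity,
        by positivity, ?_, by module⟩
      have : t * l + t' * l' + (t * m + t' * m') + (t * n + t' * n') =
        t * (l + m + n) + t' * (l' + m' + n') := by ring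
      rw [this, h4, h4']; linarith
    refine convexHull_min ?_ this hq
    rintro q (rfl | rfl | rfl)
    · exact ⟨1, 0, 0, by simp⟩
    · exact ⟨0, 1, 0, by simp⟩
    · exact ⟨0, 0, 1, by simp⟩
  · rintro ⟨l, m, n, h1, h2, h3, h4, rfl⟩
    have := (convex_convexHull ℝ {a, b, c}).sum_mem (t := Finset.univ)
      (w := ![l, m, n]) (z := ![a, b, c])
      (by intro i _; fin_cases i <;> simpa)
      (by simpa [Fin.sum_univ_three] using h4)
      (by intro i _; apply subset_convexHull; fin_cases i <;> simp)
    simpa [Fin.sum_univ_three] using this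

section

variable {o : ℂ} {s : ℝ} {x y z v : ℂ}

/-- Three pairwise near points lie in a `2 × 2` block of cells, and so all points of the triangle
that they span are near each other. -/
theorem near_of_mem_hull (hs : 0 < s) {a b c : ℂ} (hab : Near o s a b) (hac : Near o s a c)
    (hbc : Near o s b c) {q r : ℂ} (hq : q ∈ convexHull ℝ {a, b, c})
    (hr : r ∈ convexHull ℝ {a, b, c}) : Near o s q r := by
  set L := min (cell o s a).1 (min (cell o s b).1 (cell o s c).1) with hL
  set L' := min (cell o s a).2 (min (cell o s b).2 (cell o s c).2) with hL'
  have hK := convex_block o hs L (L + 1) L' (L' + 1)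
  simp only [Near, abs_le] at hab hac hbc ⊢
  have hsub := convexHull_min (s := {a, b, c}) (by
    rintro q (rfl | rfl | rfl)
    all_goals
      refine ⟨⟨?_, ?_⟩, ?_, ?_⟩ <;> lia) hK
  have hq' := hsub hq
  have hr' := hsub hr
  obtain ⟨⟨h1, h2⟩, h3, h4⟩ := hq'
  obtain ⟨⟨k1, k2⟩, k3, k4⟩ := hr'
  refine ⟨⟨?_, ?_⟩, ?_, ?_⟩ <;> lia

theorem scaled_comb {s a b : ℝ} (o t : ℝ) :
    (((1 - t) * a + t * b) - o) / s = (1 - t) * ((a - o) / s) + t * ((b - o) / s) := by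
  ring

theorem scaled_comb₃ {s a b c l m n : ℝ} (o : ℝ) (h : l + m + n = 1) :
    ((l * a + m * b + n * c) - o) / s =
      l * ((a - o) / s) + m * ((b - o) / s) + n * ((c - o) / s) := by
  have : l * a + m * b + n * c - o = l * (a - o) + m * (b - o) + n * (c - o) := by
    linear_combination o * h
  rw [this, add_div, add_div, mul_div_assoc, mul_div_assoc, mul_div_assoc]

theorem abs_scaled_lt {s a b : ℝ} (hs : 0 < s) (o : ℝ) (h : |a - b| < s) :
    |(a - o) / s - (b - o) / s| < 1 := by
  rwa [← sub_div, sub_sub_sub_cancel_right, abs_div, abs_of_pos hs, div_lt_one hs]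

/-- A point close to a segment with near ends is near one of them: otherwise it would be separated
from both ends, in different coordinates, and hence at distance more than `s / √2`. -/
theorem near_or_near (hs : 0 < s) (hxy : Near o s x y) (hz : z ∈ segment ℝ x y)
    (hd : dist v z ≤ s / Real.sqrt 2) : Near o s v x ∨ Near o s v y := by
  obtain ⟨τ, t0, t1, rfl⟩ := mem_segment_iff_lin.1 hz
  set z := (1 - τ) • x + τ • y with hzdef
  have zre : z.re = (1 - τ) * x.re + τ * y.re := by simp [hzdef]
  have zim : z.im = (1 - τ) * x.im + τ * y.im := by simp [hzdef]
  have hsq : ((v.re - z.re) / s) ^ 2 + ((v.im - z.im) / s) ^ 2 ≤ 1 / 2 := by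
    have h1 : dist v z ^ 2 = (v.re - z.re) ^ 2 + (v.im - z.im) ^ 2 := by
      rw [Complex.dist_eq, Complex.sq_norm, Complex.normSq_apply]
      simp [sq]
    have h2 : dist v z ^ 2 ≤ (s / Real.sqrt 2) ^ 2 := by gcongr
    rw [h1, div_pow, Real.sq_sqrt (by norm_num)] at h2
    rw [div_pow, div_pow, ← add_div, div_le_iff₀ (by positivity)]
    linarith
  have ere : (v.re - z.re) / s = (v.re - o.re) / s - (z.re - o.re) / s := by ring
  have eim : (v.im - z.im) / s = (v.im - o.im) / s - (z.im - o.im) / s := by ring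
  rw [ere, eim] at hsq
  have zre' : (z.re - o.re) / s = (1 - τ) * ((x.re - o.re) / s) + τ * ((y.re - o.re) / s) := by
    rw [zre]; exact scaled_comb _ _
  have zim' : (z.im - o.im) / s = (1 - τ) * ((x.im - o.im) / s) + τ * ((y.im - o.im) / s) := by
    rw [zim]; exact scaled_comb _ _
  have zre'' : (z.re - o.re) / s =
      (1 - (1 - τ)) * ((y.re - o.re) / s) + (1 - τ) * ((x.re - o.re) / s) := by
    rw [zre']; ring
  have zim'' : (z.im - o.im) / s =
      (1 - (1 - τ)) * ((y.im - o.im) / s) + (1 - τ) * ((x.im - o.im) / s) := by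
    rw [zim']; ring
  unfold Near cell at *
  simp only at hxy ⊢
  generalize (v.re - o.re) / s = V at *
  generalize (v.im - o.im) / s = V' at *
  generalize (z.re - o.re) / s = Z at *
  generalize (z.im - o.im) / s = Z' at *
  generalize (x.re - o.re) / s = X at *
  generalize (x.im - o.im) / s = X' at *
  generalize (y.re - o.re) / s = Y at *
  generalize (y.im - o.im) / s = Y' at *
  have hxy' : |⌊Y⌋ - ⌊X⌋| ≤ 1 ∧ |⌊Y'⌋ - ⌊X'⌋| ≤ 1 := by
    rw [abs_sub_comm, abs_sub_comm ⌊Y'⌋]; exact hxy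
  by_contra! hcon
  obtain ⟨c1, c2⟩ := hcon
  have s1 : 1 < |⌊V⌋ - ⌊X⌋| ∨ 1 < |⌊V'⌋ - ⌊X'⌋| := by
    by_contra! h; exact absurd (c1 h.1) (not_lt.2 h.2)
  have s2 : 1 < |⌊V⌋ - ⌊Y⌋| ∨ 1 < |⌊V'⌋ - ⌊Y'⌋| := by
    by_contra! h; exact absurd (c2 h.1) (not_lt.2 h.2)
  have same : ∀ {V X Y Z : ℝ}, |⌊X⌋ - ⌊Y⌋| ≤ 1 → Z = (1 - τ) * X + τ * Y → |V - Z| < 1 →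
      1 < |⌊V⌋ - ⌊X⌋| → 1 < |⌊V⌋ - ⌊Y⌋| → False := by
    intro V X Y Z h1 h2 h3 h4 h5
    have h6 := floor_between t0 t1 h2
    have h7 := abs_floor_sub_le h3
    rw [abs_le] at h1 h7
    rw [lt_abs] at h4 h5
    lia
  have habs : |V - Z| < 1 := by rw [abs_lt]; constructor <;> nlinarith
  have habs' : |V' - Z'| < 1 := by rw [abs_lt]; constructor <;> nlinarith
  have fin : ∀ {a b : ℝ}, 1 - τ < |a| → τ < |b| → a ^ 2 + b ^ 2 ≤ 1 / 2 → False := by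
    intro a b h1 h2 h3
    rw [← sq_abs a, ← sq_abs b] at h3
    nlinarith [sq_nonneg (|a| - |b|)]
  rcases s1 with s1 | s1 <;> rcases s2 with s2 | s2
  · exact same hxy.1 zre' habs s1 s2
  · have h1 := lt_abs_of_two_le t0 t1 zre' hxy.1 s1
    have h2 := lt_abs_of_two_le (by linarith) (by linarith) zim'' hxy'.2 s2
    exact fin h1 (by linarith) hsq
  · have h1 := lt_abs_of_two_le t0 t1 zim' hxy.2 s1
    have h2 := lt_abs_of_two_le (by linarith) (by linarith) zre'' hxy'.1 s2
    exact fin (a := V' - Z') (b := V - Z) h1 (by linarith) (by linarith)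
  · exact same hxy.2 zim' habs' s1 s2

theorem near_of_dist_lt (hs : 0 < s) (hd : dist v z < s) : Near o s v z := by
  rw [Complex.dist_eq] at hd
  have h1 := (Complex.abs_re_le_norm (v - z)).trans_lt hd
  have h2 := (Complex.abs_im_le_norm (v - z)).trans_lt hd
  exact ⟨abs_floor_sub_le (abs_scaled_lt hs _ (by simpa using h1)),
    abs_floor_sub_le (abs_scaled_lt hs _ (by simpa using h2))⟩

/-- Let `v`, near `y`, be close to a point `z` of a segment `x y` with near ends. If two points on
the two sides of the line of sight `v z` are not near, then the one on the side of `x` is near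
`x`. -/
theorem near_of_not_near (hs : 0 < s) (hxy : Near o s x y) (hvy : Near o s v y)
    (hz : z ∈ segment ℝ x y) (hd : dist v z < s) {u w : ℂ} (hu : u ∈ convexHull ℝ {v, z, x})
    (hw : w ∈ convexHull ℝ {v, z, y}) (huw : ¬ Near o s u w) : Near o s u x := by
  obtain ⟨τ, t0, t1, rfl⟩ := mem_segment_iff_lin.1 hz
  set z := (1 - τ) • x + τ • y with hzdef
  obtain ⟨l, m, n, hl, hm, hn, h1, hu⟩ := mem_hull_three.1 hu
  obtain ⟨l', m', n', hl', hm', hn', h1', hw⟩ := mem_hull_three.1 hw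
  rw [Complex.dist_eq] at hd
  have d1 := (Complex.abs_re_le_norm (v - z)).trans_lt hd
  have d2 := (Complex.abs_im_le_norm (v - z)).trans_lt hd
  have d1' := abs_scaled_lt hs o.re (by simpa using d1)
  have d2' := abs_scaled_lt hs o.im (by simpa using d2)
  have zre : (z.re - o.re) / s = (1 - τ) * ((x.re - o.re) / s) + τ * ((y.re - o.re) / s) := by
    rw [← scaled_comb]; simp [hzdef]
  have zim : (z.im - o.im) / s = (1 - τ) * ((x.im - o.im) / s) + τ * ((y.im - o.im) / s) := by
    rw [← scaled_comb]; simp [hzdef]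
  have ure := scaled_comb₃ (s := s) (a := v.re) (b := z.re) (c := x.re) o.re h1
  have uim := scaled_comb₃ (s := s) (a := v.im) (b := z.im) (c := x.im) o.im h1
  have wre := scaled_comb₃ (s := s) (a := v.re) (b := z.re) (c := y.re) o.re h1'
  have wim := scaled_comb₃ (s := s) (a := v.im) (b := z.im) (c := y.im) o.im h1'
  rw [show l * v.re + m * z.re + n * x.re = u.re by simp [hu]] at ure
  rw [show l * v.im + m * z.im + n * x.im = u.im by simp [hu]] at uim
  rw [show l' * v.re + m' * z.re + n' * y.re = w.re by simp [hw]] at wre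
  rw [show l' * v.im + m' * z.im + n' * y.im = w.im by simp [hw]] at wim
  by_contra hux
  unfold Near cell at *
  simp only [not_and_or, not_le] at hxy hvy huw hux
  have far : l < n := by
    rcases huw with h | h
    · exact weight_lt_of_far t0 t1 zre hxy.1 hvy.1 d1' hl hm hn h1 ure hl' hm' hn' h1' wre h
    · exact weight_lt_of_far t0 t1 zim hxy.2 hvy.2 d2' hl hm hn h1 uim hl' hm' hn' h1' wim h
  rcases hux with h | h
  · exact absurd (lt_weight_of_far t0 t1 zre hxy.1 hvy.1 d1' hl hm hn h1 ure h) far.not_gt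
  · exact absurd (lt_weight_of_far t0 t1 zim hxy.2 hvy.2 d2' hl hm hn h1 uim h) far.not_gt

end

/-! ### The triangle of a visible edge -/

section

variable {P : Finset ℂ} {A : SimpleGraph ℂ} {f : Set ℂ} {o : ℂ} {s : ℝ} {x y v z : ℂ} {ζ : ℝ}
  {p h : ℂ → ℝ}

theorem Coords.flip {O a b : ℂ} (c : Coords O a b p h) :
    Coords a O b (fun q => 1 - p q - h q) h := by
  have key : ∀ α β : ℝ, a + α • (O - a) + β • (b - a) =
      O + (1 - α - β) • (a - O) + β • (b - O) := fun α β => by module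
  refine ⟨fun u w t => ?_, c.aff_snd, fun q => ?_, fun α β => ?_, fun α β => ?_, ?_, c.cont_snd⟩
  · simp only [c.aff_fst u w t, c.aff_snd u w t]; ring
  · rw [key]
    convert c.eq q using 4
    ring
  · simp only [key, c.fst, c.snd]; ring
  · rw [key, c.snd]
  · exact (continuous_const.sub c.cont_fst).sub c.cont_snd

/-- The vertex `v` sees through the face `f` the point `z` of the edge `x y`. The coordinates `p`
and `h` are those of the triangle `x y v`, so that `z` has the coordinates `ζ` and `0`, and
`p + ζ * h < ζ` is the side of `x` of the line of sight `v z`. -/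
structure View (P : Finset ℂ) (A : SimpleGraph ℂ) (f : Set ℂ) (x y v z : ℂ) (ζ : ℝ)
    (p h : ℂ → ℝ) : Prop where
  coords : Coords x y v p h
  pos : 0 < ζ
  lt_one : ζ < 1
  eq : z = (1 - ζ) • x + ζ • y
  seg : openSegment ℝ v z ⊆ f
  adj : A.Adj x y
  mem : v ∈ P

namespace View

variable (V : View P A f x y v z ζ p h)

include V

theorem flip : View P A f y x v z (1 - ζ) (fun q => 1 - p q - h q) h :=
  ⟨V.coords.flip, by linarith [V.lt_one], by linarith [V.pos],
    by rw [V.eq, sub_sub_cancel, add_comm], V.seg, V.adj.symm, V.mem⟩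

theorem fst_z : p z = ζ := by
  rw [V.eq, V.coords.aff_fst, V.coords.fst_O, V.coords.fst_a]; ring

theorem snd_z : h z = 0 := by
  rw [V.eq, V.coords.aff_snd, V.coords.snd_O, V.coords.snd_a]; ring

theorem near_of_mem_triangle (hs : 0 < s) (hA : IsMaximalPSLG P o s A) (hvy : Near o s v y)
    {q : ℂ} (h₁ : 0 ≤ p q) (h₂ : 0 ≤ h q) (h₃ : p q + h q ≤ 1) : Near o s y q :=
  V.coords.mem_of_convex (convex_near o hs y) (hA.near V.adj.symm) (near_self o s y) hvy.symm
    h₁ h₂ h₃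

theorem mem_openSegment {d : ℂ} (d₁ : 0 < h d) (d₂ : h d < 1) (d₃ : p d + ζ * h d = ζ) :
    d ∈ openSegment ℝ v z := by
  refine mem_openSegment_iff_lin.2 ⟨1 - h d, by linarith, by linarith, ?_⟩
  apply V.coords.ext
  · rw [V.coords.aff_fst, V.fst_z, V.coords.fst_b]; linarith
  · rw [V.coords.aff_snd, V.snd_z, V.coords.snd_b]; ring

theorem off_ray (hf : IsFace P A f) {d : ℂ} (hd : d ∈ drawing P A) (d₁ : 0 < h d) (d₂ : h d < 1)
    (d₃ : p d + ζ * h d = ζ) : False :=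
  hf.subset (V.seg (V.mem_openSegment d₁ d₂ d₃)) hd

theorem eq_or_eq_of_fst (hP : GenPos P) (hG : IsPSLG P A) {q : ℂ} (hq : q ∈ P) (h₁ : p q = 0) :
    q = x ∨ q = v :=
  V.coords.eq_or_eq hP (hG.mem _ _ V.adj).1 V.mem hq
    (fun e => by
      have := V.coords.snd_b
      rw [← e, V.coords.snd_O] at this
      norm_num at this)
    (by rw [h₁, V.coords.fst_O, V.coords.fst_b]; ring)

theorem eq_or_eq_of_snd (hP : GenPos P) (hG : IsPSLG P A) {q : ℂ} (hq : q ∈ P) (h₁ : h q = 0) :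
    q = x ∨ q = y :=
  V.coords.eq_or_eq hP (hG.mem _ _ V.adj).1 (hG.mem _ _ V.adj).2 hq V.adj.ne
    (by rw [h₁, V.coords.snd_O, V.coords.snd_a]; ring)

/-- The vertices in the triangle `v z x` other than `v` and `x` lie in its interior. -/
theorem strict (hP : GenPos P) (hG : IsPSLG P A) (hf : IsFace P A f) {q : ℂ} (hq : q ∈ P)
    (h₁ : 0 ≤ p q) (h₂ : 0 < h q) (h₃ : p q + ζ * h q ≤ ζ) (hne : q ≠ v) :
    0 < p q ∧ p q + ζ * h q < ζ ∧ h q < 1 := by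
  have hζ := V.pos
  have hp : 0 < p q := by
    refine lt_of_le_of_ne h₁ fun e => ?_
    rcases V.eq_or_eq_of_fst hP hG hq e.symm with rfl | rfl
    · rw [V.coords.snd_O] at h₂; exact lt_irrefl _ h₂
    · exact hne rfl
  have hh : h q < 1 := by nlinarith
  exact ⟨hp, lt_of_le_of_ne h₃ fun e => V.off_ray hf (Or.inl hq) h₂ hh e, hh⟩

theorem mem_hull {q : ℂ} (h₁ : 0 ≤ p q) (h₂ : 0 ≤ h q) (h₃ : p q + ζ * h q ≤ ζ) :
    q ∈ convexHull ℝ {v, z, x} := by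
  have hζ := V.pos
  refine mem_hull_three.2 ⟨h q, p q / ζ, 1 - h q - p q / ζ, h₂, by positivity, ?_, by ring, ?_⟩
  · rw [sub_nonneg, div_le_iff₀ hζ]; linarith
  · conv_lhs => rw [V.coords.eq q]
    rw [V.eq]
    have e : p q = p q / ζ * ζ := by field_simp
    generalize p q / ζ = c at e
    rw [e]
    module

/-- A half-plane that contains `x`, `v` and the vertices inside the triangle `v z x` contains the
part of the drawing inside this triangle: no edge enters it through the edge `x y` or the line of
sight `v z`. -/
theorem drawing_subset_halfPlane (hG : IsPSLG P A) (hf : IsFace P A f) {φ : ℂ → ℝ}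
    (hφ : IsAff φ) (hx : 0 ≤ φ x) (hv : 0 ≤ φ v)
    (hU : ∀ q ∈ P, 0 ≤ p q → 0 < h q → p q + ζ * h q ≤ ζ → 0 ≤ φ q) {d : ℂ}
    (hd : d ∈ drawing P A) (d₁ : 0 ≤ p d) (d₂ : 0 < h d) (d₃ : p d + ζ * h d < ζ) : 0 ≤ φ d := by
  have hζ := V.pos
  have hζ1 := V.lt_one
  have c := V.coords
  have hg : IsAff fun q => (-1) * p q + (-ζ) * h q + ζ := c.aff_fst.comb c.aff_snd (-1) (-ζ) ζ
  refine hG.drawing_subset_halfPlane c.aff_snd hg c.aff_fst hφ ?_ ?_ ?_ hd d₂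
    (by linarith) d₁
  · intro r t hrt d hd e₁ e₂ e₃ d' hd' e₁' e₂' e₃' h4
    rcases h4 with h4 | h4
    · rcases e₃'.eq_or_lt with e | e
      · rw [show d' = x from c.ext (by rw [← e, c.fst_O]) (by rw [h4, c.snd_O])]
        exact hx
      · exfalso
        rw [h4] at e₂'
        have hmem : d' ∈ openSegment ℝ x y := by
          refine mem_openSegment_iff_lin.2 ⟨p d', e, by linarith, ?_⟩
          conv_lhs => rw [c.eq d', h4]
          module
        exact e₁.ne' (hG.eq_zero_of_meet c.aff_snd hrt V.adj c.snd_O c.snd_a hd hd' hmem)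
    · rcases e₃'.eq_or_lt with e | e
      · have : h d' = 1 := by
          rw [← e] at h4
          have : ζ * h d' = ζ * 1 := by linarith
          exact mul_left_cancel₀ hζ.ne' this
        rw [show d' = v from c.ext (by rw [← e, c.fst_b]) (by rw [this, c.snd_b])]
        exact hv
      · have hh : h d' < 1 := by nlinarith
        rcases e₁'.eq_or_lt with e' | e'
        · exfalso
          rw [← e'] at h4
          have hmem : d' ∈ openSegment ℝ x y := by
            refine mem_openSegment_iff_lin.2 ⟨p d', e, by linarith, ?_⟩
            conv_lhs => rw [c.eq d', ← e']
            module
          exact e₁.ne' (hG.eq_zero_of_meet c.aff_snd hrt V.adj c.snd_O c.snd_a hd hd' hmem)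
        · exact (V.off_ray hf (segment_subset_drawing hrt hd') e' hh (by linarith)).elim
  · intro q hq e₁ e₂ e₃
    exact hU q hq e₃ e₁ (by linarith)
  · intro q e₁ e₂ e₃
    rw [e₃] at e₂
    have hle : h q ≤ 1 := by nlinarith
    have : q = (1 - h q) • x + h q • v := by
      conv_lhs => rw [c.eq q, e₃]
      module
    rw [this, hφ]
    have := mul_nonneg (sub_nonneg.2 hle) hx
    have := mul_nonneg e₁ hv
    linarith

/-- The support line, through `x`, of the vertices in the triangle `v z x`. -/
theorem exists_bottom (hG : IsPSLG P A) (hf : IsFace P A f) :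
    ∃ u ∈ P, ∃ σ : ℝ, 0 ≤ σ ∧ 0 ≤ p u ∧ 0 < h u ∧ p u + ζ * h u ≤ ζ ∧ p u = σ * h u ∧
      (∀ q ∈ P, 0 ≤ p q → 0 < h q → p q + ζ * h q ≤ ζ → p q ≤ σ * h q) ∧
      ∀ d ∈ drawing P A, 0 ≤ p d → 0 < h d → p d + ζ * h d < ζ → p d ≤ σ * h d := by
  have c := V.coords
  obtain ⟨u, hu, hmax⟩ := (P.filter fun q => 0 ≤ p q ∧ 0 < h q ∧ p q + ζ * h q ≤ ζ).exists_max_image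
    (fun q => p q / h q) ⟨v, by simp [V.mem, c.fst_b, c.snd_b]⟩
  simp only [Finset.mem_filter] at hu hmax
  obtain ⟨huP, u₁, u₂, u₃⟩ := hu
  have hσ : 0 ≤ p u / h u := by positivity
  have hle : ∀ q ∈ P, 0 ≤ p q → 0 < h q → p q + ζ * h q ≤ ζ → p q ≤ p u / h u * h q := by
    intro q hq q₁ q₂ q₃
    have := hmax q ⟨hq, q₁, q₂, q₃⟩
    rwa [div_le_iff₀ q₂] at this
  refine ⟨u, huP, p u / h u, hσ, u₁, u₂, u₃, by field_simp, hle, fun d hd d₁ d₂ d₃ => ?_⟩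
  have := V.drawing_subset_halfPlane hG hf (c.aff_fst.comb c.aff_snd (-1) (p u / h u) 0)
    (by rw [c.fst_O, c.snd_O]; norm_num) (by rw [c.fst_b, c.snd_b]; linarith)
    (fun q hq q₁ q₂ q₃ => by linarith [hle q hq q₁ q₂ q₃]) hd d₁ d₂ d₃
  linarith

/-- The support line, through `v`, of the vertices in the triangle `v z x`. -/
theorem exists_top (hP : GenPos P) (hG : IsPSLG P A) (hf : IsFace P A f)
    (H : ∃ q ∈ P, 0 ≤ p q ∧ 0 < h q ∧ p q + ζ * h q ≤ ζ ∧ q ≠ v) :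
    ∃ u ∈ P, ∃ μ : ℝ, μ < ζ ∧ 0 < p u ∧ 0 < h u ∧ h u < 1 ∧ p u + ζ * h u < ζ ∧
      p u = μ * (1 - h u) ∧
      (∀ q ∈ P, 0 ≤ p q → 0 < h q → p q + ζ * h q ≤ ζ → p q ≤ μ * (1 - h q)) ∧
      ∀ d ∈ drawing P A, 0 ≤ p d → 0 < h d → p d + ζ * h d < ζ → p d ≤ μ * (1 - h d) := by
  have c := V.coords
  obtain ⟨q₀, hq₀, H⟩ := H
  obtain ⟨u, hu, hmax⟩ := (P.filter fun q => 0 ≤ p q ∧ 0 < h q ∧ p q + ζ * h q ≤ ζ ∧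
    q ≠ v).exists_max_image (fun q => p q / (1 - h q)) ⟨q₀, by simp [hq₀, H]⟩
  simp only [Finset.mem_filter] at hu hmax
  obtain ⟨huP, u₁, u₂, u₃, u₄⟩ := hu
  obtain ⟨e₁, e₂, e₃⟩ := V.strict hP hG hf huP u₁ u₂ u₃ u₄
  have e₃' : 0 < 1 - h u := by linarith
  have hμ : 0 ≤ p u / (1 - h u) := by positivity
  have hle : ∀ q ∈ P, 0 ≤ p q → 0 < h q → p q + ζ * h q ≤ ζ → p q ≤ p u / (1 - h u) * (1 - h q) := by
    intro q hq q₁ q₂ q₃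
    by_cases hqv : q = v
    · rw [hqv, c.fst_b, c.snd_b]; norm_num
    have := hmax q ⟨hq, q₁, q₂, q₃, hqv⟩
    rwa [div_le_iff₀ (by linarith [(V.strict hP hG hf hq q₁ q₂ q₃ hqv).2.2])] at this
  refine ⟨u, huP, p u / (1 - h u), ?_, e₁, u₂, e₃, e₂, by field_simp, hle,
    fun d hd d₁ d₂ d₃ => ?_⟩
  · rw [div_lt_iff₀ e₃']; linarith
  have := V.drawing_subset_halfPlane hG hf
    (c.aff_fst.comb c.aff_snd (-1) (-(p u / (1 - h u))) (p u / (1 - h u)))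
    (by rw [c.fst_O, c.snd_O]; linarith) (by rw [c.fst_b, c.snd_b]; linarith)
    (fun q hq q₁ q₂ q₃ => by linarith [hle q hq q₁ q₂ q₃]) hd d₁ d₂ d₃
  linarith

/-- The vertices `u` and `w` lie on the support lines, through `x` and `y`, of the vertices in the
triangles `v z x` and `v z y`. If `w` sees `x` past the first line but `u` does not see `y` past
the second one, then `v z x` contains no vertices but `v` and `x`: otherwise the support lines
through `v` give a vertex `a` in `v z x` that is near `x`, and `w` lies in the triangle `a z y`,
all of which is near `x`. -/
theorem eq_of_mem_of_lt (hs : 0 < s) (hA : IsMaximalPSLG P o s A) (hP : GenPos P)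
    (hf : IsFace P A f) (hvy : Near o s v y) (hd : dist v z < s)
    {u w : ℂ} {σ ρ : ℝ} (hu : u ∈ P) (hw : w ∈ P)
    (u₁ : 0 ≤ p u) (u₂ : 0 < h u) (u₃ : p u + ζ * h u ≤ ζ) (u₄ : p u = σ * h u) (hσ : 0 ≤ σ)
    (hσU : ∀ q ∈ P, 0 ≤ p q → 0 < h q → p q + ζ * h q ≤ ζ → p q ≤ σ * h q)
    (w₂ : 0 < h w) (w₃ : ζ ≤ p w + ζ * h w) (w₄ : 1 - p w - h w = ρ * h w) (hρ : 0 ≤ ρ)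
    (hwx : ¬ Near o s x w) (huρ : 1 - p u - h u ≤ ρ * h u) (hwσ : σ * h w < p w) :
    ∀ q ∈ P, 0 ≤ p q → 0 < h q → p q + ζ * h q ≤ ζ → q = v := by
  have hG := hA.pslg
  have c := V.coords
  have hζ := V.pos
  have hζ1 := V.lt_one
  by_contra! H
  obtain ⟨q₀, hq₀, q₁, q₂, q₃, q₄⟩ := H
  obtain ⟨a, haP, μ, hμ, a₁, a₂, a₃, a₄, a₅, hμU, hμD⟩ :=
    V.exists_top hP hG hf ⟨q₀, hq₀, q₁, q₂, q₃, q₄⟩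
  have hwv : w ≠ v := by
    rintro rfl
    rw [c.snd_b, c.fst_b] at hwσ
    linarith
  obtain ⟨b, hbP, ν, hν, b₁, b₂, b₃, b₄, b₅, hνU, hνD⟩ := V.flip.exists_top hP hG hf
    ⟨w, hw, by rw [w₄]; positivity, w₂, by linarith, hwv⟩
  have hab : ¬ Near o s a b := by
    refine hA.not_near haP hbP (fun e => by rw [e] at a₄; linarith) fun d hd hdD => ?_
    obtain ⟨t, t0, t1, rfl⟩ := mem_openSegment_iff_lin.1 hd
    set d := (1 - t) • a + t • b
    have hp : p d = (1 - t) * p a + t * p b := c.aff_fst a b t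
    have hh : h d = (1 - t) * h a + t * h b := c.aff_snd a b t
    have t0' : 0 < 1 - t := by linarith
    have e₁ : p b = (1 - h b) * (1 - ν) := by linarith
    have pb : 0 < p b := by rw [e₁]; exact mul_pos (by linarith) (by linarith)
    have e₂ : 0 < h d := by rw [hh]; positivity
    have e₃ : h d < 1 := by rw [hh]; nlinarith
    have e₄ : 0 < p d := by rw [hp]; positivity
    have pa : 0 < 1 - p a - h a := by
      have : 0 < (1 - μ) * (1 - h a) := mul_pos (by linarith) (by linarith)
      linarith
    have e₅ : 0 < 1 - p d - h d := by
      have := mul_pos t0' pa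
      have := mul_pos t0 b₁
      rw [hp, hh]; linarith
    have hμν : 0 < 1 - μ - ν := by linarith
    rcases lt_trichotomy (p d + ζ * h d) ζ with e | e | e
    · have := hμD d hdD e₄.le e₂ e
      have k : 0 < t * ((1 - h b) * (1 - μ - ν)) := mul_pos t0 (mul_pos (by linarith) hμν)
      rw [hp, hh, a₅, e₁] at this
      linarith
    · exact V.off_ray hf hdD e₂ e₃ e
    · have := hνD d hdD e₅.le e₂ (by linarith)
      have k : 0 < (1 - t) * ((1 - h a) * (1 - μ - ν)) := mul_pos t0' (mul_pos (by linarith) hμν)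
      have k' : 1 - p b - h b = ν * (1 - h b) := b₅
      have : (1 - t) * (1 - p a - h a) + t * (1 - p b - h b) ≤ ν * (1 - h d) := by
        rw [hp] at this; rw [hh] at this ⊢; linarith
      rw [k', hh, a₅] at this
      linarith
  have hax : Near o s a x := by
    refine near_of_not_near hs (hA.near V.adj) hvy ?_ hd (V.mem_hull a₁.le a₂.le a₄.le)
      (V.flip.mem_hull b₁.le b₂.le b₄.le) hab
    exact mem_segment_iff_lin.2 ⟨ζ, hζ.le, hζ1.le, V.eq⟩
  have huv : u ≠ v := by
    rintro rfl
    have : σ = 0 := by rw [c.fst_b, c.snd_b] at u₄; linarith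
    have := hσU a haP a₁.le a₂ a₄.le
    rw [‹σ = 0›] at this
    linarith
  -- the vertex `a` is not above the support line from `y`, as `u` is not
  have haρ : 1 - p a - h a ≤ ρ * h a := by
    obtain ⟨v₁, v₂, v₃⟩ := V.strict hP hG hf hu u₁ u₂ u₃ huv
    have i₁ : p a * h u ≤ p u * h a := by
      have := mul_le_mul_of_nonneg_right (hσU a haP a₁.le a₂ a₄.le) u₂.le
      rw [u₄]; linarith
    have i₂ : p u * (1 - h a) ≤ p a * (1 - h u) := by
      have := mul_le_mul_of_nonneg_right (hμU u hu u₁ u₂ u₃) (sub_pos.2 a₃).le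
      rw [a₅]; linarith
    set D := p u * h a - p a * h u with hD
    have hD0 : 0 ≤ D := by linarith
    have i₃ : D * (1 - h a) ≤ (h a - h u) * p a := by
      have := mul_le_mul_of_nonneg_right i₂ a₂.le
      rw [hD]; linarith
    have i₄ : 0 ≤ h a - h u := by
      have := mul_nonneg hD0 (sub_pos.2 a₃).le
      nlinarith
    have i₅ : p a ≤ 1 - h a := by
      rw [a₅]
      have := mul_nonneg (show 0 ≤ 1 - μ by linarith) (sub_pos.2 a₃).le
      linarith
    have i₆ : D ≤ h a - h u := by
      have := mul_le_mul_of_nonneg_left i₅ i₄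
      exact le_of_mul_le_mul_right (i₃.trans this) (sub_pos.2 a₃)
    have i₇ := mul_le_mul_of_nonneg_right huρ a₂.le
    have : (1 - p a - h a) * h u ≤ ρ * h a * h u := by rw [hD] at i₆; linarith
    exact le_of_mul_le_mul_right this u₂
  -- hence `w` lies in the triangle `a z y`, and it is near `x` as the vertices of this triangle are
  apply hwx
  have hpos : 0 < 1 + ρ - ζ := by linarith
  have hlt : h w ≤ h a := by
    have : (1 + ρ - ζ) * h w ≤ (1 + ρ - ζ) * h a := by linarith
    exact le_of_mul_le_mul_left this hpos
  set l := h w / h a with hl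
  have hl0 : 0 ≤ l := by positivity
  have hl1 : l ≤ 1 := by rw [hl, div_le_one a₂]; exact hlt
  have hla : h w = l * h a := by rw [hl]; field_simp
  set α := (1 - l + l * p a - p w) / (1 - ζ) with hα
  have hζ' : 0 < 1 - ζ := by linarith
  have hαe : α * (1 - ζ) = 1 - l + l * p a - p w := by rw [hα]; field_simp
  have hα0 : 0 ≤ α := by
    apply div_nonneg _ hζ'.le
    have := mul_le_mul_of_nonneg_left haρ hl0
    have e : p w = 1 - (1 + ρ) * (l * h a) := by rw [← hla]; linarith
    rw [e]; linarith
  have hβ0 : 0 ≤ 1 - l - α := by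
    have e := mul_le_mul_of_nonneg_left a₄.le hl0
    have : 0 ≤ (1 - l - α) * (1 - ζ) := by
      rw [sub_mul, hαe]
      rw [hla] at w₃
      linarith
    exact nonneg_of_mul_nonneg_left this hζ'
  have hwe : w = y + l • (a - y) + α • (z - y) := by
    apply c.ext
    · rw [c.aff_fst.wedge, c.fst_a, V.fst_z]; linarith
    · rw [c.aff_snd.wedge, c.snd_a, V.snd_z, hla]; ring
  have hmem : w ∈ convexHull ℝ {a, z, y} :=
    mem_hull_three.2 ⟨l, α, 1 - l - α, hl0, hα0, hβ0, by ring, by rw [hwe]; module⟩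
  have hxy := hA.near V.adj
  refine convexHull_min ?_ (convex_near o hs x) hmem
  rintro q (rfl | rfl | rfl)
  · exact hax.symm
  · exact (convex_near o hs x).segment_subset (near_self o s x) hxy
      (mem_segment_iff_lin.2 ⟨ζ, hζ.le, hζ1.le, V.eq⟩)
  · exact hxy

/-- If `v` is near `y`, then the triangle `v z x` contains no other vertices than `v` and `x`. -/
theorem eq_of_mem (hs : 0 < s) (hA : IsMaximalPSLG P o s A) (hP : GenPos P)
    (hf : IsFace P A f) (hvy : Near o s v y) (hd : dist v z < s) :
    ∀ q ∈ P, 0 ≤ p q → 0 < h q → p q + ζ * h q ≤ ζ → q = v := by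
  have hG := hA.pslg
  have c := V.coords
  have hζ := V.pos
  have hζ1 := V.lt_one
  obtain ⟨u, hu, σ, hσ, u₁, u₂, u₃, u₄, hσU, hσD⟩ := V.exists_bottom hG hf
  obtain ⟨w, hw, ρ, hρ, w₁, w₂, w₃, w₄, hρU, hρD⟩ := V.flip.exists_bottom hG hf
  have hfree : ∀ d ∈ drawing P A, 0 ≤ p d → 0 < h d → 0 ≤ 1 - p d - h d → σ * h d < p d →
      ρ * h d < 1 - p d - h d → False := by
    intro d hdD d₁ d₂ d₃ d₄ d₅
    have := mul_nonneg hσ d₂.le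
    rcases lt_trichotomy (p d + ζ * h d) ζ with e | e | e
    · linarith [hσD d hdD d₁ d₂ e]
    · exact V.off_ray hf hdD d₂ (by linarith) e
    · linarith [hρD d hdD d₃ d₂ (by linarith)]
  have u₅ : p u + h u ≤ 1 := by
    have : h u ≤ 1 := by nlinarith
    have := mul_le_mul_of_nonneg_left this (sub_nonneg.2 hζ1.le)
    linarith
  have w₅ : 0 ≤ p w := by
    have : h w ≤ 1 := by nlinarith
    nlinarith
  have huρ : 1 - p u - h u ≤ ρ * h u := by
    by_contra! hlt
    refine hA.not_near (hG.mem _ _ V.adj).2 hu (fun e => ?_) (fun d hd hdD => ?_)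
      (V.near_of_mem_triangle hs hA hvy u₁ u₂.le u₅)
    · rw [← e, c.snd_a] at u₂; exact lt_irrefl _ u₂
    · obtain ⟨t, t0, t1, rfl⟩ := mem_openSegment_iff_lin.1 hd
      set d := (1 - t) • y + t • u
      have hp : p d = (1 - t) + t * p u := by rw [c.aff_fst y u t, c.fst_a, mul_one]
      have hh : h d = t * h u := by rw [c.aff_snd y u t, c.snd_a, mul_zero, zero_add]
      refine hfree d hdD ?_ ?_ ?_ ?_ ?_
      · rw [hp]; have := mul_nonneg t0.le u₁; linarith
      · rw [hh]; positivity
      · rw [hp, hh]; nlinarith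
      · rw [hp, hh, u₄]; linarith
      · rw [hp, hh]; nlinarith
  rcases lt_or_ge (σ * h w) (p w) with hwσ | hwσ
  · have hwx : ¬ Near o s x w := by
      refine hA.not_near (hG.mem _ _ V.adj).1 hw (fun e => ?_) (fun d hd hdD => ?_)
      · rw [← e, c.snd_O] at w₂; exact lt_irrefl _ w₂
      · obtain ⟨t, t0, t1, rfl⟩ := mem_openSegment_iff_lin.1 hd
        set d := (1 - t) • x + t • w
        have hp : p d = t * p w := by rw [c.aff_fst x w t, c.fst_O, mul_zero, zero_add]
        have hh : h d = t * h w := by rw [c.aff_snd x w t, c.snd_O, mul_zero, zero_add]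
        refine hfree d hdD ?_ ?_ ?_ ?_ ?_
        · rw [hp]; positivity
        · rw [hh]; positivity
        · rw [hp, hh]; nlinarith
        · rw [hp, hh]; nlinarith
        · rw [hp, hh]
          have : 1 - p w - h w = ρ * h w := w₄
          nlinarith
    exact V.eq_of_mem_of_lt hs hA hP hf hvy hd hu hw u₁ u₂ u₃ u₄ hσ hσU w₂ (by linarith) w₄ hρ
      hwx huρ hwσ
  · -- the two support lines cross on the line of sight, so that `v` is the only vertex
    have w₄' : 1 - p w - h w = ρ * h w := w₄
    rw [u₄] at u₃ huρ
    have k₁ : 1 ≤ (1 + ρ + σ) * h u := by linarith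
    have k₂ : 1 ≤ (1 + ρ + σ) * h w := by linarith
    have k₃ : (ζ + σ) * h u ≤ ζ := by linarith
    have k₄ : (1 - ζ + ρ) * h w ≤ 1 - ζ := by linarith
    have k₅ : (1 - ζ) * σ ≤ ζ * ρ := by
      have i := mul_le_mul_of_nonneg_left k₁ (show 0 ≤ ζ + σ by linarith)
      have i' := mul_le_mul_of_nonneg_left k₃ (show 0 ≤ 1 + ρ + σ by linarith)
      linarith
    have k₆ : ζ * ρ ≤ (1 - ζ) * σ := by
      have i := mul_le_mul_of_nonneg_left k₂ (show 0 ≤ 1 - ζ + ρ by linarith)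
      have i' := mul_le_mul_of_nonneg_left k₄ (show 0 ≤ 1 + ρ + σ by linarith)
      linarith
    have k₇ : (ζ + σ) * h u = ζ := by
      refine le_antisymm k₃ ?_
      have i := mul_le_mul_of_nonneg_left k₁ hζ.le
      have e : ζ * (1 + ρ + σ) = ζ + σ := by linarith
      rw [← mul_assoc, e] at i
      linarith
    have huv : u = v := by
      by_contra hne
      have := (V.strict hP hG hf hu u₁ u₂ (by rw [u₄]; exact u₃) hne).2.1
      rw [u₄] at this
      linarith
    have hσ0 : σ = 0 := by rw [huv, c.fst_b, c.snd_b] at u₄; linarith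
    intro q hq q₁ q₂ q₃
    by_contra hne
    have := (V.strict hP hG hf hq q₁ q₂ q₃ hne).1
    have := hσU q hq q₁ q₂ q₃
    rw [hσ0] at this
    linarith

end View

end

section

variable {P : Finset ℂ} {A : SimpleGraph ℂ} {f : Set ℂ} {o : ℂ} {s : ℝ} {x y v z : ℂ} {ζ : ℝ}
  {p h : ℂ → ℝ}

namespace View

variable (V : View P A f x y v z ζ p h)

include V

theorem not_mem_drawing (hG : IsPSLG P A) (hf : IsFace P A f)
    (hU : ∀ q ∈ P, 0 ≤ p q → 0 < h q → p q + ζ * h q ≤ ζ → q = v) {d : ℂ}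
    (d₁ : 0 < p d) (d₂ : 0 < h d) (d₃ : p d + ζ * h d < ζ) : d ∉ drawing P A := by
  intro hd
  have c := V.coords
  have := V.drawing_subset_halfPlane hG hf (c.aff_fst.comb c.aff_snd (-1) 0 0)
    (by rw [c.fst_O]; norm_num) (by rw [c.fst_b]; norm_num)
    (fun q hq q₁ q₂ q₃ => by rw [hU q hq q₁ q₂ q₃, c.fst_b]; norm_num) hd d₁.le d₂ d₃
  linarith

theorem adj_or_free (hP : GenPos P) (hG : IsPSLG P A) (hf : IsFace P A f)
    (hU : ∀ q ∈ P, 0 ≤ p q → 0 < h q → p q + ζ * h q ≤ ζ → q = v) :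
    A.Adj x v ∨ ∀ d ∈ openSegment ℝ x v, d ∉ drawing P A := by
  by_contra! H
  obtain ⟨hn, d, hd, hdD⟩ := H
  have c := V.coords
  have hζ := V.pos
  have hne : x ≠ v := by
    intro e
    have := c.snd_b
    rw [← e, c.snd_O] at this
    norm_num at this
  refine hn (hG.adj_of_touch (c.aff_fst.comb c.aff_snd (-1) 0 0) (by rw [c.fst_O]; norm_num)
    (by rw [c.fst_b]; norm_num) hd hdD
    (fun q hq e => V.eq_or_eq_of_fst hP hG hq (by linarith)) hne fun r hr => ?_)
  obtain ⟨t, t0, t1, rfl⟩ := mem_openSegment_iff_lin.1 hd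
  set d := (1 - t) • x + t • v
  have hp : p d = 0 := by rw [c.aff_fst x v t, c.fst_O, c.fst_b]; ring
  have hh : h d = t := by rw [c.aff_snd x v t, c.snd_O, c.snd_b]; ring
  filter_upwards [(c.aff_fst.comb c.aff_snd (-1) 0 0).eventually_neg (d := d) (by rw [hp]; ring) hr,
    c.aff_snd.eventually_pos (d := d) (by rw [hh]; exact t0) r,
    (c.aff_fst.comb c.aff_snd (-1) (-ζ) ζ).eventually_pos (d := d)
      (by rw [hp, hh]; nlinarith) r] with τ e₁ e₂ e₃
  exact V.not_mem_drawing hG hf hU (by linarith) e₂ (by linarith)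

/-- A vertex that sees a point of an edge, in a face that is not a triangle, is not near both ends
of this edge: otherwise it would be joined to both. -/
theorem not_near (hs : 0 < s) (hA : IsMaximalPSLG P o s A) (hP : GenPos P)
    (hf : IsFace P A f) (hnt : ¬ IsTriangularFace P f) (hvy : Near o s v y) (hd : dist v z < s) :
    ¬ Near o s v x := by
  intro hvx
  have hG := hA.pslg
  have c := V.coords
  have hζ := V.pos
  have hζ1 := V.lt_one
  have hU := V.eq_of_mem hs hA hP hf hvy hd
  have hW := V.flip.eq_of_mem hs hA hP hf hvx hd
  have hx := (hG.mem _ _ V.adj).1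
  have hy := (hG.mem _ _ V.adj).2
  have hadj : A.Adj x v := by
    refine (V.adj_or_free hP hG hf hU).resolve_right fun hfree => ?_
    refine hA.not_near hx V.mem (fun e => ?_) hfree hvx.symm
    have := c.snd_b
    rw [← e, c.snd_O] at this
    norm_num at this
  have hadj' : A.Adj y v := by
    refine (V.flip.adj_or_free hP hG hf hW).resolve_right fun hfree => ?_
    refine hA.not_near hy V.mem (fun e => ?_) hfree hvy.symm
    have := c.snd_b
    rw [← e, c.snd_a] at this
    norm_num at this
  refine hnt (hf.isTriangularFace hx hy V.mem c V.adj hadj hadj' (fun d hd d₁ d₂ d₃ => ?_)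
    (w := (1 - (1 / 2 : ℝ)) • v + (1 / 2 : ℝ) • z)
    (V.seg (mem_openSegment_iff_lin.2 ⟨1 / 2, by norm_num, by norm_num, rfl⟩)) ?_ ?_ ?_)
  · rcases lt_trichotomy (p d + ζ * h d) ζ with e | e | e
    · exact V.not_mem_drawing hG hf hU d₁ d₂ e hd
    · exact V.off_ray hf hd d₂ (by linarith) e
    · exact V.flip.not_mem_drawing hG hf hW (by linarith) d₂ (by linarith) hd
  · rw [c.aff_fst, c.fst_b, V.fst_z]; linarith
  · rw [c.aff_snd, c.snd_b, V.snd_z]; norm_num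
  · rw [c.aff_fst, c.fst_b, V.fst_z, c.aff_snd, c.snd_b, V.snd_z]; linarith

/-- The triangle `v z x` without its vertices `v` and `x`, and without its side on the edge `x y`,
lies in the face. -/
theorem subset_face (hP : GenPos P) (hG : IsPSLG P A) (hf : IsFace P A f)
    (hU : ∀ q ∈ P, 0 ≤ p q → 0 < h q → p q + ζ * h q ≤ ζ → q = v) (hadj : ¬ A.Adj x v) {d : ℂ}
    (d₁ : 0 ≤ p d) (d₂ : 0 < h d) (d₃ : p d + ζ * h d ≤ ζ) (d₄ : h d < 1) : d ∈ f := by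
  have c := V.coords
  have hζ := V.pos
  have hconv : Convex ℝ {q | 0 ≤ p q ∧ 0 < h q ∧ 0 ≤ (-1) * p q + (-ζ) * h q + ζ ∧
      0 < 0 * p q + (-1) * h q + 1} :=
    c.aff_fst.convex_nonneg.inter (c.aff_snd.convex_pos.inter
      ((c.aff_fst.comb c.aff_snd (-1) (-ζ) ζ).convex_nonneg.inter
        (c.aff_fst.comb c.aff_snd 0 (-1) 1).convex_pos))
  refine hf.absorb hconv.isPreconnected (fun d hd hdD => ?_)
    (w := (1 - (1 / 2 : ℝ)) • v + (1 / 2 : ℝ) • z) ?_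
    (V.seg (mem_openSegment_iff_lin.2 ⟨1 / 2, by norm_num, by norm_num, rfl⟩))
    (show d ∈ {q | 0 ≤ p q ∧ 0 < h q ∧ 0 ≤ (-1) * p q + (-ζ) * h q + ζ ∧
      0 < 0 * p q + (-1) * h q + 1} from ⟨d₁, d₂, by linarith, by linarith⟩)
  · obtain ⟨e₁, e₂, e₃, e₄⟩ := hd
    rcases e₁.eq_or_lt with e | e
    · refine (V.adj_or_free hP hG hf hU).resolve_left hadj d ?_ hdD
      refine mem_openSegment_iff_lin.2 ⟨h d, e₂, by linarith, ?_⟩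
      conv_lhs => rw [c.eq d, ← e]
      module
    · rcases (show p d + ζ * h d ≤ ζ by linarith).eq_or_lt with e' | e'
      · exact V.off_ray hf hdD e₂ (by linarith) e'
      · exact V.not_mem_drawing hG hf hU e e₂ e' hdD
  · have e₁ : p ((1 - (1 / 2 : ℝ)) • v + (1 / 2 : ℝ) • z) = ζ / 2 := by
      rw [c.aff_fst, c.fst_b, V.fst_z]; ring
    have e₂ : h ((1 - (1 / 2 : ℝ)) • v + (1 / 2 : ℝ) • z) = 1 / 2 := by
      rw [c.aff_snd, c.snd_b, V.snd_z]; ring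
    refine ⟨?_, ?_, ?_, ?_⟩
    · show 0 ≤ p _
      rw [e₁]; linarith
    · show 0 < h _
      rw [e₂]; norm_num
    · show 0 ≤ (-1) * p _ + (-ζ) * h _ + ζ
      rw [e₁, e₂]; linarith
    · show 0 < 0 * p _ + (-1) * h _ + 1
      rw [e₁, e₂]; norm_num

theorem not_adj (hs : 0 < s) (hA : IsMaximalPSLG P o s A) (hP : GenPos P)
    (hf : IsFace P A f) (hnt : ¬ IsTriangularFace P f) (hvy : Near o s v y) (hd : dist v z < s) :
    ¬ A.Adj x v :=
  fun h => V.not_near hs hA hP hf hnt hvy hd (hA.near h).symm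

theorem seesEnd (hs : 0 < s) (hA : IsMaximalPSLG P o s A) (hP : GenPos P)
    (hf : IsFace P A f) (hnt : ¬ IsTriangularFace P f) (hvy : Near o s v y) (hd : dist v z < s)
    (hcr : cross (v - x) (y - x) ≠ 0) : SeesEnd P A f x y v := by
  have hG := hA.pslg
  have c := V.coords
  have hζ := V.pos
  have hS : ∀ d, 0 ≤ p d → 0 < h d → p d + ζ * h d ≤ ζ → h d < 1 → d ∈ f := fun d =>
    V.subset_face hP hG hf (V.eq_of_mem hs hA hP hf hvy hd) (V.not_adj hs hA hP hf hnt hvy hd)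
  refine ⟨V.mem, hcr, ?_, ?_⟩
  · intro d hd
    obtain ⟨t, t0, t1, rfl⟩ := mem_openSegment_iff_lin.1 hd
    have hp : p ((1 - t) • x + t • v) = 0 := by rw [c.aff_fst x v t, c.fst_O, c.fst_b]; ring
    have hh : h ((1 - t) • x + t • v) = t := by rw [c.aff_snd x v t, c.snd_O, c.snd_b]; ring
    refine hS _ hp.ge (by rw [hh]; exact t0) ?_ (by rw [hh]; exact t1)
    rw [hp, hh]; nlinarith
  · intro q hq α β hα hβ e
    have e' : q = x + β • (y - x) + α • (v - x) := by
      rw [sub_eq_iff_eq_add] at e; rw [e]; module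
    have hp : p q = β := by rw [e', c.fst]
    have hh : h q = α := by rw [e', c.snd]
    have hlt : ∀ᶠ t : ℝ in 𝓝[>] 0, t < 1 := nhdsWithin_le_nhds (Iio_mem_nhds one_pos)
    obtain ⟨t, t₁, t₂, t₃, t₄⟩ := (((c.aff_fst.comb c.aff_snd (-1) (-ζ) ζ).eventually_pos
      (d := x) (by rw [c.fst_O, c.snd_O]; linarith) q).and
      (((c.aff_fst.comb c.aff_snd 0 (-1) 1).eventually_pos
      (d := x) (by rw [c.fst_O, c.snd_O]; linarith) q).and
      (hlt.and self_mem_nhdsWithin))).exists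
    have t₄' : (0 : ℝ) < t := t₄
    have t₃' : t < (1 : ℝ) := t₃
    refine hf.subset (hS ((1 - t) • x + t • q) ?_ ?_ (by linarith) (by linarith))
      (segment_subset_drawing hq (mem_segment_iff_lin.2 ⟨t, t₄'.le, t₃'.le, rfl⟩))
    · rw [c.aff_fst, c.fst_O, hp]; nlinarith
    · rw [c.aff_snd, c.snd_O, hh]; nlinarith

/-- No edge at `v` lies in the angle between the directions to `x` and to `z`. -/
theorem wedge (hs : 0 < s) (hA : IsMaximalPSLG P o s A) (hP : GenPos P)
    (hf : IsFace P A f) (hnt : ¬ IsTriangularFace P f) (hvy : Near o s v y) (hd : dist v z < s)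
    {q : ℂ} (hq : A.Adj v q) {α β : ℝ} (hα : 0 ≤ α) (hβ : 0 ≤ β) :
    q - v ≠ α • (x - v) + β • (z - v) := by
  intro e
  have hG := hA.pslg
  have c := V.coords
  have hζ := V.pos
  have hS : ∀ d, 0 ≤ p d → 0 < h d → p d + ζ * h d ≤ ζ → h d < 1 → d ∈ f := fun d =>
    V.subset_face hP hG hf (V.eq_of_mem hs hA hP hf hvy hd) (V.not_adj hs hA hP hf hnt hvy hd)
  have hpos : 0 < α + β := by
    refine lt_of_le_of_ne (by positivity) fun e0 => hq.ne' ?_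
    have h1 : α = 0 := by linarith
    have h2 : β = 0 := by linarith
    rw [h1, h2, zero_smul, zero_smul, add_zero] at e
    exact sub_eq_zero.1 e
  have e' : q = v + α • (x - v) + β • (z - v) := by
    rw [sub_eq_iff_eq_add] at e; rw [e]; module
  have hp : p q = β * ζ := by rw [e', c.aff_fst.wedge, c.fst_O, c.fst_b, V.fst_z]; ring
  have hh : h q = 1 - (α + β) := by rw [e', c.aff_snd.wedge, c.snd_O, c.snd_b, V.snd_z]; ring
  have hlt : ∀ᶠ t : ℝ in 𝓝[>] 0, t < 1 := nhdsWithin_le_nhds (Iio_mem_nhds one_pos)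
  obtain ⟨t, t₁, t₃, t₄⟩ := ((c.aff_snd.eventually_pos
    (d := v) (by rw [c.snd_b]; norm_num) q).and (hlt.and self_mem_nhdsWithin)).exists
  have t₄' : (0 : ℝ) < t := t₄
  have t₃' : t < (1 : ℝ) := t₃
  have hp' : p ((1 - t) • v + t • q) = t * (β * ζ) := by rw [c.aff_fst, c.fst_b, hp]; ring
  have hh' : h ((1 - t) • v + t • q) = 1 - t * (α + β) := by rw [c.aff_snd, c.snd_b, hh]; ring
  refine hf.subset (hS ((1 - t) • v + t • q) ?_ t₁ ?_ ?_)
    (segment_subset_drawing hq (mem_segment_iff_lin.2 ⟨t, t₄'.le, t₃'.le, rfl⟩))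
  · rw [hp']; positivity
  · rw [hp', hh']
    have : 0 ≤ t * (α * ζ) := by positivity
    linarith
  · rw [hh']
    have := mul_pos t₄' hpos
    linarith

/-- If `v` is near `y`, then the vertices of the triangle `x v y` other than `x` are pairwise
near. -/
theorem near_of_mem_hull (hs : 0 < s) (hA : IsMaximalPSLG P o s A) (hP : GenPos P)
    (hf : IsFace P A f) (hvy : Near o s v y) (hd : dist v z < s) {q q' : ℂ} (hq : q ∈ P)
    (hq' : q' ∈ P) (hqT : q ∈ convexHull ℝ {x, v, y}) (hqT' : q' ∈ convexHull ℝ {x, v, y})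
    (hqx : q ≠ x) (hqx' : q' ≠ x) : Near o s q q' := by
  have hG := hA.pslg
  have c := V.coords
  have hζ := V.pos
  have hζ1 := V.lt_one
  have key : ∀ q ∈ P, q ∈ convexHull ℝ {x, v, y} → q ≠ x → q ∈ convexHull ℝ {v, z, y} := by
    intro q hq hqT hqx
    rw [c.swap.convexHull_eq] at hqT
    obtain ⟨h₁, h₂, h₃⟩ := hqT
    refine V.flip.mem_hull (by linarith) h₁ ?_
    by_contra! hlt
    rcases h₁.eq_or_lt with e | e
    · rcases V.eq_or_eq_of_snd hP hG hq e.symm with rfl | rfl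
      · exact hqx rfl
      · rw [c.fst_a, ← e] at hlt; linarith
    · have := V.eq_of_mem hs hA hP hf hvy hd q hq h₂ e (by linarith)
      rw [this, c.fst_b, c.snd_b] at hlt
      linarith
  have hzy : Near o s z y :=
    ((convex_near o hs y).segment_subset (hA.near V.adj.symm) (near_self o s y)
      (mem_segment_iff_lin.2 ⟨ζ, hζ.le, hζ1.le, V.eq⟩) : Near o s y z).symm
  exact _root_.near_of_mem_hull hs (near_of_dist_lt hs hd) hvy hzy (key q hq hqT hqx)
    (key q' hq' hqT' hqx')

end View

end

/-! ### A visible edge is joined to its viewer by a chain of reflex vertices -/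

section

variable {P : Finset ℂ} {A : SimpleGraph ℂ} {f : Set ℂ} {o : ℂ} {s : ℝ} {x y z : ℂ} {ζ : ℝ}
  {p h : ℂ → ℝ} {v : ℤ → ℂ} {m : ℕ} {a : ℤ}

/-- The chain that joins a vertex `v a`, near `y`, to a visible edge `x y`, when the vertex is
on the right of the edge. It precedes the vertex, and all its vertices see `x`. -/
theorem View.exists_backward (V : View P A f x y (v a) z ζ p h) (hs : 0 < s)
    (hA : IsMaximalPSLG P o s A) (hP : GenPos P) (hf : IsFace P A f)
    (hnt : ¬ IsTriangularFace P f) (hv : IsBoundaryWalk A f v m) (hvy : Near o s (v a) y)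
    (hd : dist (v a) z < s) (hcr : 0 < cross (v a - x) (y - x)) (hcor : InCorner v a (z - v a)) :
    ∃ c < a, v c = y ∧ v (c - 1) = x ∧ ConvexAt v c ∧ (∀ k, c < k → k < a → ReflexAt v k) ∧
      ∀ k, c < k → k ≤ a → Near o s (v k) y ∧ Sees f v k (c - 1) := by
  classical
  have hy := (hA.pslg.mem _ _ V.adj).2
  have hcor' : InCorner v a (x - v a) := by
    by_contra! hlt
    have hpos : 0 < cross (z - v a) (x - v a) := by
      have e : cross (z - v a) (x - v a) = ζ * cross (v a - x) (y - x) := by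
        rw [V.eq]; simp [cross]; ring
      rw [e]; exact mul_pos V.pos hcr
    obtain ⟨α, β, hα, hβ, e⟩ := next_mem_sector' (hv.prev_ne a) (hv.next_ne a) hpos hcor.le
      (not_lt.1 hlt)
    exact V.wedge hs hA hP hf hnt hvy hd (hv.adj a) hβ hα (by rw [e, add_comm])
  have hnear : ∀ q ∈ P, ∀ q' ∈ P, q ∈ convexHull ℝ {x, v a, y} → q' ∈ convexHull ℝ {x, v a, y} →
      q ≠ x → q' ≠ x → Near o s q q' := fun q hq q' hq' hqT hqT' hqx hqx' =>
    V.near_of_mem_hull hs hA hP hf hvy hd hq hq' hqT hqT' hqx hqx'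
  obtain ⟨c, hc, h₁, h₂, h₃, h₄, h₅⟩ := hv.backward_chain hA hP hf V.adj _ a rfl
    (V.seesEnd hs hA hP hf hnt hvy hd hcr.ne') hcr hcor' hnear
  refine ⟨c, hc, h₁, h₂, h₃, h₄, fun k hk hk' => ?_⟩
  obtain ⟨hT, hsee, hC, hin⟩ := h₅ k hk hk'
  refine ⟨hnear _ hsee.mem _ hy hT (subset_convexHull ℝ _ (by simp)) hsee.ne V.adj.ne', ?_, ?_⟩
  · rw [h₂]
    exact ⟨by rw [openSegment_symm]; exact hsee.seg, hin⟩
  · refine ⟨by rw [h₂]; exact hsee.seg, hv.inCorner_of_next ?_ ?_⟩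
    · rw [sub_add_cancel, h₁, h₂]; exact hC
    · rw [sub_add_cancel, h₁, h₂]; exact hsee.wedge

/-- The chain that joins a vertex `v a`, near `y`, to a visible edge `x y`, when the vertex is
on the left of the edge. It follows the vertex, and all its vertices see `x`. -/
theorem View.exists_forward (V : View P A f x y (v a) z ζ p h) (hs : 0 < s)
    (hA : IsMaximalPSLG P o s A) (hP : GenPos P) (hf : IsFace P A f)
    (hnt : ¬ IsTriangularFace P f) (hv : IsBoundaryWalk A f v m) (hvy : Near o s (v a) y)
    (hd : dist (v a) z < s) (hcr : cross (v a - x) (y - x) < 0) (hcor : InCorner v a (z - v a)) :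
    ∃ c, a < c ∧ v c = y ∧ v (c + 1) = x ∧ ConvexAt v c ∧ (∀ k, a < k → k < c → ReflexAt v k) ∧
      ∀ k, a ≤ k → k < c → Near o s (v k) y ∧ Sees f v k (c + 1) := by
  classical
  have hy := (hA.pslg.mem _ _ V.adj).2
  have hcor' : InCorner v a (x - v a) := by
    by_contra! hlt
    have hpos : 0 < cross (x - v a) (z - v a) := by
      have e : cross (x - v a) (z - v a) = ζ * -cross (v a - x) (y - x) := by
        rw [V.eq]; simp [cross]; ring
      rw [e]; exact mul_pos V.pos (neg_pos.2 hcr)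
    obtain ⟨α, β, hα, hβ, e⟩ := mem_sector_of_ccwAngle_le (hv.prev_ne a) hpos
      (hcor.le.trans (not_lt.1 hlt))
    exact V.wedge hs hA hP hf hnt hvy hd (hv.adj_prev a) hα.le hβ e
  have hnear : ∀ q ∈ P, ∀ q' ∈ P, q ∈ convexHull ℝ {x, v a, y} → q' ∈ convexHull ℝ {x, v a, y} →
      q ≠ x → q' ≠ x → Near o s q q' := fun q hq q' hq' hqT hqT' hqx hqx' =>
    V.near_of_mem_hull hs hA hP hf hvy hd hq hq' hqT hqT' hqx hqx'
  obtain ⟨c, hc, h₁, h₂, h₃, h₄, h₅⟩ := hv.forward_chain hA hP hf V.adj _ a rfl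
    (V.seesEnd hs hA hP hf hnt hvy hd hcr.ne) hcr hcor' hnear
  refine ⟨c, hc, h₁, h₂, h₃, h₄, fun k hk hk' => ?_⟩
  obtain ⟨hT, hsee, hC, hin⟩ := h₅ k hk hk'
  refine ⟨hnear _ hsee.mem _ hy hT (subset_convexHull ℝ _ (by simp)) hsee.ne V.adj.ne', ?_, ?_⟩
  · rw [h₂]
    exact ⟨by rw [openSegment_symm]; exact hsee.seg, hin⟩
  · refine ⟨by rw [h₂]; exact hsee.seg, hv.inCorner_of_prev ?_ ?_⟩
    · rw [add_sub_cancel_right, h₁, h₂]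
      have : cross (y - x) (v k - x) = -cross (v k - x) (y - x) := by simp [cross]; ring
      rw [this]; exact neg_pos.2 hC
    · rw [add_sub_cancel_right, h₁, h₂]; exact hsee.wedge

theorem IsBoundaryWalk.mem (hv : IsBoundaryWalk A f v m) (hG : IsPSLG P A) (k : ℤ) : v k ∈ P :=
  (hG.mem _ _ (hv.adj k)).1

/-- A `δ`-visible edge `x y` occurs on the walk just before or just after a chain of reflex
vertices that starts at its viewer. In the first case the vertices of the chain are near `y` and
see `x`; in the second case they are near `x` and see `y`. -/
theorem IsBoundaryWalk.exists_of_deltaVisible (hs : 0 < s) (hA : IsMaximalPSLG P o s A)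
    (hP : GenPos P) (hf : IsFace P A f) (hnt : ¬ IsTriangularFace P f)
    (hv : IsBoundaryWalk A f v m) (hxy : A.Adj x y)
    (hvis : DeltaVisible f v (s / Real.sqrt 2) a x y) :
    (∃ c < a, v c = y ∧ v (c - 1) = x ∧ ConvexAt v c ∧ (∀ k, c < k → k < a → ReflexAt v k) ∧
      ∀ k, c < k → k ≤ a → Near o s (v k) (v c) ∧ Sees f v k (c - 1)) ∨
    (∃ c, a < c ∧ v c = x ∧ v (c + 1) = y ∧ ConvexAt v c ∧ (∀ k, a < k → k < c → ReflexAt v k) ∧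
      ∀ k, a ≤ k → k < c → Near o s (v k) (v c) ∧ Sees f v k (c + 1)) := by
  obtain ⟨hside, z, hz, ⟨hseg, hcor⟩, hdist⟩ := hvis
  have hG := hA.pslg
  have hcr : 0 < cross (v a - x) (y - x) := by
    have e : ((starRingEnd ℂ) (y - x) * (v a - x)).im = -cross (v a - x) (y - x) := by
      simp [cross]; ring
    rw [e] at hside
    linarith
  have hlt : s / Real.sqrt 2 < s := by
    apply div_lt_self hs
    rw [Real.lt_sqrt] <;> norm_num
  have hd : dist (v a) z < s := hdist.trans_lt hlt
  have hne : ∀ q ∈ P, q ≠ v a → z ≠ q := by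
    rintro q hq hqa rfl
    exact hA.not_near (hv.mem hG a) hq hqa.symm (fun d hd => hf.subset (hseg hd))
      (near_of_dist_lt hs hd)
  have hzx : z ≠ x := by
    refine hne x (hG.mem _ _ hxy).1 ?_
    rintro rfl
    simp [cross] at hcr
  have hzy : z ≠ y := by
    refine hne y (hG.mem _ _ hxy).2 ?_
    rintro rfl
    simp only [cross] at hcr
    linarith
  obtain ⟨ζ, h0, h1, e⟩ := mem_openSegment_iff_lin.1
    (mem_openSegment_of_ne_left_right hzx.symm hzy.symm hz)
  obtain ⟨p, h, co⟩ := exists_coords (O := x) (a := y) (b := v a)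
    (by rw [cross_comm]; exact neg_ne_zero.2 hcr.ne')
  have V : View P A f x y (v a) z ζ p h := ⟨co, h0, h1, e, hseg, hxy, hv.mem hG a⟩
  rcases near_or_near hs (hA.near hxy) hz hdist with hn | hn
  · right
    obtain ⟨c, h₁, rfl, h₂⟩ := V.flip.exists_forward hs hA hP hf hnt hv hn hd
      (by
        have : cross (v a - y) (x - y) = -cross (v a - x) (y - x) := by simp [cross]; ring
        rw [this]; exact neg_neg_of_pos hcr) hcor
    exact ⟨c, h₁, rfl, h₂⟩
  · left
    obtain ⟨c, h₁, rfl, h₂⟩ := V.exists_backward hs hA hP hf hnt hv hn hd hcr hcor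
    exact ⟨c, h₁, rfl, h₂⟩

end

/-! ### Chain ends -/

section

variable {o : ℂ} {s : ℝ} {f : Set ℂ} {v : ℤ → ℂ} {T p l e c : ℤ}

/-- Convex vertices occur arbitrarily far in both directions. -/
def ConvexRecurs (v : ℤ → ℂ) : Prop :=
  (∀ p, ∃ c, p < c ∧ ConvexAt v c) ∧ ∀ p, ∃ c, c < p ∧ ConvexAt v c

theorem ReflexAt.not_convexAt (h : ReflexAt v c) : ¬ ConvexAt v c := not_lt.2 (le_of_lt h)

theorem forwardConvex_spec (h : ConvexRecurs v) (p : ℤ) :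
    p < forwardConvex v p ∧ ConvexAt v (forwardConvex v p) :=
  Int.csInf_mem (s := {c | p < c ∧ ConvexAt v c}) (h.1 p) ⟨p, fun _ hc => hc.1.le⟩

theorem forwardConvex_le (hc : p < c) (hcv : ConvexAt v c) : forwardConvex v p ≤ c :=
  csInf_le (⟨p, fun _ hc => hc.1.le⟩ : BddBelow {c | p < c ∧ ConvexAt v c}) ⟨hc, hcv⟩

theorem forwardConvex_eq (hc : p < c) (hcv : ConvexAt v c)
    (hno : ∀ k, p < k → k < c → ¬ ConvexAt v k) : forwardConvex v p = c :=
  IsLeast.csInf_eq (s := {c | p < c ∧ ConvexAt v c})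
    ⟨⟨hc, hcv⟩, fun k hk => not_lt.1 fun hlt => hno k hk.1 hlt hk.2⟩

theorem backwardConvex_eq (hc : c < p) (hcv : ConvexAt v c)
    (hno : ∀ k, c < k → k < p → ¬ ConvexAt v k) : backwardConvex v p = c :=
  IsGreatest.csSup_eq (s := {c | c < p ∧ ConvexAt v c})
    ⟨⟨hc, hcv⟩, fun k hk => not_lt.1 fun hlt => hno k hlt hk.1 hk.2⟩

theorem backwardConvex_spec (h : ConvexRecurs v) (p : ℤ) :
    backwardConvex v p < p ∧ ConvexAt v (backwardConvex v p) ∧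
      ∀ k, backwardConvex v p < k → k < p → ¬ ConvexAt v k := by
  have hb : BddAbove {c | c < p ∧ ConvexAt v c} := ⟨p, fun _ hc => hc.1.le⟩
  have hm := Int.csSup_mem (s := {c | c < p ∧ ConvexAt v c}) (h.2 p) hb
  exact ⟨hm.1, hm.2, fun k hk hkp hkc => absurd (le_csSup hb ⟨hkp, hkc⟩) (not_le.2 hk)⟩

theorem isGreatest_extendedEnd (h : ConvexRecurs v) (hA : StepOneA o s f v l) :
    IsGreatest {e | l < e ∧ (∀ k, l < k → k ≤ e → ReflexAt v k) ∧
      BackwardOK o s f v (backwardConvex v (l + 1)) e} (extendedEnd o s f v l) := by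
  obtain ⟨c, hc, hcv⟩ := h.1 l
  have hb : BddAbove {e | l < e ∧ (∀ k, l < k → k ≤ e → ReflexAt v k) ∧
      BackwardOK o s f v (backwardConvex v (l + 1)) e} :=
    ⟨c, fun e he => not_lt.1 fun hlt => (he.2.1 c hc hlt.le).not_convexAt hcv⟩
  refine ⟨Int.csSup_mem ⟨l + 1, by lia, fun k h1 h2 => ?_, hA.2⟩ hb, fun e he => le_csSup hb he⟩
  rw [show k = l + 1 by lia]
  exact hA.1

theorem lt_extendedEnd (h : ConvexRecurs v) (hA : StepOneA o s f v l) :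
    l < extendedEnd o s f v l :=
  (isGreatest_extendedEnd h hA).1.1

theorem forwardConvex_lt_chainEnd (h : ConvexRecurs v) (hp : StepOne o s f v p) :
    forwardConvex v p + 1 ≤ chainEnd o s f v p := by
  rw [chainEnd, if_pos hp]
  split_ifs with hA
  · exact (lt_extendedEnd h hA).le
  · exact le_rfl

theorem lt_chainEnd (h : ConvexRecurs v) (p : ℤ) : p < chainEnd o s f v p := by
  by_cases hp : StepOne o s f v p
  · have := forwardConvex_lt_chainEnd h hp
    have := (forwardConvex_spec h p).1
    lia
  · rw [chainEnd, if_neg hp]; lia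

/-- A chain does not reach beyond a convex vertex that follows its support vertex. -/
theorem chainEnd_lt (h : ConvexRecurs v) (hp : StepOne o s f v p) (hc : forwardConvex v p + 1 < c)
    (hcv : ConvexAt v c) : chainEnd o s f v p < c := by
  rw [chainEnd, if_pos hp]
  split_ifs with hA
  · by_contra! hle
    exact ((isGreatest_extendedEnd h hA).1.2.1 c hc hle).not_convexAt hcv
  · exact hc

theorem chainEnd_congr {p' : ℤ} (hp : StepOne o s f v p) (hp' : StepOne o s f v p')
    (e : forwardConvex v p = forwardConvex v p') :
    chainEnd o s f v p = chainEnd o s f v p' := by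
  rw [chainEnd, chainEnd, if_pos hp, if_pos hp', e]

section Shift

variable (hT : ∀ k, v (k + T) = v k)

include hT

theorem cornerAngle_shift (k : ℤ) : cornerAngle v (k + T) = cornerAngle v k := by
  rw [cornerAngle, cornerAngle, show k + T - 1 = k - 1 + T by ring,
    show k + T + 1 = k + 1 + T by ring, hT, hT, hT]

theorem convexAt_shift (k : ℤ) : ConvexAt v (k + T) ↔ ConvexAt v k := by
  rw [ConvexAt, ConvexAt, cornerAngle_shift hT]

theorem reflexAt_shift (k : ℤ) : ReflexAt v (k + T) ↔ ReflexAt v k := by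
  rw [ReflexAt, ReflexAt, cornerAngle_shift hT]

theorem seesPoint_shift (k : ℤ) (z : ℂ) : SeesPoint f v (k + T) z ↔ SeesPoint f v k z := by
  rw [SeesPoint, SeesPoint, cornerAngle_shift hT, show k + T - 1 = k - 1 + T by ring, hT, hT]

theorem sees_shift (k l : ℤ) : Sees f v (k + T) (l + T) ↔ Sees f v k l := by
  rw [Sees, Sees, seesPoint_shift hT, seesPoint_shift hT, hT, hT]

theorem forwardConvex_shift (h : ConvexRecurs v) (p : ℤ) :
    forwardConvex v (p + T) = forwardConvex v p + T := by
  obtain ⟨h1, h2⟩ := forwardConvex_spec h p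
  refine forwardConvex_eq (by lia) ((convexAt_shift hT _).2 h2) fun k hk hk' hkc => ?_
  rw [show k = k - T + T by ring, convexAt_shift hT] at hkc
  have := forwardConvex_le (p := p) (by lia) hkc
  lia

theorem backwardConvex_shift (h : ConvexRecurs v) (p : ℤ) :
    backwardConvex v (p + T) = backwardConvex v p + T := by
  obtain ⟨h1, h2, h3⟩ := backwardConvex_spec h p
  refine backwardConvex_eq (by lia) ((convexAt_shift hT _).2 h2) fun k hk hk' hkc => ?_
  rw [show k = k - T + T by ring, convexAt_shift hT] at hkc
  exact h3 _ (by lia) (by lia) hkc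

theorem stepOne_shift (h : ConvexRecurs v) (p : ℤ) :
    StepOne o s f v (p + T) ↔ StepOne o s f v p := by
  rw [StepOne, StepOne, forwardConvex_shift hT h, convexAt_shift hT, hT, hT,
    show forwardConvex v p + T + 1 = forwardConvex v p + 1 + T by ring, sees_shift hT]

theorem backwardOK_shift (d k : ℤ) :
    BackwardOK o s f v (d + T) (k + T) ↔ BackwardOK o s f v d k := by
  rw [BackwardOK, BackwardOK, hT, hT, show d + T - 1 = d - 1 + T by ring, sees_shift hT]

theorem stepOneA_shift (h : ConvexRecurs v) (l : ℤ) :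
    StepOneA o s f v (l + T) ↔ StepOneA o s f v l := by
  rw [StepOneA, StepOneA, show l + T + 1 = l + 1 + T by ring, reflexAt_shift hT,
    backwardConvex_shift hT h, backwardOK_shift hT]

theorem extendedEnd_shift (h : ConvexRecurs v) (hA : StepOneA o s f v l) :
    extendedEnd o s f v (l + T) = extendedEnd o s f v l + T := by
  have key : ∀ e, (l + T < e + T ∧ (∀ k, l + T < k → k ≤ e + T → ReflexAt v k) ∧
      BackwardOK o s f v (backwardConvex v (l + T + 1)) (e + T)) ↔
      (l < e ∧ (∀ k, l < k → k ≤ e → ReflexAt v k) ∧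
        BackwardOK o s f v (backwardConvex v (l + 1)) e) := by
    intro e
    rw [show l + T + 1 = l + 1 + T by ring, backwardConvex_shift hT h, backwardOK_shift hT]
    refine and_congr (by lia) (and_congr ⟨fun H k h1 h2 => ?_, fun H k h1 h2 => ?_⟩ Iff.rfl)
    · exact (reflexAt_shift hT k).1 (H (k + T) (by lia) (by lia))
    · rw [show k = k - T + T by ring]
      exact (reflexAt_shift hT _).2 (H (k - T) (by lia) (by lia))
  obtain ⟨h1, h2⟩ := isGreatest_extendedEnd h hA
  refine IsGreatest.csSup_eq ⟨(key _).2 h1, fun e he => ?_⟩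
  rw [mem_ofPred_eq, show e = e - T + T by ring, key] at he
  have : e - T ≤ _ := h2 he
  lia

theorem chainEnd_shift (h : ConvexRecurs v) (p : ℤ) :
    chainEnd o s f v (p + T) = chainEnd o s f v p + T := by
  have e : forwardConvex v p + T + 1 = forwardConvex v p + 1 + T := by ring
  rw [chainEnd, chainEnd, forwardConvex_shift hT h, e]
  by_cases h1 : StepOne o s f v p
  · rw [if_pos h1, if_pos ((stepOne_shift hT h p).2 h1)]
    by_cases h2 : StepOneA o s f v (forwardConvex v p + 1)
    · rw [if_pos h2, if_pos ((stepOneA_shift hT h _).2 h2)]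
      exact extendedEnd_shift hT h h2
    · rw [if_neg h2, if_neg (mt (stepOneA_shift hT h _).1 h2)]
  · rw [if_neg h1, if_neg (mt (stepOne_shift hT h p).1 h1)]
    ring

end Shift

/-! ### One round of the walk -/

/-- What is used of a maximal triangulated chain from `p` to `q`: each of its edges belongs to a
generated chain that ends in it, or, if two chains were merged, to the part of the first one before
its forward convex vertex, whose support vertex is then convex. -/
structure IsRemainingChain (o : ℂ) (s : ℝ) (f : Set ℂ) (v : ℤ → ℂ) (p q : ℤ) : Prop where
  lt : p < q
  stepOne : StepOne o s f v p → forwardConvex v p + 1 ≤ q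
  cover : ∀ X, p ≤ X → X < q →
    (∃ p' ≤ X, X < chainEnd o s f v p' ∧ chainEnd o s f v p' ≤ q) ∨
      (StepOne o s f v p ∧ X < forwardConvex v p ∧ ConvexAt v (forwardConvex v p + 1))

theorem IsRemainingChain.shift (hT : ∀ k, v (k + T) = v k) (h : ConvexRecurs v) {p q : ℤ}
    (H : IsRemainingChain o s f v p q) : IsRemainingChain o s f v (p + T) (q + T) := by
  refine ⟨by have := H.lt; lia, fun hp => ?_, fun X h1 h2 => ?_⟩
  · have := H.stepOne ((stepOne_shift hT h p).1 hp)
    rw [forwardConvex_shift hT h]; lia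
  · rw [stepOne_shift hT h, forwardConvex_shift hT h,
      show forwardConvex v p + T + 1 = forwardConvex v p + 1 + T by ring, convexAt_shift hT]
    rcases H.cover (X - T) (by lia) (by lia) with ⟨p', h3, h4, h5⟩ | ⟨h3, h4, h5⟩
    · refine Or.inl ⟨p' + T, by lia, ?_⟩
      rw [chainEnd_shift hT h]
      lia
    · exact Or.inr ⟨h3, by lia, h5⟩

theorem isRemainingChain_chainEnd (h : ConvexRecurs v) (p : ℤ) :
    IsRemainingChain o s f v p (chainEnd o s f v p) :=
  ⟨lt_chainEnd h p, forwardConvex_lt_chainEnd h, fun _ h1 h2 => Or.inl ⟨p, h1, h2, le_rfl⟩⟩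

theorem processedFrom_eq (h : ConvexRecurs v) (bound : ℤ) (fuel : ℕ) :
    ∀ p : ℤ, bound ≤ p + fuel → ∃ n : ℕ,
      processedFrom o s f v bound fuel p =
        (List.range n).map (fun i => (chainEnd o s f v)^[i] p) ∧
      (∀ i < n, (chainEnd o s f v)^[i] p < bound) ∧ bound ≤ (chainEnd o s f v)^[n] p := by
  induction fuel with
  | zero => exact fun p hp => ⟨0, by simp [processedFrom], by simp, by simpa using hp⟩
  | succ fuel ih =>
    intro p hp
    by_cases hlt : p < bound
    · have := lt_chainEnd (o := o) (s := s) (f := f) h p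
      obtain ⟨n, h1, h2, h3⟩ := ih (chainEnd o s f v p) (by push_cast at hp; lia)
      refine ⟨n + 1, ?_, ?_, ?_⟩
      · rw [processedFrom, if_pos hlt, h1, List.range_succ_eq_map, List.map_cons, List.map_map]
        rfl
      · rintro (_ | i) hi
        · simpa using hlt
        · rw [Function.iterate_succ_apply]; exact h2 i (by lia)
      · rw [Function.iterate_succ_apply]; exact h3
    · exact ⟨0, by rw [processedFrom, if_neg hlt]; simp, by simp, by simpa using hlt⟩

/-- One round of Phase 1: the remaining vertices are `K 0, …, K (N - 1)`, and the part of the walk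
between any two consecutive ones, in cyclic order, is a chain. -/
theorem exists_round {A : SimpleGraph ℂ} {m : ℕ} {j : ℤ} (hv : IsBoundaryWalk A f v m)
    (h : ConvexRecurs v) (hnear : ∀ k, Near o s (v k) (v (k + 1)))
    (hsees : ∀ k, ConvexAt v k → Sees f v (k - 1) (k + 1))
    (hrefl : ∀ k, ¬ ConvexAt v k → ReflexAt v k) (hj : IsStart v j) :
    ∃ (N : ℕ) (K : ℕ → ℤ), 0 < N ∧ remaining o s f v m j = (List.range N).map K ∧
      (∀ k, k + 1 < N → IsRemainingChain o s f v (K k) (K (k + 1))) ∧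
      IsRemainingChain o s f v (K (N - 1)) (K 0 + m) := by
  have hT := hv.periodic
  have hm : (0 : ℤ) < m := by exact_mod_cast hv.pos
  -- the start vertex is followed by a convex vertex: otherwise all vertices are reflex
  have hj1 : ConvexAt v (j + 1) := by
    rcases hj with hj | hj
    · exact hj.1
    · push Not at hj
      obtain ⟨c, hc, hcv⟩ := h.2 (j + 1)
      have : ∀ n : ℕ, ConvexAt v (c + n) := by
        intro n
        induction n with
        | zero => simpa using hcv
        | succ n ih =>
          by_contra hn
          refine hj (c + n - 1) (by rwa [sub_add_cancel]) ?_
          have := hrefl _ hn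
          rwa [show c + n - 1 + 2 = c + ((n + 1 : ℕ) : ℤ) by push_cast; ring]
      have := this (j + 1 - c).toNat
      rwa [Int.toNat_of_nonneg (by lia), add_sub_cancel] at this
  have hjm1 : ConvexAt v (j + m + 1) := by
    rw [show j + m + 1 = j + 1 + m by ring, convexAt_shift hT]; exact hj1
  have hfj : forwardConvex v j = j + 1 := forwardConvex_eq (by lia) hj1 fun k _ _ => by lia
  have hsj : StepOne o s f v j := by
    refine ⟨by rw [hfj]; exact hj1, by rw [hfj]; exact hnear j, ?_⟩
    rw [hfj]
    have := hsees _ hj1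
    rwa [add_sub_cancel_right] at this
  have hm2 : (1 : ℤ) < m := by
    by_contra! hle
    have : (m : ℤ) = 1 := by lia
    have h1 := hv.adj 0
    have h2 := hT 0
    rw [this] at h2
    rw [h2] at h1
    exact h1.ne rfl
  obtain ⟨n, hn, hlt, hge⟩ := processedFrom_eq (o := o) (s := s) (f := f) h (j + m) m j (by lia)
  set K : ℕ → ℤ := fun i => (chainEnd o s f v)^[i] j with hK
  have hK0 : K 0 = j := rfl
  have hKs : ∀ i, K (i + 1) = chainEnd o s f v (K i) := fun i => Function.iterate_succ_apply' ..
  have hstep : ∀ i, IsRemainingChain o s f v (K i) (K (i + 1)) := fun i => by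
    rw [hKs]; exact isRemainingChain_chainEnd h _
  have hmono : ∀ i, K 0 ≤ K i := by
    intro i
    induction i with
    | zero => exact le_rfl
    | succ i ih => exact ih.trans (hstep i).lt.le
  have hn0 : n ≠ 0 := by
    rintro rfl
    have : j + m ≤ j := hge
    lia
  obtain ⟨n, rfl⟩ := Nat.exists_eq_succ_of_ne_zero hn0
  have hKn : K n < j + m := hlt n (by lia)
  have hKn1 : j + m ≤ K (n + 1) := hge
  have hmem : ∀ p, p ∈ processed o s f v m j ↔ ∃ i < n + 1, K i = p := by
    intro p
    rw [processed, hn]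
    simp
  by_cases hC : StepOneC o s f v m j
  · -- the vertex with a visited forward convex vertex is the last one
    obtain ⟨p, hp, hp1, hpc⟩ := hC
    have hpK : p = K n := by
      obtain ⟨i, hi, rfl⟩ := (hmem p).1 hp
      by_contra hne
      have hi' : i + 1 < n + 1 := by
        rcases (show i + 1 < n + 1 ∨ i = n by lia) with h | rfl
        · exact h
        · exact absurd rfl hne
      have := hlt (i + 1) hi'
      have h2 := forwardConvex_lt_chainEnd h hp1
      rw [← hKs] at h2
      have h3 : K (i + 1) < j + m := this
      lia
    subst hpK
    have hn1 : n ≠ 0 := by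
      rintro rfl
      rw [hK0, hfj] at hpc
      lia
    obtain ⟨n, rfl⟩ := Nat.exists_eq_succ_of_ne_zero hn1
    refine ⟨n + 1, fun i => K (i + 1), by lia, ?_, fun k _ => hstep _, ?_⟩
    · rw [remaining, if_pos ⟨_, hp, hp1, hpc⟩, processed, hn, List.range_succ_eq_map]
      simp [hK, List.map_map, Function.comp_def]
    · show IsRemainingChain o s f v (K (n + 1)) (K 1 + m)
      have hK1 : K 1 + m = chainEnd o s f v (j + m) := by
        rw [chainEnd_shift hT h, hKs 0, hK0]
      have hfjm : forwardConvex v (j + m) = j + m + 1 := by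
        rw [forwardConvex_shift hT h, hfj]; ring
      have hsjm := (stepOne_shift hT h j).2 hsj
      have hle := forwardConvex_le (p := K (n + 1)) (show K (n + 1) < j + m + 1 by lia) hjm1
      have hge' := forwardConvex_lt_chainEnd h hsjm
      rw [hK1]
      rcases (show forwardConvex v (K (n + 1)) = j + m ∨
        forwardConvex v (K (n + 1)) = j + m + 1 by lia) with hc | hc
      · refine ⟨by lia, fun _ => by lia, fun X h1 h2 => ?_⟩
        rcases lt_or_ge X (j + m) with hX | hX
        · exact Or.inr ⟨hp1, by lia, by rw [hc]; exact hjm1⟩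
        · exact Or.inl ⟨j + m, hX, h2, le_rfl⟩
      · rw [← chainEnd_congr hp1 hsjm (by rw [hc, hfjm])]
        exact isRemainingChain_chainEnd h _
  · refine ⟨n + 1, K, by lia, by rw [remaining, if_neg hC, processed, hn], fun k _ => hstep k, ?_⟩
    have hend : K (n + 1) = j + m := by
      refine le_antisymm ?_ hKn1
      rw [hKs]
      by_cases hs : StepOne o s f v (K n)
      · have hlt' : forwardConvex v (K n) < j + m := by
          by_contra! hle
          exact hC ⟨K n, (hmem _).2 ⟨n, by lia, rfl⟩, hs, hle⟩
        have := chainEnd_lt h hs (by lia) hjm1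
        lia
      · rw [chainEnd, if_neg hs]; lia
    have := hstep n
    rw [hend] at this
    rw [hK0]
    exact this

end

/-! ### The sequence of remaining vertices -/

section

variable {o : ℂ} {s : ℝ} {f : Set ℂ} {v : ℤ → ℂ} {a : ℤ} {J : ℤ → ℤ}

theorem isRemainingChain_remainingIndex {m : ℕ} {j : ℤ} {N : ℕ} {K : ℕ → ℤ}
    (hT : ∀ k, v (k + m) = v k) (h : ConvexRecurs v) (hN : 0 < N)
    (hL : remaining o s f v m j = (List.range N).map K)
    (hK : ∀ k, k + 1 < N → IsRemainingChain o s f v (K k) (K (k + 1)))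
    (hK' : IsRemainingChain o s f v (K (N - 1)) (K 0 + m)) (r : ℤ) :
    IsRemainingChain o s f v (remainingIndex o s f v m j r) (remainingIndex o s f v m j (r + 1)) := by
  have hN' : (0 : ℤ) < N := by exact_mod_cast hN
  have key : ∀ (k : ℕ) (q : ℤ), k < N →
      remainingIndex o s f v m j (k + q * N) = K k + q * m := by
    intro k q hk
    have hk' : (k : ℤ) < N := by exact_mod_cast hk
    have e1 : (k + q * N : ℤ) % N = k := by
      rw [Int.add_mul_emod_self_right, Int.emod_eq_of_lt (by lia) hk']
    have e2 : (k + q * N : ℤ) / N = q := by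
      rw [Int.add_mul_ediv_right _ _ hN'.ne', Int.ediv_eq_zero_of_lt (by lia) hk', zero_add]
    simp only [remainingIndex, hL, List.length_map, List.length_range, e1, e2, Int.toNat_natCast]
    rw [List.getD_eq_getElem _ _ (by simpa using hk)]
    simp
  have hTq : ∀ q : ℤ, ∀ k, v (k + q * m) = v k := fun q k =>
    Function.Periodic.int_mul (f := v) (c := (m : ℤ)) hT q k
  obtain ⟨k, q, hk, rfl⟩ : ∃ (k : ℕ) (q : ℤ), k < N ∧ r = k + q * N := by
    have h1 := Int.emod_nonneg r hN'.ne'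
    have h2 := Int.emod_lt_of_pos r hN'
    refine ⟨(r % N).toNat, r / N, by lia, ?_⟩
    rw [Int.toNat_of_nonneg h1]
    have := Int.emod_add_mul_ediv r N
    lia
  rw [key k q hk]
  rcases (show k + 1 < N ∨ k = N - 1 by lia) with hk1 | rfl
  · have := key (k + 1) q hk1
    rw [show ((k + 1 : ℕ) : ℤ) + q * N = k + q * N + 1 by push_cast; ring] at this
    rw [this]
    exact (hK k hk1).shift (hTq q) h
  · have := key 0 (q + 1) hN
    rw [show ((0 : ℕ) : ℤ) + (q + 1) * N = ((N - 1 : ℕ) : ℤ) + q * N + 1 by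
      rw [Nat.cast_pred hN]; push_cast; ring] at this
    rw [this, show K 0 + (q + 1) * (m : ℤ) = K 0 + m + q * m by ring]
    exact hK'.shift (hTq q) h

theorem exists_le_lt_of_strictMono (hJ : StrictMono J) (a : ℤ) : ∃ r, J r ≤ a ∧ a < J (r + 1) := by
  have up : ∀ n : ℕ, J 0 + n ≤ J n := by
    intro n
    induction n with
    | zero => simp
    | succ n ih =>
      have := hJ (show (n : ℤ) < (n + 1 : ℕ) by push_cast; lia)
      push_cast at this ⊢
      lia
  have down : ∀ n : ℕ, J (-n) ≤ J 0 - n := by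
    intro n
    induction n with
    | zero => simp
    | succ n ih =>
      have := hJ (show -((n + 1 : ℕ) : ℤ) < -(n : ℤ) by push_cast; lia)
      push_cast at this ⊢
      lia
  obtain ⟨r, hr, hmax⟩ := Int.exists_greatest_of_bdd (P := fun r => J r ≤ a)
    ⟨(a - J 0).toNat, fun r hr => by
      by_contra! hlt
      have h1 := up r.toNat
      rw [Int.toNat_of_nonneg (by lia)] at h1
      lia⟩
    ⟨-((J 0 - a).toNat : ℤ), by
      have h1 := down (J 0 - a).toNat
      lia⟩
  refine ⟨r, hr, not_le.1 fun hle => ?_⟩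
  have := hmax _ hle
  lia

/-- Let the vertices after the convex vertex `c` up to `a`, all of them reflex except perhaps `a`,
be near `c` and see the vertex before `c`. A chain that starts before `c` and reaches `c` extends
over all reflex ones among them, by part (a) of Step 1. -/
theorem le_chainEnd_of_backward (h : ConvexRecurs v) (hnear : ∀ k, Near o s (v k) (v (k + 1)))
    (hsees : ∀ k, ConvexAt v k → Sees f v (k - 1) (k + 1)) {c p : ℤ} (hca : c < a)
    (hc : ConvexAt v c) (hrun : ∀ k, c < k → k < a → ReflexAt v k)
    (hchain : ∀ k, c < k → k ≤ a → BackwardOK o s f v c k) (hp : p < c)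
    (hpc : c ≤ chainEnd o s f v p) :
    a - 1 ≤ chainEnd o s f v p ∧ (ReflexAt v a → a ≤ chainEnd o s f v p) := by
  have hfc : forwardConvex v (c - 1) = c := forwardConvex_eq (by lia) hc fun k _ _ => by lia
  have hsc : StepOne o s f v (c - 1) := by
    refine ⟨by rwa [hfc], ?_, by rw [hfc]; exact hsees c hc⟩
    have := hnear (c - 1)
    rwa [hfc, show v c = v (c - 1 + 1) by rw [sub_add_cancel]]
  have hs : StepOne o s f v p := by
    by_contra hs
    rw [chainEnd, if_neg hs] at hpc
    rw [show c - 1 = p by lia] at hsc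
    exact hs hsc
  have hle := forwardConvex_le hp hc
  have hlt := forwardConvex_lt_chainEnd h hs
  set l := forwardConvex v p + 1 with hl
  -- the support vertex is `c` or the vertex after it
  have hlc : c ≤ l := by
    by_contra! hlt
    exact absurd (chainEnd_lt h hs hlt hc) (not_lt.2 hpc)
  have hbc : backwardConvex v (l + 1) = c ∨ a ≤ l := by
    rcases le_or_gt a l with hal | hal
    · exact Or.inr hal
    · exact Or.inl (backwardConvex_eq (by lia) hc fun k h1 h2 =>
        (hrun k h1 (by lia)).not_convexAt)
  rcases hbc with hbc | hal
  · have ext : ∀ e, l < e → e ≤ a → (∀ k, l < k → k ≤ e → ReflexAt v k) →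
        e ≤ chainEnd o s f v p := by
      intro e h1 h2 h3
      have hA : StepOneA o s f v l :=
        ⟨h3 _ (by lia) (by lia), by rw [hbc]; exact hchain _ (by lia) (by lia)⟩
      rw [chainEnd, if_pos hs, if_pos hA]
      exact (isGreatest_extendedEnd h hA).2 ⟨h1, h3, by rw [hbc]; exact hchain e (by lia) h2⟩
    constructor
    · rcases le_or_gt (a - 1) l with h1 | h1
      · exact h1.trans hlt
      · exact ext (a - 1) h1 (by lia) fun k h2 h3 => hrun k (by lia) (by lia)
    · intro ha
      rcases le_or_gt a l with h1 | h1
      · exact h1.trans hlt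
      · refine ext a h1 le_rfl fun k h2 h3 => ?_
        rcases h3.eq_or_lt with rfl | h3
        · exact ha
        · exact hrun k (by lia) h3
  · exact ⟨by lia, fun _ => by lia⟩

end

theorem mainTheorem4
    (P : Finset ℂ)
    (hP : ∀ a ∈ P, ∀ b ∈ P, ∀ c ∈ P, a ≠ b → a ≠ c → b ≠ c → ¬ Collinear ℝ {a, b, c})
    (γ : ℝ) (hγ : 0 < γ) (i : ℤ) (o : ℂ)
    (s : ℝ) (hs : s = γ * 3 ^ (i - 1))
    (A : SimpleGraph ℂ) (hA : IsMaximalPSLG P o s A)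
    (f : Set ℂ) (hf : IsFace P A f) (hnt : ¬ IsTriangularFace P f)
    (v : ℤ → ℂ) (m : ℕ) (hv : IsBoundaryWalk A f v m)
    (j : ℤ) (hj : IsStart v j)
    (J : ℤ → ℤ) (hJ : ∀ r, J r = remainingIndex o s f v m j r)
    (a : ℤ) (x y : ℂ) (hxy : A.Adj x y)
    (hvis : DeltaVisible f v (s / Real.sqrt 2) a x y) :
    (∃ r : ℤ, J r ≤ a ∧ a < J (r + 1)) ∧
    (∀ r : ℤ, J r < a → a < J (r + 1) →
      ∃ b : ℤ, v b = x ∧ v (b + 1) = y ∧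
        (({a, b, b + 1} : Set ℤ) ⊆ Set.Icc (J (r - 1)) (J (r + 1)) ∨
          ({a, b, b + 1} : Set ℤ) ⊆ Set.Icc (J r) (J (r + 2)))) ∧
    (∀ r : ℤ, a = J r →
      ∃ b : ℤ, v b = x ∧ v (b + 1) = y ∧
        (({a, b, b + 1} : Set ℤ) ⊆ Set.Icc (J r) (J (r + 1)) ∨
          ({a, b, b + 1} : Set ℤ) ⊆ Set.Icc (J (r - 1)) (J r))) := by
  have hs0 : 0 < s := by rw [hs]; positivity
  have hG := hA.pslg
  have hnear : ∀ k, Near o s (v k) (v (k + 1)) := fun k => hA.near (hv.adj k)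
  have hsees : ∀ k, ConvexAt v k → Sees f v (k - 1) (k + 1) := fun k hk =>
    hv.sees_of_convexAt hs0 hA hP hf hnt hk
  have hrefl : ∀ k, ¬ ConvexAt v k → ReflexAt v k := fun k hk =>
    hv.reflexAt_of_not_convexAt hG hP hk
  have hconf := hv.exists_of_deltaVisible hs0 hA hP hf hnt hxy hvis
  have hrec : ConvexRecurs v := by
    obtain ⟨c, hc⟩ : ∃ c, ConvexAt v c := by
      rcases hconf with ⟨c, -, -, -, hc, -⟩ | ⟨c, -, -, -, hc, -⟩ <;> exact ⟨c, hc⟩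
    have hm : (1 : ℤ) ≤ m := by exact_mod_cast hv.pos
    have hshift : ∀ q : ℤ, ConvexAt v (c + q * m) := fun q =>
      (convexAt_shift (T := q * m)
        (fun k => Function.Periodic.int_mul (f := v) (c := (m : ℤ)) hv.periodic q k) c).2 hc
    refine ⟨fun p => ⟨_, ?_, hshift (|p - c| + 1)⟩, fun p => ⟨_, ?_, hshift (-(|p - c| + 1))⟩⟩
    · have := le_abs_self (p - c)
      nlinarith [abs_nonneg (p - c)]
    · have := neg_abs_le (p - c)
      nlinarith [abs_nonneg (p - c)]
  obtain ⟨N, K, hN, hL, hK, hK'⟩ := exists_round hv hrec hnear hsees hrefl hj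
  have hchain : ∀ r, IsRemainingChain o s f v (J r) (J (r + 1)) := fun r => by
    rw [hJ, hJ]
    exact isRemainingChain_remainingIndex hv.periodic hrec hN hL hK hK' r
  have hmono : StrictMono J := strictMono_int_of_lt_succ fun r => (hchain r).lt
  refine ⟨exists_le_lt_of_strictMono hmono a, ?_⟩
  rcases hconf with ⟨c, hca, rfl, rfl, hc, hrun, hlink⟩ | ⟨c, hac, rfl, rfl, hc, hrun, hlink⟩
  · obtain ⟨ρ, hρ, hρ'⟩ := exists_le_lt_of_strictMono hmono (c - 1)
    -- the chain over the edge reaches the viewer, or stops one vertex before it, and then the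
    -- next chain passes over the viewer
    have hreach : a ≤ J (ρ + 1) ∨ J (ρ + 1) = a - 1 ∧ a < J (ρ + 2) := by
      have h1 : a - 1 ≤ J (ρ + 1) ∧ (ReflexAt v a → a ≤ J (ρ + 1)) := by
        rcases (hchain ρ).cover _ hρ hρ' with ⟨p, h1, h2, h3⟩ | ⟨h1, h2, h3⟩
        · obtain ⟨h4, h5⟩ := le_chainEnd_of_backward hrec hnear hsees hca hc hrun hlink
            (p := p) (by lia) (by lia)
          exact ⟨by lia, fun ha => by have := h5 ha; lia⟩
        · have h4 := forwardConvex_le (show J ρ < c by lia) hc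
          have h5 : forwardConvex v (J ρ) = c := by lia
          rw [h5] at h3
          have h6 : a = c + 1 := by
            by_contra hne
            exact (hrun (c + 1) (by lia) (by lia)).not_convexAt h3
          have h7 := (hchain ρ).stepOne h1
          exact ⟨by lia, fun _ => by lia⟩
      rcases le_or_gt a (J (ρ + 1)) with h2 | h2
      · exact Or.inl h2
      · have e : J (ρ + 1) = a - 1 := by lia
        have ha : ConvexAt v a := by
          by_contra ha
          exact absurd (h1.2 (hrefl a ha)) (not_le.2 h2)
        have hfa : forwardConvex v (a - 1) = a :=
          forwardConvex_eq (by lia) ha fun k _ _ => by lia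
        have hstep : StepOne o s f v (a - 1) := by
          refine ⟨by rwa [hfa], ?_, by rw [hfa]; exact hsees a ha⟩
          have := hnear (a - 1)
          rw [sub_add_cancel] at this
          rwa [hfa]
        have h3 := (hchain (ρ + 1)).stepOne (by rwa [e])
        rw [e, hfa, add_assoc] at h3
        exact Or.inr ⟨e, by have : a + 1 ≤ J (ρ + 2) := h3
                            lia⟩
    refine ⟨fun r hr hr' => ⟨c - 1, rfl, by rw [sub_add_cancel], ?_⟩,
      fun r hr => ⟨c - 1, rfl, by rw [sub_add_cancel], ?_⟩⟩
    · rcases hreach with h1 | ⟨h1, h2⟩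
      · right
        have h2 : J r ≤ J ρ := by
          have : r < ρ + 1 := hmono.lt_iff_lt.1 (by lia)
          exact hmono.monotone (by lia)
        have h3 : J (r + 1) < J (r + 2) := hmono (by lia)
        rintro k (rfl | rfl | rfl) <;> constructor <;> lia
      · left
        have h3 : J (r - 1) ≤ J ρ := by
          have : r < ρ + 2 := hmono.lt_iff_lt.1 (by lia)
          exact hmono.monotone (by lia)
        rintro k (rfl | rfl | rfl) <;> constructor <;> lia
    · right
      have h3 : J (r - 1) ≤ J ρ := by
        have : r < ρ + 2 := by
          rcases hreach with h1 | ⟨h1, h2⟩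
          · have : r ≤ ρ + 1 := hmono.le_iff_le.1 (by lia)
            lia
          · exact hmono.lt_iff_lt.1 (by lia)
        exact hmono.monotone (by lia)
      rintro k (rfl | rfl | rfl) <;> constructor <;> lia
  · -- Step 1 applies to all vertices from the viewer to the edge
    have hjump : ∀ r, a ≤ J r → J r < c → c + 1 ≤ J (r + 1) := by
      intro r h1 h2
      have hfc : forwardConvex v (J r) = c :=
        forwardConvex_eq h2 hc fun k h3 h4 => (hrun k (by lia) h4).not_convexAt
      have := (hchain r).stepOne
        ⟨by rwa [hfc], by rw [hfc]; exact (hlink _ h1 h2).1, by rw [hfc]; exact (hlink _ h1 h2).2⟩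
      rwa [hfc] at this
    refine ⟨fun r hr hr' => ⟨c, rfl, rfl, Or.inr ?_⟩, fun r hr => ⟨c, rfl, rfl, Or.inl ?_⟩⟩
    · have h1 : J (r + 1) < J (r + 2) := hmono (by lia)
      have h2 : c + 1 ≤ J (r + 2) := by
        rcases lt_or_ge (J (r + 1)) c with h3 | h3
        · have := hjump (r + 1) hr'.le h3
          rwa [add_assoc] at this
        · lia
      rintro k (rfl | rfl | rfl) <;> constructor <;> lia
    · have := hjump r hr.le (by lia)
      rintro k (rfl | rfl | rfl) <;> constructor <;> lia
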